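/- Let $G$ be a locally compact, $\sigma$-compact (Hausdorff) topological group with left Haar measure $dg$, put $G_2:=G\times\mathbb Z/2$, and let $A$ and $B$ be $\sigma$-unital $G_2$-$C^*$-algebras, i.e. $\sigma$-unital $C^*$-algebras with strongly continuous actions $\alpha,\beta$ of $G_2$ (the factor $\mathbb Z/2$ acts by the grading automorphism). Let $(E,\varphi,F)$ be an essential Kasparov triple for $A,B$. That is, $E$ is a countably generated Hilbert $B$-module with a strongly continuous compatible action $\gamma$ of $G_2$; $\varphi:A\to\mathbb L(E)$ is a $G_2$-equivariant $*$-homomorphism with $\varphi(A)E=E$; and $F\in\mathbb L(E)$ is odd and satisfies, with a graded commutator and $\gamma_g(F):=\gamma_gF\gamma_g^{-1}$, $$[F,\varphi(a)],\quad (1-F^2)\varphi(a),\quad (F-F^*)\varphi(a),\quad(\gamma_g(F)-F)\varphi(a)\ \in\ \mathbb K(E)\qquad\text{for all }a\in A,\ g\in G.$$ Let $L^2(G,E)$ be the Hilbert $B$-module obtained by completing $C_c(G,E)$ for the inner product $\langle f_1,f_2\rangle=\int_G\langle f_1(g),f_2(g)\rangle_B\,dg$, with the action $(hf)(g)=\gamma_h(f(\bar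 h^{-1}g))$ of $h\in G_2$, where $\bar h\in G$ is the first component of $h$; define $L^2(G,A)$ likewise, with $A$ regarded as a Hilbert module over itself. Let $E':=L^2(G,A)\,\hat\otimes_\varphi E$ be the interior tensor product with the diagonal action of $G_2$. (1) There is a $G_2$-equivariant unitary isomorphism of Hilbert $B$-modules $U:E'\to L^2(G,E)$ with $U(f\otimes\eta)(g)=\varphi(f(g))\eta$ for all $f\in C_c(G,A)$, $\eta\in E$. (2) There is an odd self-adjoint $F_0\in\mathbb L(E)$ with $\|F_0\|\le1$ that is a compact perturbation of $F$, that is, $(F_0-F)\varphi(a)$ and $\varphi(a)(F_0-F)$ belong to $\mathbb K(E)$ for all $a\in A$. (If $F$ is itself a self-adjoint contraction, $F_0=F$ is allowed.) (3) For every $F_0$ as in (2) there is an odd, $G$-equivariant, self-adjoint $F'\in\mathbb L(E')$ with $\|F'\|\le1$ that is given, under the isomorphism $U$, by $$(F'f)(g)=\gamma_g(F_0)\,f(g)=\gamma_g\bigl(F_0\,\gamma_g^{-1}f(g)\bigr)\qquad\text{for all }f\in C_c(G,E),\ g\in G,$$ and that is an $F$-connection: for every $\xi\in L^2(G,A)$,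 with $T_\xi:E\to E'$, $T_\xi\eta=\xi\otimes\eta$, the graded commutator $$\left[\begin{pmatrix}F&0\\0&F'\end{pmatrix},\begin{pmatrix}0&T_\xi^*\\T_\xi&0\end{pmatrix}\right]$$ belongs to $\mathbb K(E\oplus E')$. In particular, there is a $G$-equivariant $F$-connection on $E'$ that is a self-adjoint contraction. -/

import Mathlib

open scoped RightActions CompactlySupported TensorProduct InnerProductSpace Topology
open MeasureTheory Filter

set_option linter.unusedSectionVars false

noncomputable section

namespace EquivariantKK

/-! ### Hilbert modules -/

/-- A pre-Hilbert `B`-module: a complex vector space `V` with a right action `x <• b` of the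
C⋆-algebra `B` and a positive semidefinite `B`-valued inner product `⟪x, y⟫_B`, which is linear
in the second variable and satisfies `⟪x, y <• b⟫_B = ⟪x, y⟫_B * b`. -/
class PreHilbertModule (B V : Type*) [NonUnitalCStarAlgebra B] [PartialOrder B]
    [AddCommGroup V] [Module ℂ V] [SMul Bᵐᵒᵖ V] extends Inner B V where
  ip_add_right (x y z : V) : ⟪x, y + z⟫_B = ⟪x, y⟫_B + ⟪x, z⟫_B
  ip_smul_right (c : ℂ) (x y : V) : ⟪x, c • y⟫_B = c • ⟪x, y⟫_B
  ip_op_smul_right (b : B) (x y : V) : ⟪x, y <• b⟫_B = ⟪x, y⟫_B * b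
  star_ip (x y : V) : star ⟪x, y⟫_B = ⟪y, x⟫_B
  ip_self_nonneg (x : V) : 0 ≤ ⟪x, x⟫_B

/-- A (right) Hilbert `B`-module: a complex Banach space `E` with the structure of a pre-Hilbert
`B`-module such that `‖x‖ ^ 2 = ‖⟪x, x⟫_B‖`.  The laws of a right module, such as
`x <• (b * c) = (x <• b) <• c`, follow because the inner product is then definite. -/
class HilbertModule (B E : Type*) [NonUnitalCStarAlgebra B] [PartialOrder B]
    [NormedAddCommGroup E] [NormedSpace ℂ E] [CompleteSpace E] [SMul Bᵐᵒᵖ E]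
    extends PreHilbertModule B E where
  norm_sq_eq (x : E) : ‖x‖ ^ 2 = ‖⟪x, x⟫_B‖

namespace PreHilbertModule

section basic

variable {B V : Type*} [NonUnitalCStarAlgebra B] [PartialOrder B]
  [AddCommGroup V] [Module ℂ V] [SMul Bᵐᵒᵖ V] [PreHilbertModule B V]

lemma ip_add_left (x y z : V) : ⟪x + y, z⟫_B = ⟪x, z⟫_B + ⟪y, z⟫_B := by
  rw [← star_ip, ip_add_right, star_add, star_ip, star_ip]

lemma ip_smul_left (c : ℂ) (x y : V) : ⟪c • x, y⟫_B = star c • ⟪x, y⟫_B := by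
  rw [← star_ip, ip_smul_right, star_smul, star_ip]

lemma ip_op_smul_left (b : B) (x y : V) : ⟪x <• b, y⟫_B = star b * ⟪x, y⟫_B := by
  rw [← star_ip, ip_op_smul_right, star_mul, star_ip]

variable (B V) in
/-- The inner product as a sesquilinear map. -/
def ipₛₗ : V →ₗ⋆[ℂ] V →ₗ[ℂ] B :=
  LinearMap.mk₂'ₛₗ (starRingEnd ℂ) (RingHom.id ℂ) (fun x y => ⟪x, y⟫_B)
    ip_add_left (fun c x y => ip_smul_left c x y) ip_add_right
    (fun c x y => ip_smul_right c x y)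

lemma ipₛₗ_apply (x y : V) : ipₛₗ B V x y = ⟪x, y⟫_B := rfl

lemma ip_sub_right (x y z : V) : ⟪x, y - z⟫_B = ⟪x, y⟫_B - ⟪x, z⟫_B :=
  map_sub (ipₛₗ B V x) y z

lemma ip_sub_left (x y z : V) : ⟪x - y, z⟫_B = ⟪x, z⟫_B - ⟪y, z⟫_B := by
  rw [← star_ip, ip_sub_right, star_sub, star_ip, star_ip]

lemma ip_zero_right (x : V) : ⟪x, 0⟫_B = 0 := map_zero (ipₛₗ B V x)

lemma ip_zero_left (x : V) : ⟪0, x⟫_B = 0 := by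
  rw [← star_ip, ip_zero_right, star_zero]

variable [StarOrderedRing B]

/-- The Cauchy–Schwarz inequality for pre-Hilbert modules. -/
lemma norm_ip_sq_le (x y : V) : ‖⟪x, y⟫_B‖ ^ 2 ≤ ‖⟪x, x⟫_B‖ * ‖⟪y, y⟫_B‖ := by
  refine le_of_forall_pos_le_add fun ε hε => ?_
  obtain ⟨δ, hδ, hδε⟩ : ∃ δ : ℝ, 0 < δ ∧ δ * ‖⟪y, y⟫_B‖ ≤ ε := by
    refine ⟨ε / (‖⟪y, y⟫_B‖ + 1), by positivity, ?_⟩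
    rw [div_mul_eq_mul_div, div_le_iff₀ (by positivity)]
    nlinarith [norm_nonneg ⟪y, y⟫_B]
  set N : ℝ := ‖⟪x, x⟫_B‖ + δ with hN
  have hN0 : 0 < N := by positivity
  set b : B := ⟪x, y⟫_B with hb
  have hyx : ⟪y, x⟫_B = star b := (star_ip x y).symm
  have h1 : 0 ≤ star b * ⟪x, x⟫_B * b - (N : ℂ) • (star b * b) - (N : ℂ) • (star b * b)
      + (N : ℂ) • (N : ℂ) • ⟪y, y⟫_B := by
    have := ip_self_nonneg (B := B) (x <• b - (N : ℂ) • y)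
    rw [ip_sub_left, ip_sub_right, ip_sub_right, ip_op_smul_left, ip_op_smul_right,
      ip_smul_right, ip_smul_left, ip_smul_left, ip_smul_right, ip_op_smul_right,
      ip_op_smul_left, hyx, ← hb] at this
    convert this using 1
    simp [mul_assoc]
    abel
  have h2 : star b * ⟪x, x⟫_B * b ≤ (N : ℂ) • (star b * b) := by
    refine (CStarAlgebra.star_left_conjugate_le_norm_smul
      (hb := (ip_self_nonneg x).isSelfAdjoint)).trans ?_
    rw [← Complex.coe_smul]
    have : 0 ≤ star b * b := star_mul_self_nonneg b
    have hle : ‖⟪x, x⟫_B‖ ≤ N := by linarith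
    simpa only [Complex.coe_smul] using smul_le_smul_of_nonneg_right hle this
  have h3 : (N : ℂ) • (star b * b) ≤ (N : ℂ) • (N : ℂ) • ⟪y, y⟫_B := by
    rw [← sub_nonneg]
    have := add_nonneg h1 (sub_nonneg.2 h2)
    convert this using 1
    abel
  have h4 : star b * b ≤ N • ⟪y, y⟫_B := by
    rw [Complex.coe_smul, Complex.coe_smul] at h3
    exact (smul_le_smul_iff_of_pos_left hN0).1 h3
  have h5 := CStarAlgebra.norm_le_norm_of_nonneg_of_le (star_mul_self_nonneg b) h4
  rw [CStarRing.norm_star_mul_self, norm_smul, Real.norm_of_nonneg hN0.le] at h5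
  rw [sq]
  refine h5.trans ?_
  rw [hN, add_mul]
  linarith

end basic

/-! ### Completion of a pre-Hilbert module -/

/-- The vector space underlying a pre-Hilbert `B`-module, equipped with the seminorm
`‖x‖ = √‖⟪x, x⟫_B‖`. -/
@[nolint unusedArguments]
def Space (B V : Type*) [NonUnitalCStarAlgebra B] [PartialOrder B] [StarOrderedRing B]
    [AddCommGroup V] [Module ℂ V] [SMul Bᵐᵒᵖ V] [PreHilbertModule B V] : Type _ := V

section completion

variable {B V : Type*} [NonUnitalCStarAlgebra B] [PartialOrder B] [StarOrderedRing B]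
  [AddCommGroup V] [Module ℂ V] [SMul Bᵐᵒᵖ V] [PreHilbertModule B V]

instance : AddCommGroup (Space B V) := inferInstanceAs (AddCommGroup V)
instance : Module ℂ (Space B V) := inferInstanceAs (Module ℂ V)
instance : SMul Bᵐᵒᵖ (Space B V) := inferInstanceAs (SMul Bᵐᵒᵖ V)
instance : PreHilbertModule B (Space B V) := inferInstanceAs (PreHilbertModule B V)
instance : Norm (Space B V) := ⟨fun x => √‖⟪x, x⟫_B‖⟩

lemma space_norm_sq (x : Space B V) : ‖x‖ ^ 2 = ‖⟪x, x⟫_B‖ := Real.sq_sqrt (norm_nonneg _)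

lemma space_norm_nonneg (x : Space B V) : 0 ≤ ‖x‖ := Real.sqrt_nonneg _

lemma space_norm_ip_le (x y : Space B V) : ‖⟪x, y⟫_B‖ ≤ ‖x‖ * ‖y‖ := by
  refine abs_le_of_sq_le_sq' ?_ (mul_nonneg (space_norm_nonneg x) (space_norm_nonneg y)) |>.2
  rw [mul_pow, space_norm_sq, space_norm_sq]
  exact norm_ip_sq_le x y

lemma space_core : SeminormedSpace.Core ℂ (Space B V) where
  norm_nonneg x := space_norm_nonneg x
  norm_smul c x := by
    refine (sq_eq_sq₀ (space_norm_nonneg _) (mul_nonneg (norm_nonneg _) (space_norm_nonneg _))).1 ?_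
    rw [mul_pow, space_norm_sq, space_norm_sq, ip_smul_left, ip_smul_right, norm_smul, norm_smul,
      norm_star]
    ring
  norm_triangle x y := by
    refine abs_le_of_sq_le_sq' ?_ (add_nonneg (space_norm_nonneg x) (space_norm_nonneg y)) |>.2
    rw [space_norm_sq, ip_add_left, ip_add_right, ip_add_right]
    have h1 := space_norm_ip_le x y
    have h2 := space_norm_ip_le y x
    have h3 := space_norm_sq x
    have h4 := space_norm_sq y
    have h5 := norm_add_le (⟪x, x⟫_B + ⟪x, y⟫_B) (⟪y, x⟫_B + ⟪y, y⟫_B)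
    have h6 := norm_add_le ⟪x, x⟫_B ⟪x, y⟫_B
    have h7 := norm_add_le ⟪y, x⟫_B ⟪y, y⟫_B
    nlinarith

instance : SeminormedAddCommGroup (Space B V) := SeminormedAddCommGroup.ofCore (𝕜 := ℂ) space_core
instance : NormedSpace ℂ (Space B V) where
  norm_smul_le c x := (space_core.norm_smul c x).le

lemma continuous_space_ip : Continuous fun p : Space B V × Space B V => ⟪p.1, p.2⟫_B := by
  have h (x y : Space B V) : ‖ipₛₗ B (Space B V) x y‖ ≤ 1 * ‖x‖ * ‖y‖ := by
    simpa [ipₛₗ_apply] using space_norm_ip_le x y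
  have hL : Continuous fun p : Space B V × Space B V => (ipₛₗ B (Space B V)).mkContinuous₂ 1 h p.1 p.2 := by fun_prop
  exact hL

lemma space_norm_op_smul_sub (b : B) (x y : Space B V) :
    ‖x <• b - y <• b‖ ≤ ‖b‖ * ‖x - y‖ := by
  refine abs_le_of_sq_le_sq' ?_ (by positivity) |>.2
  have h : ⟪x <• b - y <• b, x <• b - y <• b⟫_B = star b * ⟪x - y, x - y⟫_B * b := by
    simp only [ip_sub_left, ip_sub_right, ip_op_smul_left, ip_op_smul_right, mul_sub,
      sub_mul, mul_assoc]
  rw [space_norm_sq, h, mul_pow, space_norm_sq]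
  calc ‖star b * ⟪x - y, x - y⟫_B * b‖ ≤ ‖star b‖ * ‖⟪x - y, x - y⟫_B‖ * ‖b‖ :=
        (norm_mul_le _ _).trans (by gcongr; exact norm_mul_le _ _)
    _ = _ := by rw [norm_star]; ring

instance : UniformContinuousConstSMul Bᵐᵒᵖ (Space B V) where
  uniformContinuous_const_smul b := by
    refine LipschitzWith.uniformContinuous (K := ‖b.unop‖₊) (LipschitzWith.of_dist_le_mul ?_)
    intro x y
    rw [dist_eq_norm, dist_eq_norm]
    exact space_norm_op_smul_sub b.unop x y

lemma continuous_completion_op_smul (b : B) :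
    Continuous fun x : UniformSpace.Completion (Space B V) => x <• b :=
  UniformSpace.Completion.continuous_map

open UniformSpace in
lemma completion_ip_coe (x y : Space B V) :
    ⟪(x : Completion (Space B V)), (y : Completion (Space B V))⟫_B = ⟪x, y⟫_B :=
  (Completion.isDenseInducing_coe.prodMap Completion.isDenseInducing_coe).extend_eq
    (f := Function.uncurry (inner B)) continuous_space_ip (x, y)

open UniformSpace in
lemma continuous_completion_ip : Continuous
    fun p : Completion (Space B V) × Completion (Space B V) => ⟪p.1, p.2⟫_B := by
  let i : Space B V →+ Space B V →+ B :=
    { toFun := fun x => (ipₛₗ B (Space B V) x).toAddMonoidHom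
      map_zero' := by ext x; exact ip_zero_left x
      map_add' := fun x y => by ext z; exact ip_add_left x y z }
  have : Continuous fun p : Space B V × Space B V => i p.1 p.2 := continuous_space_ip
  exact (Completion.isDenseInducing_toCompl (Space B V)).extend_Z_bilin
    (Completion.isDenseInducing_toCompl (Space B V)) this

open UniformSpace in
/-- The completion of a pre-Hilbert module is a Hilbert module. -/
instance completionHilbertModule : HilbertModule B (Completion (Space B V)) where
  ip_add_right x y z := by
    induction x, y, z using Completion.induction_on₃ with
    | hp =>
      exact isClosed_eq
        (continuous_completion_ip.comp (continuous_fst.prodMk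
          ((continuous_fst.comp continuous_snd).add (continuous_snd.comp continuous_snd))))
        ((continuous_completion_ip.comp
          (continuous_fst.prodMk (continuous_fst.comp continuous_snd))).add
          (continuous_completion_ip.comp
            (continuous_fst.prodMk (continuous_snd.comp continuous_snd))))
    | ih x y z =>
      rw [← Completion.coe_add]
      simp only [completion_ip_coe, ip_add_right]
  ip_smul_right c x y := by
    induction x, y using Completion.induction_on₂ with
    | hp =>
      exact isClosed_eq (continuous_completion_ip.comp
        (continuous_fst.prodMk (continuous_snd.const_smul c)))
        (continuous_completion_ip.const_smul c)
    | ih x y =>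
      rw [← Completion.coe_smul]
      simp only [completion_ip_coe, ip_smul_right]
  ip_op_smul_right b x y := by
    induction x, y using Completion.induction_on₂ with
    | hp =>
      exact isClosed_eq (continuous_completion_ip.comp
        (continuous_fst.prodMk ((continuous_completion_op_smul b).comp continuous_snd)))
        (continuous_completion_ip.mul continuous_const)
    | ih x y =>
      rw [← Completion.coe_smul]
      simp only [completion_ip_coe, ip_op_smul_right]
  star_ip x y := by
    induction x, y using Completion.induction_on₂ with
    | hp =>
      exact isClosed_eq continuous_completion_ip.star
        (continuous_completion_ip.comp continuous_swap)
    | ih x y => simp only [completion_ip_coe, star_ip]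
  ip_self_nonneg x := by
    induction x using Completion.induction_on with
    | hp =>
      exact isClosed_le continuous_const
        (continuous_completion_ip.comp (continuous_id.prodMk continuous_id))
    | ih x => simpa only [completion_ip_coe] using ip_self_nonneg x
  norm_sq_eq x := by
    induction x using Completion.induction_on with
    | hp =>
      exact isClosed_eq (by fun_prop)
        (continuous_completion_ip.comp (continuous_id.prodMk continuous_id)).norm
    | ih x => simpa only [completion_ip_coe, Completion.norm_coe] using space_norm_sq x

end completion

end PreHilbertModule

namespace HilbertModule

open PreHilbertModule

variable {B E : Type*} [NonUnitalCStarAlgebra B] [PartialOrder B] [StarOrderedRing B]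
  [NormedAddCommGroup E] [NormedSpace ℂ E] [CompleteSpace E] [SMul Bᵐᵒᵖ E] [HilbertModule B E]

lemma norm_ip_le (x y : E) : ‖⟪x, y⟫_B‖ ≤ ‖x‖ * ‖y‖ := by
  refine abs_le_of_sq_le_sq' ?_ (by positivity) |>.2
  rw [mul_pow, norm_sq_eq (B := B) x, norm_sq_eq (B := B) y]
  exact norm_ip_sq_le x y

variable (B E) in
lemma continuous_ip : Continuous fun p : E × E => ⟪p.1, p.2⟫_B := by
  have h (x y : E) : ‖ipₛₗ B E x y‖ ≤ 1 * ‖x‖ * ‖y‖ := by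
    simpa [ipₛₗ_apply] using norm_ip_le x y
  have hL : Continuous fun p : E × E => (ipₛₗ B E).mkContinuous₂ 1 h p.1 p.2 := by fun_prop
  exact hL

lemma _root_.Continuous.ip {X : Type*} [TopologicalSpace X] {f g : X → E} (hf : Continuous f)
    (hg : Continuous g) : Continuous fun x => ⟪f x, g x⟫_B :=
  (continuous_ip B E).comp (hf.prodMk hg)

lemma ext_ip {x y : E} (h : ∀ z : E, ⟪z, x⟫_B = ⟪z, y⟫_B) : x = y := by
  rw [← sub_eq_zero, ← norm_eq_zero, ← sq_eq_zero_iff, norm_sq_eq (B := B), ip_sub_right, h,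
    sub_self, norm_zero]

variable (E) in
/-- Right multiplication by an element of the C⋆-algebra. -/
def opSMul (b : B) : E →L[ℂ] E :=
  LinearMap.mkContinuous
    { toFun := fun x => x <• b
      map_add' := fun x y => ext_ip (B := B) fun z => by
        simp only [ip_op_smul_right, ip_add_right, add_mul]
      map_smul' := fun c x => ext_ip (B := B) fun z => by
        simp only [ip_op_smul_right, ip_smul_right, RingHom.id_apply, smul_mul_assoc] }
    ‖b‖ (fun x => by
      refine abs_le_of_sq_le_sq' ?_ (by positivity) |>.2
      change ‖x <• b‖ ^ 2 ≤ _
      rw [mul_pow, norm_sq_eq (B := B) (x <• b), norm_sq_eq (B := B) x, ip_op_smul_left,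
        ip_op_smul_right]
      calc ‖star b * (⟪x, x⟫_B * b)‖ ≤ ‖star b‖ * (‖⟪x, x⟫_B‖ * ‖b‖) :=
            (norm_mul_le _ _).trans (by gcongr; exact norm_mul_le _ _)
        _ = _ := by rw [norm_star]; ring)

lemma opSMul_apply (b : B) (x : E) : opSMul E b x = x <• b := rfl

end HilbertModule

/-- The completion of a pre-Hilbert module, which is a Hilbert module. -/
def HilbertCompletion (B V : Type*) [NonUnitalCStarAlgebra B] [PartialOrder B]
    [StarOrderedRing B] [AddCommGroup V] [Module ℂ V] [SMul Bᵐᵒᵖ V] [PreHilbertModule B V] :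
    Type _ :=
  UniformSpace.Completion (PreHilbertModule.Space B V)

namespace HilbertCompletion

open PreHilbertModule

variable {B V : Type*} [NonUnitalCStarAlgebra B] [PartialOrder B] [StarOrderedRing B]
  [AddCommGroup V] [Module ℂ V] [SMul Bᵐᵒᵖ V] [PreHilbertModule B V]

instance : NormedAddCommGroup (HilbertCompletion B V) :=
  inferInstanceAs (NormedAddCommGroup (UniformSpace.Completion (Space B V)))
instance : NormedSpace ℂ (HilbertCompletion B V) :=
  inferInstanceAs (NormedSpace ℂ (UniformSpace.Completion (Space B V)))
instance : CompleteSpace (HilbertCompletion B V) :=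
  inferInstanceAs (CompleteSpace (UniformSpace.Completion (Space B V)))
instance : SMul Bᵐᵒᵖ (HilbertCompletion B V) :=
  inferInstanceAs (SMul Bᵐᵒᵖ (UniformSpace.Completion (Space B V)))
instance : HilbertModule B (HilbertCompletion B V) :=
  inferInstanceAs (HilbertModule B (UniformSpace.Completion (Space B V)))

variable (B V) in
/-- The canonical map from a pre-Hilbert module to its completion. -/
def of : V →ₗ[ℂ] HilbertCompletion B V :=
  { toFun := fun x => UniformSpace.Completion.coe' (α := Space B V) x
    map_add' := fun x y => UniformSpace.Completion.coe_add (α := Space B V) x y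
    map_smul' := fun c x => UniformSpace.Completion.coe_smul (X := Space B V) c x }

lemma ip_of (x y : V) : ⟪of B V x, of B V y⟫_B = ⟪x, y⟫_B :=
  completion_ip_coe (B := B) (V := V) x y

lemma of_op_smul (x : V) (b : B) : of B V (x <• b) = of B V x <• b :=
  UniformSpace.Completion.coe_smul (X := Space B V) (MulOpposite.op b) x

lemma denseRange_of : DenseRange (of B V) :=
  UniformSpace.Completion.denseRange_coe (α := Space B V)

lemma norm_of_sq (x : V) : ‖of B V x‖ ^ 2 = ‖⟪x, x⟫_B‖ := by
  rw [HilbertModule.norm_sq_eq (B := B), ip_of]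

/-- The continuous extension of a bounded linear map on a pre-Hilbert module. -/
def extend {F : Type*} [NormedAddCommGroup F] [NormedSpace ℂ F] [CompleteSpace F]
    (T : V →ₗ[ℂ] F) (C : ℝ) (_h : ∀ x, ‖T x‖ ≤ C * ‖of B V x‖) : HilbertCompletion B V →L[ℂ] F :=
  T.extendOfNorm (of B V)

lemma extend_of {F : Type*} [NormedAddCommGroup F] [NormedSpace ℂ F] [CompleteSpace F]
    (T : V →ₗ[ℂ] F) (C : ℝ) (h : ∀ x, ‖T x‖ ≤ C * ‖of B V x‖) (x : V) :
    extend T C h (of B V x) = T x :=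
  LinearMap.extendOfNorm_eq denseRange_of ⟨C, h⟩ x

end HilbertCompletion

/-- A C⋆-algebra as a Hilbert module over itself, with `⟪a, b⟫ = star a * b`. -/
instance selfHilbertModule {B : Type*} [NonUnitalCStarAlgebra B] [PartialOrder B]
    [StarOrderedRing B] : HilbertModule B B where
  inner x y := star x * y
  ip_add_right := fun x y z => mul_add _ _ _
  ip_smul_right := fun c x y => mul_smul_comm _ _ _
  ip_op_smul_right := fun b x y => (mul_assoc _ _ _).symm
  star_ip := fun x y => by
    simp [star_mul]
  ip_self_nonneg := fun x => star_mul_self_nonneg x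
  norm_sq_eq := fun x => by
    rw [CStarRing.norm_star_mul_self, sq]

/-! ### Adjointable and compact operators -/

section operators

variable (B : Type*) {E F : Type*} [NormedAddCommGroup E] [NormedSpace ℂ E]
  [NormedAddCommGroup F] [NormedSpace ℂ F]

/-- `S` is the adjoint of `T` with respect to the `B`-valued inner products. -/
def IsAdjointPair [Inner B E] [Inner B F] (T : E →L[ℂ] F) (S : F →L[ℂ] E) : Prop :=
  ∀ x y, ⟪T x, y⟫_B = ⟪x, S y⟫_B

/-- `T` is an adjointable operator, that is, `T ∈ 𝕃(E, F)`. -/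
def IsAdjointable [Inner B E] [Inner B F] (T : E →L[ℂ] F) : Prop :=
  ∃ S, IsAdjointPair B T S

variable (E F) in
/-- The compact operators `𝕂(E, F)`: the operator norm closure of the linear span of the rank one
operators `|x⟩⟨y| : z ↦ x <• ⟪y, z⟫_B`. -/
def compactOperators [Inner B E] [SMul Bᵐᵒᵖ F] : Submodule ℂ (E →L[ℂ] F) :=
  (Submodule.span ℂ {T : E →L[ℂ] F | ∃ (x : F) (y : E), ∀ z, T z = x <• ⟪y, z⟫_B}).topologicalClosure

end operators

/-- A ⋆-homomorphism `φ : A → 𝕃(E)` from a C⋆-algebra `A` to the adjointable operators on the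
Hilbert `B`-module `E`. -/
structure StarRep (A B E : Type*) [NonUnitalCStarAlgebra A] [NonUnitalCStarAlgebra B]
    [PartialOrder B] [NormedAddCommGroup E] [NormedSpace ℂ E] [CompleteSpace E] [SMul Bᵐᵒᵖ E]
    [HilbertModule B E] where
  toHom : A →ₙₐ[ℂ] (E →L[ℂ] E)
  adjoint : ∀ a, IsAdjointPair B (toHom a) (toHom (star a))

namespace StarRep

variable {A B E : Type*} [NonUnitalCStarAlgebra A] [NonUnitalCStarAlgebra B]
    [PartialOrder B] [NormedAddCommGroup E] [NormedSpace ℂ E] [CompleteSpace E] [SMul Bᵐᵒᵖ E]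
    [HilbertModule B E]

instance : CoeFun (StarRep A B E) fun _ => A → E →L[ℂ] E := ⟨fun φ => φ.toHom⟩

/-- `φ` is essential iff `φ(A) · E = E`. -/
def IsEssential (φ : StarRep A B E) : Prop := ∀ x : E, ∃ (a : A) (y : E), φ a y = x

lemma ip_left (φ : StarRep A B E) (a : A) (x y : E) : ⟪φ a x, y⟫_B = ⟪x, φ (star a) y⟫_B :=
  φ.adjoint a x y

lemma ip_right (φ : StarRep A B E) (a : A) (x y : E) : ⟪x, φ a y⟫_B = ⟪φ (star a) x, y⟫_B := by
  rw [ip_left, star_star]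

end StarRep

/-! ### Group actions -/

/-- A strongly continuous action of the topological group `H` on the C⋆-algebra `A` by
⋆-automorphisms. -/
structure CStarAction (H A : Type*) [Group H] [TopologicalSpace H] [NonUnitalCStarAlgebra A] where
  toHom : H →* (A ≃⋆ₐ[ℂ] A)
  continuous : ∀ a, Continuous fun h => toHom h a

instance {H A : Type*} [Group H] [TopologicalSpace H] [NonUnitalCStarAlgebra A] :
    CoeFun (CStarAction H A) fun _ => H → A ≃⋆ₐ[ℂ] A := ⟨fun α => α.toHom⟩

/-- A strongly continuous linear action `γ` of `H` on the Hilbert `B`-module `E` that is compatible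
with the action `β` of `H` on `B`. -/
structure HilbertAction {H B : Type*} [Group H] [TopologicalSpace H] [NonUnitalCStarAlgebra B]
    [PartialOrder B] (β : CStarAction H B) (E : Type*) [NormedAddCommGroup E] [NormedSpace ℂ E]
    [CompleteSpace E] [SMul Bᵐᵒᵖ E] [HilbertModule B E] where
  toHom : H →* (E →L[ℂ] E)
  map_op_smul : ∀ h x (b : B), toHom h (x <• b) = toHom h x <• β h b
  ip_map : ∀ h x y, ⟪toHom h x, toHom h y⟫_B = β h ⟪x, y⟫_B
  continuous : ∀ x, Continuous fun h => toHom h x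

instance {H B : Type*} [Group H] [TopologicalSpace H] [NonUnitalCStarAlgebra B]
    [PartialOrder B] (β : CStarAction H B) (E : Type*) [NormedAddCommGroup E] [NormedSpace ℂ E]
    [CompleteSpace E] [SMul Bᵐᵒᵖ E] [HilbertModule B E] :
    CoeFun (HilbertAction β E) fun _ => H → E →L[ℂ] E := ⟨fun γ => γ.toHom⟩

lemma StarAlgEquiv_norm_map {B : Type*} [NonUnitalCStarAlgebra B] (f : B ≃⋆ₐ[ℂ] B) (b : B) :
    ‖f b‖ = ‖b‖ :=
  NonUnitalStarAlgHom.norm_map f f.injective b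

/-- A ⋆-automorphism as a linear isometry. -/
def isometryOfAut {B : Type*} [NonUnitalCStarAlgebra B] (f : B ≃⋆ₐ[ℂ] B) : B →ₗᵢ[ℂ] B where
  toFun := f
  map_add' := map_add f
  map_smul' := map_smul f
  norm_map' := StarAlgEquiv_norm_map f

/-- The action on a C⋆-algebra, viewed as an action on the Hilbert module over itself. -/
def CStarAction.onSelf {H B : Type*} [Group H] [TopologicalSpace H] [NonUnitalCStarAlgebra B]
    [PartialOrder B] [StarOrderedRing B] (β : CStarAction H B) : HilbertAction β B where
  toHom :=
    { toFun := fun h => (isometryOfAut (β h)).toContinuousLinearMap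
      map_one' := by ext b; simp [isometryOfAut]
      map_mul' := fun g h => by ext b; simp [isometryOfAut] }
  map_op_smul := fun h x b => map_mul (β h) x b
  ip_map := fun h x y => by
    change star (β h x) * β h y = β h (star x * y)
    rw [map_mul, map_star]
  continuous := β.continuous

/-- `φ` is equivariant iff `γ_h (φ(a) x) = φ(α_h(a)) γ_h(x)`. -/
def StarRep.IsEquivariant {H A B E : Type*} [Group H] [TopologicalSpace H]
    [NonUnitalCStarAlgebra A] [NonUnitalCStarAlgebra B] [PartialOrder B]
    [NormedAddCommGroup E] [NormedSpace ℂ E] [CompleteSpace E] [SMul Bᵐᵒᵖ E] [HilbertModule B E]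
    {β : CStarAction H B} (φ : StarRep A B E) (α : CStarAction H A) (γ : HilbertAction β E) :
    Prop :=
  ∀ h a x, γ h (φ a x) = φ (α h a) (γ h x)

open PreHilbertModule

/-! ### Extending actions to completions -/

section extend

variable {B V : Type*} [NonUnitalCStarAlgebra B] [PartialOrder B] [StarOrderedRing B]
  [AddCommGroup V] [Module ℂ V] [SMul Bᵐᵒᵖ V] [PreHilbertModule B V]

/-- A linear action of `H` on a pre-Hilbert module that is compatible with an action on `B`. -/
structure PreAction {H : Type*} [Group H] [TopologicalSpace H] (β : CStarAction H B) (V : Type*)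
    [AddCommGroup V] [Module ℂ V] [SMul Bᵐᵒᵖ V] [PreHilbertModule B V] where
  toHom : H →* (V →ₗ[ℂ] V)
  ip_map : ∀ h x y, ⟪toHom h x, toHom h y⟫_B = β h ⟪x, y⟫_B
  tendsto : ∀ x, Tendsto (fun h => ⟪toHom h x, x⟫_B) (𝓝 1) (𝓝 ⟪x, x⟫_B)

namespace PreAction

variable {H : Type*} [Group H] [TopologicalSpace H] {β : CStarAction H B}

lemma norm_of_toHom (γ : PreAction β V) (h : H) (x : V) :
    ‖HilbertCompletion.of B V (γ.toHom h x)‖ = ‖HilbertCompletion.of B V x‖ := by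
  refine (sq_eq_sq₀ (norm_nonneg _) (norm_nonneg _)).1 ?_
  rw [HilbertCompletion.norm_of_sq, HilbertCompletion.norm_of_sq, γ.ip_map, StarAlgEquiv_norm_map]

/-- The operators on the completion that come from a `PreAction`. -/
def extend (γ : PreAction β V) (h : H) : HilbertCompletion B V →L[ℂ] HilbertCompletion B V :=
  HilbertCompletion.extend ((HilbertCompletion.of B V).comp (γ.toHom h)) 1 fun x => by
    rw [one_mul, LinearMap.comp_apply, γ.norm_of_toHom]

lemma extend_of (γ : PreAction β V) (h : H) (x : V) :
    γ.extend h (HilbertCompletion.of B V x) = HilbertCompletion.of B V (γ.toHom h x) :=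
  HilbertCompletion.extend_of _ _ _ x

lemma extend_one (γ : PreAction β V) : γ.extend 1 = 1 := by
  ext x
  induction x using HilbertCompletion.denseRange_of.induction_on with
  | hp => exact isClosed_eq (γ.extend 1).continuous continuous_id
  | ih x => rw [extend_of, map_one]; rfl

lemma extend_mul (γ : PreAction β V) (g h : H) : γ.extend (g * h) = γ.extend g * γ.extend h := by
  refine ContinuousLinearMap.ext fun x => ?_
  change γ.extend (g * h) x = γ.extend g (γ.extend h x)
  induction x using HilbertCompletion.denseRange_of.induction_on with
  | hp =>
    exact isClosed_eq (γ.extend (g * h)).continuous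
      ((γ.extend g).continuous.comp (γ.extend h).continuous)
  | ih x => rw [extend_of, extend_of, extend_of, map_mul]; rfl

lemma ip_extend (γ : PreAction β V) (h : H) (x y : HilbertCompletion B V) :
    ⟪γ.extend h x, γ.extend h y⟫_B = β h ⟪x, y⟫_B := by
  have hβ : Continuous (β h) := (isometryOfAut (β h)).continuous
  have hγ : Continuous (γ.extend h) := (γ.extend h).continuous
  induction x using HilbertCompletion.denseRange_of.induction_on with
  | hp =>
    exact isClosed_eq (hγ.ip continuous_const) (hβ.comp (continuous_id.ip continuous_const))
  | ih x =>
    induction y using HilbertCompletion.denseRange_of.induction_on with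
    | hp =>
      exact isClosed_eq (continuous_const.ip hγ) (hβ.comp (continuous_const.ip continuous_id))
    | ih y => rw [extend_of, extend_of, HilbertCompletion.ip_of, HilbertCompletion.ip_of, γ.ip_map]

lemma norm_extend (γ : PreAction β V) (h : H) (x : HilbertCompletion B V) :
    ‖γ.extend h x‖ = ‖x‖ := by
  refine (sq_eq_sq₀ (norm_nonneg _) (norm_nonneg _)).1 ?_
  rw [HilbertModule.norm_sq_eq (B := B) (γ.extend h x), HilbertModule.norm_sq_eq (B := B) x,
    γ.ip_extend, StarAlgEquiv_norm_map]

lemma tendsto_of (γ : PreAction β V) (x : V) :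
    Tendsto (fun h => γ.extend h (HilbertCompletion.of B V x)) (𝓝 1)
      (𝓝 (HilbertCompletion.of B V x)) := by
  rw [tendsto_iff_norm_sub_tendsto_zero]
  have h0 : Tendsto (fun h => ‖γ.extend h (HilbertCompletion.of B V x)
      - HilbertCompletion.of B V x‖ ^ 2) (𝓝 1) (𝓝 0) := by
    have hβ : Tendsto (fun h => β h ⟪x, x⟫_B) (𝓝 1) (𝓝 ⟪x, x⟫_B) := by
      have := (β.continuous ⟪x, x⟫_B).tendsto 1
      simpa using this
    have ht := γ.tendsto x
    have hts := ht.star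
    rw [star_ip] at hts
    have := (((hβ.sub hts).sub ht).add (tendsto_const_nhds (x := ⟪x, x⟫_B))).norm
    have hz : ‖⟪x, x⟫_B - ⟪x, x⟫_B - ⟪x, x⟫_B + ⟪x, x⟫_B‖ = 0 := by simp
    rw [hz] at this
    refine this.congr fun h => ?_
    rw [HilbertModule.norm_sq_eq (B := B), ip_sub_left, ip_sub_right, ip_sub_right, γ.ip_extend,
      γ.extend_of, HilbertCompletion.ip_of, HilbertCompletion.ip_of, HilbertCompletion.ip_of,
      star_ip]
    congr 1
    abel
  have := h0.sqrt
  simpa using this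

lemma tendsto_one (γ : PreAction β V) (x : HilbertCompletion B V) :
    Tendsto (fun h => γ.extend h x) (𝓝 1) (𝓝 x) := by
  rw [Metric.tendsto_nhds]
  intro ε hε
  obtain ⟨y, hy⟩ := HilbertCompletion.denseRange_of.exists_dist_lt x (show 0 < ε / 3 by positivity)
  filter_upwards [Metric.tendsto_nhds.1 (γ.tendsto_of y) (ε / 3) (by positivity)] with h hh
  set y' := HilbertCompletion.of B V y
  have h1 : dist (γ.extend h x) (γ.extend h y') = dist x y' := by
    rw [dist_eq_norm, dist_eq_norm, ← map_sub, γ.norm_extend]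
  have h2 := dist_triangle4 (γ.extend h x) (γ.extend h y') y' x
  rw [h1, dist_comm y' x] at h2
  linarith

/-- A `PreAction` extends to an action on the completion. -/
def completion [IsTopologicalGroup H] (γ : PreAction β V) :
    HilbertAction β (HilbertCompletion B V) where
  toHom :=
    { toFun := γ.extend
      map_one' := γ.extend_one
      map_mul' := γ.extend_mul }
  ip_map := γ.ip_extend
  map_op_smul := fun h x b => by
    change γ.extend h (x <• b) = γ.extend h x <• β h b
    refine HilbertModule.ext_ip (B := B) fun z => ?_
    have hz : z = γ.extend h (γ.extend h⁻¹ z) := by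
      rw [← mul_apply_eq_comp, ← γ.extend_mul, mul_inv_cancel, γ.extend_one]
      rfl
    rw [hz, ip_op_smul_right, γ.ip_extend, γ.ip_extend, ip_op_smul_right, map_mul]
  continuous := fun x => by
    rw [continuous_iff_continuousAt]
    intro g
    have h1 : Tendsto (fun h => g⁻¹ * h) (𝓝 g) (𝓝 1) := by
      have : Continuous fun h : H => g⁻¹ * h := by fun_prop
      simpa using this.tendsto g
    have h2 := ((γ.extend g).continuous.tendsto x).comp ((γ.tendsto_one x).comp h1)
    refine h2.congr fun h => ?_
    change γ.extend g (γ.extend (g⁻¹ * h) x) = γ.extend h x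
    rw [← mul_apply_eq_comp, ← γ.extend_mul, mul_inv_cancel_left]

end PreAction

end extend

section gram

variable {A E : Type*} [NonUnitalCStarAlgebra A] [PartialOrder A] [StarOrderedRing A]
  [NormedAddCommGroup E] [NormedSpace ℂ E] [CompleteSpace E] [SMul Aᵐᵒᵖ E] [HilbertModule A E]

lemma exists_negPart {M : Type*} [NonUnitalCStarAlgebra M] [PartialOrder M] [StarOrderedRing M]
    (a : M) (ha : IsSelfAdjoint a) :
    ∃ n : M, IsSelfAdjoint n ∧ n * a * n = -(n * n * n) ∧ (∃ d, n * n * n = star d * d) ∧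
      (n = 0 → ∃ c, a = star c * c) := by
  refine ⟨a⁻, (CFC.negPart_nonneg a).isSelfAdjoint, ?_, ?_, fun h => ?_⟩
  · have h : a⁻ * a = -(a⁻ * a⁻) := by
      calc a⁻ * a = a⁻ * (a⁺ - a⁻) := by rw [CFC.posPart_sub_negPart a ha]
        _ = _ := by rw [mul_sub, CFC.negPart_mul_posPart, zero_sub]
    rw [h, neg_mul]
  · refine CStarAlgebra.nonneg_iff_eq_star_mul_self.1 ?_
    have := star_left_conjugate_nonneg (CFC.negPart_nonneg a) a⁻
    rwa [(CFC.negPart_nonneg a).isSelfAdjoint.star_eq] at this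
  · exact CStarAlgebra.nonneg_iff_eq_star_mul_self.1 ((CFC.negPart_eq_zero_iff a ha).1 h)

lemma ip_sum_right {ι : Type*} (s : Finset ι) (x : E) (y : ι → E) :
    ⟪x, ∑ i ∈ s, y i⟫_A = ∑ i ∈ s, ⟪x, y i⟫_A := map_sum (ipₛₗ A E x) y s

lemma ip_sum_left {ι : Type*} (s : Finset ι) (x : ι → E) (y : E) :
    ⟪∑ i ∈ s, x i, y⟫_A = ∑ i ∈ s, ⟪x i, y⟫_A := by
  rw [← star_ip, ip_sum_right, star_sum]
  simp only [star_ip]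

/-- Gram matrices in Hilbert modules are positive. -/
lemma gram_nonneg {ι : Type*} [Fintype ι] (x : ι → E) :
    ∃ C : ι → ι → A, ∀ i j, ⟪x i, x j⟫_A = ∑ k, star (C k i) * C k j := by
  let M : CStarMatrix ι ι A := CStarMatrix.ofMatrix fun i j => ⟪x i, x j⟫_A
  have hMs : IsSelfAdjoint M := by
    ext i j
    exact star_ip _ _
  obtain ⟨N, hNs, hNMN, ⟨D, hD⟩, hNM⟩ := exists_negPart M hMs
  have hNij : ∀ i j, star (N i j) = N j i := fun i j => CStarMatrix.star_apply_of_isSelfAdjoint hNs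
  have hdiag : ∀ j, (N * N * N) j j = 0 := by
    intro j
    have h1 : (N * M * N) j j = ⟪∑ i, x i <• N i j, ∑ k, x k <• N k j⟫_A := by
      simp only [ip_sum_left, ip_sum_right, ip_op_smul_left, ip_op_smul_right,
        CStarMatrix.mul_apply, Finset.sum_mul, hNij]
      rfl
    have h2 : 0 ≤ (N * M * N) j j := h1 ▸ ip_self_nonneg _
    have h4 : 0 ≤ (N * N * N) j j := by
      rw [hD, CStarMatrix.mul_apply]
      exact Finset.sum_nonneg fun k _ => star_mul_self_nonneg (D k j)
    rw [hNMN] at h2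
    exact le_antisymm (neg_nonneg.1 h2) h4
  have hD0 : D = 0 := by
    ext k j
    have h := hdiag j
    rw [hD, CStarMatrix.mul_apply] at h
    have := (Finset.sum_eq_zero_iff_of_nonneg
      (fun k _ => star_mul_self_nonneg (D k j))).1 h k (Finset.mem_univ k)
    exact (CStarRing.star_mul_self_eq_zero_iff _).1 this
  have hN3 : N * N * N = 0 := by rw [hD, hD0, mul_zero]
  have hNN : N * N = 0 := by
    have : star (N * N) * (N * N) = 0 := by
      rw [star_mul, hNs.star_eq, ← mul_assoc, hN3, zero_mul]
    exact (CStarRing.star_mul_self_eq_zero_iff _).1 this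
  have hN0 : N = 0 := by
    have : star N * N = 0 := by rw [hNs.star_eq, hNN]
    exact (CStarRing.star_mul_self_eq_zero_iff _).1 this
  obtain ⟨C, hC⟩ := hNM hN0
  refine ⟨C, fun i j => ?_⟩
  change M i j = _
  rw [hC, CStarMatrix.mul_apply]
  rfl

end gram

/-! ### The interior tensor product -/

/-- The algebraic tensor product over `ℂ` of `E₁` and `E₂`, which is a pre-Hilbert module by means
of `φ : A → 𝕃(E₂)`. -/
@[nolint unusedArguments]
def AlgTensor {A B E₂ : Type*} [NonUnitalCStarAlgebra A] [NonUnitalCStarAlgebra B] [PartialOrder B]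
    [NormedAddCommGroup E₂] [NormedSpace ℂ E₂] [CompleteSpace E₂] [SMul Bᵐᵒᵖ E₂]
    [HilbertModule B E₂] (E₁ : Type*) [NormedAddCommGroup E₁] [NormedSpace ℂ E₁]
    (_φ : StarRep A B E₂) : Type _ :=
  E₁ ⊗[ℂ] E₂

namespace AlgTensor

variable {A B E₁ E₂ : Type*} [NonUnitalCStarAlgebra A] [PartialOrder A] [StarOrderedRing A]
  [NonUnitalCStarAlgebra B] [PartialOrder B] [StarOrderedRing B]
  [NormedAddCommGroup E₁] [NormedSpace ℂ E₁] [CompleteSpace E₁] [SMul Aᵐᵒᵖ E₁] [HilbertModule A E₁]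
  [NormedAddCommGroup E₂] [NormedSpace ℂ E₂] [CompleteSpace E₂] [SMul Bᵐᵒᵖ E₂] [HilbertModule B E₂]
  (φ : StarRep A B E₂)

instance : AddCommGroup (AlgTensor E₁ φ) := inferInstanceAs (AddCommGroup (E₁ ⊗[ℂ] E₂))
instance : Module ℂ (AlgTensor E₁ φ) := inferInstanceAs (Module ℂ (E₁ ⊗[ℂ] E₂))

/-- The right action of `B` with `(x ⊗ y) <• b = x ⊗ (y <• b)`. -/
instance : SMul Bᵐᵒᵖ (AlgTensor E₁ φ) where
  smul b := (HilbertModule.opSMul E₂ b.unop).toLinearMap.lTensor E₁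

/-- The elementary tensor `x ⊗ y`. -/
def tmul (x : E₁) (y : E₂) : AlgTensor E₁ φ := x ⊗ₜ[ℂ] y

variable {φ} in
lemma induction {P : AlgTensor E₁ φ → Prop} (t : AlgTensor E₁ φ) (h0 : P 0)
    (h1 : ∀ x y, P (tmul φ x y)) (h2 : ∀ s t, P s → P t → P (s + t)) : P t :=
  TensorProduct.induction_on t h0 h1 h2

lemma tmul_op_smul (x : E₁) (y : E₂) (b : B) : tmul φ x y <• b = tmul φ x (y <• b) := rfl

lemma add_op_smul (s t : AlgTensor E₁ φ) (b : B) : (s + t) <• b = s <• b + t <• b :=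
  map_add ((HilbertModule.opSMul E₂ b).toLinearMap.lTensor E₁) s t

/-- The sesquilinear form with `(x ⊗ y, x' ⊗ y') ↦ ⟪y, φ(⟪x, x'⟫) y'⟫`. -/
def form : (E₁ ⊗[ℂ] E₂) →ₗ⋆[ℂ] (E₁ ⊗[ℂ] E₂) →ₗ[ℂ] B :=
  TensorProduct.lift (LinearMap.mk₂'ₛₗ (starRingEnd ℂ) (starRingEnd ℂ)
    (fun (x : E₁) (y : E₂) => TensorProduct.lift (LinearMap.mk₂ ℂ
      (fun (x' : E₁) (y' : E₂) => ⟪y, φ ⟪x, x'⟫_A y'⟫_B)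
      (fun _ _ _ => by simp [ip_add_right])
      (fun _ _ _ => by simp [ip_smul_right])
      (fun _ _ _ => by simp [ip_add_right])
      (fun _ _ _ => by simp [ip_smul_right])))
    (fun _ _ _ => by ext; simp [ip_add_left, ip_add_right])
    (fun _ _ _ => by ext; simp [ip_smul_left, ip_smul_right])
    (fun _ _ _ => by ext; simp [ip_add_left])
    (fun _ _ _ => by ext; simp [ip_smul_left]))

instance : Inner B (AlgTensor E₁ φ) := ⟨fun s t => form φ s t⟩

lemma ip_tmul (x x' : E₁) (y y' : E₂) :
    ⟪tmul φ x y, tmul φ x' y'⟫_B = ⟪y, φ ⟪x, x'⟫_A y'⟫_B := rfl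

lemma ip_add_r (s t u : AlgTensor E₁ φ) : ⟪s, t + u⟫_B = ⟪s, t⟫_B + ⟪s, u⟫_B :=
  map_add (form φ s) t u

lemma ip_add_l (s t u : AlgTensor E₁ φ) : ⟪s + t, u⟫_B = ⟪s, u⟫_B + ⟪t, u⟫_B :=
  LinearMap.map_add₂ (form φ) s t u

lemma ip_zero_r (s : AlgTensor E₁ φ) : ⟪s, 0⟫_B = 0 := map_zero (form φ s)

lemma ip_zero_l (s : AlgTensor E₁ φ) : ⟪0, s⟫_B = 0 := LinearMap.map_zero₂ (form φ) s

lemma ip_sum_r {ι : Type*} [Fintype ι] (s : AlgTensor E₁ φ) (t : ι → AlgTensor E₁ φ) :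
    ⟪s, ∑ i, t i⟫_B = ∑ i, ⟪s, t i⟫_B := map_sum (form φ s) t _

lemma ip_sum_l {ι : Type*} [Fintype ι] (s : ι → AlgTensor E₁ φ) (t : AlgTensor E₁ φ) :
    ⟪∑ i, s i, t⟫_B = ∑ i, ⟪s i, t⟫_B :=
  (congrArg (fun f : (E₁ ⊗[ℂ] E₂) →ₗ[ℂ] B => f t) (map_sum (form φ) s Finset.univ)).trans
    (LinearMap.sum_apply _ _ _)

instance preHilbertModule : PreHilbertModule B (AlgTensor E₁ φ) where
  ip_add_right s t u := ip_add_r φ s t u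
  ip_smul_right c s t := map_smul (form φ s) c t
  ip_op_smul_right b s t := by
    induction t using AlgTensor.induction with
    | h0 =>
      have h : (0 : AlgTensor E₁ φ) <• b = 0 :=
        map_zero ((HilbertModule.opSMul E₂ b).toLinearMap.lTensor E₁)
      rw [h, ip_zero_r, zero_mul]
    | h2 t u ht hu => rw [add_op_smul, ip_add_r, ip_add_r, ht, hu, add_mul]
    | h1 x y =>
      induction s using AlgTensor.induction with
      | h0 => rw [ip_zero_l, ip_zero_l, zero_mul]
      | h2 s u hs hu => rw [ip_add_l, ip_add_l, hs, hu, add_mul]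
      | h1 x' y' =>
        rw [tmul_op_smul, ip_tmul, ip_tmul, φ.ip_right, ip_op_smul_right, φ.ip_right]
  star_ip s t := by
    induction t using AlgTensor.induction with
    | h0 => rw [ip_zero_r, ip_zero_l, star_zero]
    | h2 t u ht hu => rw [ip_add_r, ip_add_l, star_add, ht, hu]
    | h1 x y =>
      induction s using AlgTensor.induction with
      | h0 => rw [ip_zero_r, ip_zero_l, star_zero]
      | h2 s u hs hu => rw [ip_add_l, ip_add_r, star_add, hs, hu]
      | h1 x' y' => rw [ip_tmul, ip_tmul, star_ip, φ.ip_left, star_ip]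
  ip_self_nonneg t := by
    obtain ⟨S, hS⟩ := TensorProduct.exists_finset t
    have ht : t = ∑ i : S, tmul φ i.1.1 i.1.2 := by
      rw [Finset.sum_coe_sort S fun i => tmul φ i.1 i.2]
      exact hS
    obtain ⟨C, hC⟩ := gram_nonneg (A := A) fun i : S => i.1.1
    have h : ⟪t, t⟫_B = ∑ k, ⟪∑ i : S, φ (C k i) i.1.2, ∑ j : S, φ (C k j) j.1.2⟫_B := by
      have h1 : ⟪t, t⟫_B = ∑ i : S, ∑ j : S, ⟪i.1.2, φ ⟪i.1.1, j.1.1⟫_A j.1.2⟫_B := by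
        rw [ht, ip_sum_l]
        exact Finset.sum_congr rfl fun i _ => ip_sum_r φ _ _
      rw [h1]
      simp only [hC, ip_sum_left, ip_sum_right, φ.ip_left]
      simp only [map_sum, map_mul, sum_apply, mul_apply_eq_comp,
        ip_sum_right]
      calc _ = ∑ i : S, ∑ k : S, ∑ j : S, ⟪i.1.2, φ (star (C k i)) (φ (C k j) j.1.2)⟫_B :=
            Finset.sum_congr rfl fun i _ => Finset.sum_comm
        _ = ∑ k : S, ∑ i : S, ∑ j : S, ⟪i.1.2, φ (star (C k i)) (φ (C k j) j.1.2)⟫_B :=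
            Finset.sum_comm
        _ = _ := Finset.sum_congr rfl fun k _ => Finset.sum_comm
    rw [h]
    exact Finset.sum_nonneg fun k _ => ip_self_nonneg _

end AlgTensor

section continuity

variable {A B E : Type*} [NonUnitalCStarAlgebra A] [PartialOrder A] [StarOrderedRing A]
  [NonUnitalCStarAlgebra B] [PartialOrder B] [StarOrderedRing B]
  [NormedAddCommGroup E] [NormedSpace ℂ E] [CompleteSpace E] [SMul Bᵐᵒᵖ E] [HilbertModule B E]

/-- For every `y`, the map `a ↦ φ(a) y` is continuous. -/
lemma StarRep.continuous_apply (φ : StarRep A B E) (y : E) : Continuous fun a => φ a y := by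
  let f : A →ₗ[ℂ] B :=
    { toFun := fun a => ⟪y, φ a y⟫_B
      map_add' := fun a b => by rw [map_add, add_apply, ip_add_right]
      map_smul' := fun c a => by
        rw [map_smul, smul_apply, ip_smul_right, RingHom.id_apply] }
  have hφ (a : A) : f (star a * a) = ⟪φ a y, φ a y⟫_B := by
    rw [φ.ip_left]
    simp [f, mul_apply_eq_comp]
  have hf : ∀ a, 0 ≤ a → 0 ≤ f a := by
    intro a ha
    obtain ⟨b, rfl⟩ := CStarAlgebra.nonneg_iff_eq_star_mul_self.1 ha
    rw [hφ]
    exact ip_self_nonneg _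
  obtain ⟨C, hC⟩ := PositiveLinearMap.exists_norm_apply_le (PositiveLinearMap.mk₀ f hf)
  let g : A →ₗ[ℂ] E :=
    { toFun := fun a => φ a y
      map_add' := fun a b => by rw [map_add, add_apply]
      map_smul' := fun c a => by rw [map_smul, smul_apply, RingHom.id_apply] }
  refine (g.mkContinuous (√C) fun a => ?_).continuous
  refine abs_le_of_sq_le_sq' ?_ (by positivity) |>.2
  change ‖φ a y‖ ^ 2 ≤ _
  rw [HilbertModule.norm_sq_eq (B := B), ← hφ, mul_pow, Real.sq_sqrt C.coe_nonneg, sq,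
    ← CStarRing.norm_star_mul_self]
  exact hC _

end continuity

section tensor

variable {A B E₁ E₂ : Type*} [NonUnitalCStarAlgebra A] [PartialOrder A] [StarOrderedRing A]
  [NonUnitalCStarAlgebra B] [PartialOrder B] [StarOrderedRing B]
  [NormedAddCommGroup E₁] [NormedSpace ℂ E₁] [CompleteSpace E₁] [SMul Aᵐᵒᵖ E₁] [HilbertModule A E₁]
  [NormedAddCommGroup E₂] [NormedSpace ℂ E₂] [CompleteSpace E₂] [SMul Bᵐᵒᵖ E₂] [HilbertModule B E₂]

variable (E₁) in
/-- The interior tensor product `E₁ ⊗_φ E₂`, a Hilbert `B`-module: the completion of the algebraic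
tensor product for `⟪x ⊗ y, x' ⊗ y'⟫ = ⟪y, φ(⟪x, x'⟫) y'⟫`. -/
abbrev InteriorTensor (φ : StarRep A B E₂) : Type _ := HilbertCompletion B (AlgTensor E₁ φ)

variable (φ : StarRep A B E₂)

/-- An element of the algebraic tensor product, viewed in the interior tensor product. -/
def InteriorTensor.of : AlgTensor E₁ φ →ₗ[ℂ] InteriorTensor E₁ φ :=
  HilbertCompletion.of B (AlgTensor E₁ φ)

/-- The elementary tensor `x ⊗ y` in the interior tensor product. -/
def InteriorTensor.tmul (x : E₁) (y : E₂) : InteriorTensor E₁ φ :=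
  InteriorTensor.of φ (AlgTensor.tmul φ x y)

lemma InteriorTensor.ip_of (s t : AlgTensor E₁ φ) :
    ⟪InteriorTensor.of φ s, InteriorTensor.of φ t⟫_B = ⟪s, t⟫_B :=
  HilbertCompletion.ip_of s t

lemma InteriorTensor.ip_tmul (x x' : E₁) (y y' : E₂) :
    ⟪InteriorTensor.tmul φ x y, InteriorTensor.tmul φ x' y'⟫_B = ⟪y, φ ⟪x, x'⟫_A y'⟫_B :=
  InteriorTensor.ip_of φ _ _

/-- The operator `T_ξ : E₂ → E₁ ⊗_φ E₂`, `y ↦ ξ ⊗ y`. -/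
def creation (ξ : E₁) : E₂ →L[ℂ] InteriorTensor E₁ φ :=
  LinearMap.mkContinuous ((InteriorTensor.of φ).comp (TensorProduct.mk ℂ E₁ E₂ ξ))
    (√‖φ ⟪ξ, ξ⟫_A‖) (fun y => by
      refine abs_le_of_sq_le_sq' ?_ (by positivity) |>.2
      change ‖InteriorTensor.tmul φ ξ y‖ ^ 2 ≤ _
      rw [HilbertModule.norm_sq_eq (B := B), mul_pow, Real.sq_sqrt (norm_nonneg _),
        InteriorTensor.ip_tmul]
      refine (HilbertModule.norm_ip_le _ _).trans ?_
      have := (φ ⟪ξ, ξ⟫_A).le_opNorm y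
      nlinarith [norm_nonneg y])

lemma creation_apply (ξ : E₁) (y : E₂) : creation φ ξ y = InteriorTensor.tmul φ ξ y := rfl

/-- The map `x ⊗ y ↦ φ(⟪ξ, x⟫) y` on the algebraic tensor product. -/
def algAnnihilation (ξ : E₁) : AlgTensor E₁ φ →ₗ[ℂ] E₂ :=
  TensorProduct.lift (LinearMap.mk₂ ℂ (fun (x : E₁) (y : E₂) => φ ⟪ξ, x⟫_A y)
    (fun _ _ _ => by simp [ip_add_right])
    (fun _ _ _ => by simp [ip_smul_right])
    (fun _ _ _ => by simp)
    (fun _ _ _ => by simp))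

lemma ip_algAnnihilation (ξ : E₁) (y : E₂) (t : AlgTensor E₁ φ) :
    ⟪creation φ ξ y, InteriorTensor.of φ t⟫_B = ⟪y, algAnnihilation φ ξ t⟫_B := by
  induction t using AlgTensor.induction with
  | h0 => simp only [map_zero, ip_zero_right]
  | h1 x y' => exact InteriorTensor.ip_tmul φ ξ x y y'
  | h2 s t hs ht => rw [map_add, map_add, ip_add_right, ip_add_right, hs, ht]

/-- The adjoint `T_ξ^* : E₁ ⊗_φ E₂ → E₂`, `x ⊗ y ↦ φ(⟪ξ, x⟫) y`. -/
def annihilation (ξ : E₁) : InteriorTensor E₁ φ →L[ℂ] E₂ :=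
  HilbertCompletion.extend (algAnnihilation φ ξ) ‖creation φ ξ‖ fun t => by
    set z : E₂ := algAnnihilation φ ξ t with hz
    have h1 : ‖z‖ ^ 2 = ‖⟪creation φ ξ z, InteriorTensor.of φ t⟫_B‖ := by
      rw [HilbertModule.norm_sq_eq (B := B), ip_algAnnihilation]
    have h2 := HilbertModule.norm_ip_le (B := B) (creation φ ξ z) (InteriorTensor.of φ t)
    have h3 := (creation φ ξ).le_opNorm z
    rw [← h1] at h2
    rcases (norm_nonneg z).eq_or_lt with h | h
    · rw [← h]; positivity
    · have h5 := h2.trans (mul_le_mul_of_nonneg_right h3 (norm_nonneg (InteriorTensor.of φ t)))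
      change ‖z‖ ≤ ‖creation φ ξ‖ * ‖InteriorTensor.of φ t‖
      nlinarith

lemma isAdjointPair_creation (ξ : E₁) : IsAdjointPair B (creation φ ξ) (annihilation φ ξ) := by
  intro y t
  induction t using HilbertCompletion.denseRange_of.induction_on with
  | hp =>
    exact isClosed_eq
      ((HilbertModule.continuous_ip B _).comp (continuous_const.prodMk continuous_id))
      ((HilbertModule.continuous_ip B _).comp
        (continuous_const.prodMk (annihilation φ ξ).continuous))
  | ih t =>
    refine (ip_algAnnihilation φ ξ y t).trans ?_
    exact congrArg _ (HilbertCompletion.extend_of _ _ _ t).symm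

variable {φ} {H : Type*} [Group H] [TopologicalSpace H]
  {α : CStarAction H A} {β : CStarAction H B}

/-- The map `x ⊗ y ↦ γ_h x ⊗ γ_h y` on the algebraic tensor product. -/
def AlgTensor.diag (φ : StarRep A B E₂) (γ₁ : HilbertAction α E₁) (γ₂ : HilbertAction β E₂)
    (h : H) : AlgTensor E₁ φ →ₗ[ℂ] AlgTensor E₁ φ :=
  TensorProduct.map (γ₁ h).toLinearMap (γ₂ h).toLinearMap

lemma AlgTensor.diag_tmul (γ₁ : HilbertAction α E₁) (γ₂ : HilbertAction β E₂) (h : H) (x : E₁)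
    (y : E₂) : AlgTensor.diag φ γ₁ γ₂ h (AlgTensor.tmul φ x y)
      = AlgTensor.tmul φ (γ₁ h x) (γ₂ h y) := rfl

/-- The diagonal action on the algebraic tensor product. -/
def AlgTensor.preAction (γ₁ : HilbertAction α E₁) (γ₂ : HilbertAction β E₂)
    (hφ : φ.IsEquivariant α γ₂) : PreAction β (AlgTensor E₁ φ) where
  toHom :=
    { toFun := AlgTensor.diag φ γ₁ γ₂
      map_one' := by
        rw [AlgTensor.diag, map_one, map_one]
        exact TensorProduct.map_id
      map_mul' := fun g h => by
        rw [AlgTensor.diag, map_mul, map_mul]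
        exact TensorProduct.map_comp _ _ _ _ }
  ip_map h s t := by
    change ⟪AlgTensor.diag φ γ₁ γ₂ h s, AlgTensor.diag φ γ₁ γ₂ h t⟫_B = _
    induction t using AlgTensor.induction with
    | h0 => rw [map_zero, ip_zero_right, ip_zero_right, map_zero]
    | h2 t u ht hu => rw [map_add, ip_add_right, ip_add_right, map_add, ht, hu]
    | h1 x y =>
      induction s using AlgTensor.induction with
      | h0 => rw [map_zero, ip_zero_left, ip_zero_left, map_zero]
      | h2 s u hs hu => rw [map_add, ip_add_left, ip_add_left, map_add, hs, hu]
      | h1 x' y' =>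
        rw [diag_tmul, diag_tmul, ip_tmul, ip_tmul, γ₁.ip_map, ← hφ, γ₂.ip_map]
  tendsto t := by
    suffices ∀ s t : AlgTensor E₁ φ, Tendsto (fun h => ⟪AlgTensor.diag φ γ₁ γ₂ h s, t⟫_B)
        (𝓝 1) (𝓝 ⟪s, t⟫_B) from this t t
    intro s t
    induction t using AlgTensor.induction with
    | h0 => simp only [ip_zero_right]; exact tendsto_const_nhds
    | h2 t u ht hu => simp only [ip_add_right]; exact ht.add hu
    | h1 x y =>
      induction s using AlgTensor.induction with
      | h0 => simp only [map_zero, ip_zero_left]; exact tendsto_const_nhds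
      | h2 s u hs hu => simp only [map_add, ip_add_left]; exact hs.add hu
      | h1 x' y' =>
        change Tendsto (fun h => ⟪γ₂ h y', φ ⟪γ₁ h x', x⟫_A y⟫_B) (𝓝 1)
          (𝓝 ⟪y', φ ⟪x', x⟫_A y⟫_B)
        have h1 : Continuous fun h => ⟪γ₁ h x', x⟫_A :=
          (HilbertModule.continuous_ip A E₁).comp ((γ₁.continuous x').prodMk continuous_const)
        have h2 : Continuous fun h => ⟪γ₂ h y', φ ⟪γ₁ h x', x⟫_A y⟫_B :=
          (HilbertModule.continuous_ip B E₂).comp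
            ((γ₂.continuous y').prodMk ((φ.continuous_apply y).comp h1))
        have h3 := h2.tendsto 1
        simpa using h3

/-- The diagonal action `γ_h (x ⊗ y) = γ_h x ⊗ γ_h y` on the interior tensor product. -/
def HilbertAction.tensor [IsTopologicalGroup H] (γ₁ : HilbertAction α E₁)
    (γ₂ : HilbertAction β E₂) (hφ : φ.IsEquivariant α γ₂) :
    HilbertAction β (InteriorTensor E₁ φ) :=
  (AlgTensor.preAction γ₁ γ₂ hφ).completion

lemma HilbertAction.tensor_tmul [IsTopologicalGroup H] (γ₁ : HilbertAction α E₁)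
    (γ₂ : HilbertAction β E₂) (hφ : φ.IsEquivariant α γ₂) (h : H) (x : E₁) (y : E₂) :
    γ₁.tensor γ₂ hφ h (InteriorTensor.tmul φ x y) = InteriorTensor.tmul φ (γ₁ h x) (γ₂ h y) :=
  PreAction.extend_of (AlgTensor.preAction γ₁ γ₂ hφ) h (AlgTensor.tmul φ x y)

end tensor

/-! ### The group `G₂ = G × ℤ₂` and its grading element -/

/-- The group `G × ℤ / 2ℤ`; an action of it is an action of `G` together with a grading that
commutes with it. -/
abbrev G₂ (G : Type*) : Type _ := G × Multiplicative (ZMod 2)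

/-- The generator of `ℤ / 2ℤ` in `G × ℤ / 2ℤ`.  It acts by the grading automorphism. -/
def gradingElt (G : Type*) [Group G] : G₂ G := (1, Multiplicative.ofAdd 1)

/-- An element of `G`, viewed in `G × ℤ / 2ℤ`. -/
def inclG {G : Type*} (g : G) : G₂ G := (g, 1)

/-! ### The Hilbert module `L²(G, E)` -/

section HilbertActionLemmas

variable {H B E : Type*} [Group H] [TopologicalSpace H]
  [NonUnitalCStarAlgebra B] [PartialOrder B] [StarOrderedRing B]
  [NormedAddCommGroup E] [NormedSpace ℂ E] [CompleteSpace E] [SMul Bᵐᵒᵖ E] [HilbertModule B E]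
  {β : CStarAction H B}

lemma HilbertAction.norm_map (γ : HilbertAction β E) (h : H) (x : E) : ‖γ h x‖ = ‖x‖ := by
  refine (sq_eq_sq₀ (norm_nonneg _) (norm_nonneg _)).1 ?_
  rw [HilbertModule.norm_sq_eq (B := B), HilbertModule.norm_sq_eq (B := B), γ.ip_map,
    StarAlgEquiv_norm_map]

lemma HilbertAction.continuous_uncurry (γ : HilbertAction β E) :
    Continuous fun p : H × E => γ p.1 p.2 := by
  rw [continuous_iff_continuousAt]
  rintro ⟨h, x⟩
  have h1 : Tendsto (fun p : H × E => γ p.1 x) (𝓝 (h, x)) (𝓝 (γ h x)) :=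
    ((γ.continuous x).tendsto h).comp (continuous_fst.tendsto (h, x))
  have h2 : Tendsto (fun p : H × E => γ p.1 (p.2 - x)) (𝓝 (h, x)) (𝓝 0) := by
    rw [tendsto_zero_iff_norm_tendsto_zero]
    simp only [γ.norm_map]
    have : Continuous fun p : H × E => ‖p.2 - x‖ := by fun_prop
    simpa using this.tendsto (h, x)
  have h3 := h1.add h2
  simpa [ContinuousAt] using h3

end HilbertActionLemmas

section L2

variable {G : Type*} [Group G] [TopologicalSpace G] [IsTopologicalGroup G]
  [LocallyCompactSpace G] [MeasurableSpace G] [BorelSpace G]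
  (μ : Measure G) [μ.IsHaarMeasure]
  (B E : Type*) [NonUnitalCStarAlgebra B] [PartialOrder B] [StarOrderedRing B]
  [NormedAddCommGroup E] [NormedSpace ℂ E] [CompleteSpace E] [SMul Bᵐᵒᵖ E] [HilbertModule B E]

/-- The space `C_c(G, E)`, to be equipped with the `B`-valued inner product
`∫ ⟪f₁(g), f₂(g)⟫_B dg`. -/
@[nolint unusedArguments]
def CcSpace {G : Type*} [TopologicalSpace G] [MeasurableSpace G] (_μ : Measure G) (_B E : Type*)
    [NormedAddCommGroup E] : Type _ := C_c(G, E)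

namespace CcSpace

instance : AddCommGroup (CcSpace μ B E) := inferInstanceAs (AddCommGroup C_c(G, E))
instance : Module ℂ (CcSpace μ B E) := inferInstanceAs (Module ℂ C_c(G, E))
instance : FunLike (CcSpace μ B E) G E := inferInstanceAs (FunLike C_c(G, E) G E)

variable {μ B E}

@[ext] lemma ext {f g : CcSpace μ B E} (h : ∀ x, f x = g x) : f = g := DFunLike.ext _ _ h

lemma continuous (f : CcSpace μ B E) : Continuous f := f.toContinuousMap.continuous

lemma hasCompactSupport (f : CcSpace μ B E) : HasCompactSupport f := f.hasCompactSupport'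

variable (μ B) in
/-- Construct an element of `C_c(G, E)`. -/
def mk' (f : G → E) (hf : Continuous f) (hc : HasCompactSupport f) : CcSpace μ B E :=
  ⟨⟨f, hf⟩, hc⟩

@[simp] lemma mk'_apply (f : G → E) (hf : Continuous f) (hc : HasCompactSupport f) (x : G) :
    mk' μ B f hf hc x = f x := rfl

@[simp] lemma add_apply (f g : CcSpace μ B E) (x : G) : (f + g) x = f x + g x := rfl

@[simp] lemma smul_apply (c : ℂ) (f : CcSpace μ B E) (x : G) : (c • f) x = c • f x := rfl

instance : SMul Bᵐᵒᵖ (CcSpace μ B E) where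
  smul b f := mk' μ B (fun x => f x <• b.unop)
    ((HilbertModule.opSMul E b.unop).continuous.comp f.continuous)
    (f.hasCompactSupport.comp_left (map_zero (HilbertModule.opSMul E b.unop)))

@[simp] lemma op_smul_apply (f : CcSpace μ B E) (b : B) (x : G) : (f <• b) x = f x <• b := rfl

lemma ip_continuous (f g : CcSpace μ B E) : Continuous fun x => ⟪f x, g x⟫_B :=
  f.continuous.ip g.continuous

lemma ip_integrable (f g : CcSpace μ B E) : Integrable (fun x => ⟪f x, g x⟫_B) μ := by
  refine (ip_continuous f g).integrable_of_hasCompactSupport ?_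
  refine g.hasCompactSupport.mono fun x hx => ?_
  contrapose! hx
  rw [Function.notMem_support] at hx ⊢
  rw [hx, ip_zero_right]

/-- The inner product `∫ ⟪f₁(g), f₂(g)⟫_B dg` on `C_c(G, E)`. -/
instance preHilbertModule : PreHilbertModule B (CcSpace μ B E) where
  inner f g := ∫ x, ⟪f x, g x⟫_B ∂μ
  ip_add_right f g h := by
    simp only [add_apply, ip_add_right]
    exact integral_add (ip_integrable f g) (ip_integrable f h)
  ip_smul_right c f g := by
    simp only [smul_apply, ip_smul_right]
    exact integral_smul c _
  ip_op_smul_right b f g := by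
    simp only [op_smul_apply, ip_op_smul_right]
    exact ((ContinuousLinearMap.mul ℂ B).flip b).integral_comp_comm (ip_integrable f g)
  star_ip f g := by
    have := ((starL' ℝ : B ≃L[ℝ] B) : B →L[ℝ] B).integral_comp_comm (ip_integrable f g)
    refine this.symm.trans (integral_congr_ae (Eventually.of_forall fun x => ?_))
    exact star_ip (B := B) (f x) (g x)
  ip_self_nonneg f := integral_nonneg fun x => ip_self_nonneg (f x)

lemma ip_def (f g : CcSpace μ B E) : ⟪f, g⟫_B = ∫ x, ⟪f x, g x⟫_B ∂μ := rfl

variable {β : CStarAction (G₂ G) B}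

/-- The action `(h · f)(x) = γ_h (f (h⁻¹ x))` of `G × ℤ / 2ℤ` on `C_c(G, E)`, where `ℤ / 2ℤ` acts
trivially on the argument `x`. -/
def translate (γ : HilbertAction β E) (h : G₂ G) (f : CcSpace μ B E) : CcSpace μ B E :=
  mk' μ B (fun x => γ h (f (h.1⁻¹ * x)))
    ((γ h).continuous.comp (f.continuous.comp (continuous_const_mul _)))
    (HasCompactSupport.comp_left (g := γ h)
      (f.hasCompactSupport.comp_homeomorph (Homeomorph.mulLeft h.1⁻¹)) (map_zero (γ h)))

@[simp] lemma translate_apply (γ : HilbertAction β E) (h : G₂ G) (f : CcSpace μ B E) (x : G) :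
    translate γ h f x = γ h (f (h.1⁻¹ * x)) := rfl

lemma tendsto_translate (γ : HilbertAction β E) (f : CcSpace μ B E) :
    Tendsto (fun h => ⟪translate γ h f, f⟫_B) (𝓝 1) (𝓝 ⟪f, f⟫_B) := by
  have h1 : Continuous fun p : G₂ G × G => ⟪γ p.1 (f (p.1.1⁻¹ * p.2)), f p.2⟫_B := by
    refine Continuous.ip ?_ (f.continuous.comp continuous_snd)
    refine γ.continuous_uncurry.comp (continuous_fst.prodMk (f.continuous.comp ?_))
    fun_prop
  have h2 := continuousOn_integral_of_compact_support (μ := μ) (s := Set.univ)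
    (f := fun (h : G₂ G) x => ⟪γ h (f (h.1⁻¹ * x)), f x⟫_B) f.hasCompactSupport h1.continuousOn
    (fun h x _ hx => by
      rw [image_eq_zero_of_notMem_tsupport hx, ip_zero_right])
  have h3 := (continuousOn_univ.1 h2).tendsto 1
  simpa [ip_def] using h3

variable (μ) in
/-- The action of `G × ℤ / 2ℤ` on `C_c(G, E)`. -/
def preAction (γ : HilbertAction β E) : PreAction β (CcSpace μ B E) where
  toHom :=
    { toFun := fun h =>
        { toFun := translate γ h
          map_add' := fun f g => by ext x; simp
          map_smul' := fun c f => by ext x; simp }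
      map_one' := by ext f x; simp
      map_mul' := fun g h => by
        ext f x
        simp [mul_assoc] }
  ip_map h f g := by
    change ⟪translate γ h f, translate γ h g⟫_B = β h ⟪f, g⟫_B
    simp only [ip_def, translate_apply, γ.ip_map]
    rw [integral_mul_left_eq_self (fun x => β h ⟪f x, g x⟫_B) h.1⁻¹]
    exact (isometryOfAut (β h)).toContinuousLinearMap.integral_comp_comm (ip_integrable f g)
  tendsto := tendsto_translate γ

end CcSpace

/-- The Hilbert `B`-module `L²(G, E)`: the completion of `C_c(G, E)` for the inner product
`∫ ⟪f₁(g), f₂(g)⟫_B dg`. -/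
abbrev L2 : Type _ := HilbertCompletion B (CcSpace μ B E)

variable {B E}

/-- A continuous compactly supported function, viewed in `L²(G, E)`. -/
def L2.of (f : CcSpace μ B E) : L2 μ B E := HilbertCompletion.of B (CcSpace μ B E) f

/-- The action of `G × ℤ / 2ℤ` on `L²(G, E)`, given on `C_c(G, E)` by
`(h · f)(x) = γ_h (f (h⁻¹ x))`. -/
def HilbertAction.L2 {β : CStarAction (G₂ G) B} (γ : HilbertAction β E) :
    HilbertAction β (EquivariantKK.L2 μ B E) :=
  (CcSpace.preAction μ γ).completion

lemma HilbertAction.L2_of {β : CStarAction (G₂ G) B} (γ : HilbertAction β E) (h : G₂ G)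
    (f : CcSpace μ B E) : γ.L2 μ h (L2.of μ f) = L2.of μ (CcSpace.translate γ h f) :=
  PreAction.extend_of (CcSpace.preAction μ γ) h f

end L2

/-! ### Kasparov triples -/

/-- The conjugated operator `γ_h(T) = γ_h ∘ T ∘ γ_h⁻¹`. -/
def HilbertAction.conj {H B E : Type*} [Group H] [TopologicalSpace H] [NonUnitalCStarAlgebra B]
    [PartialOrder B] [NormedAddCommGroup E] [NormedSpace ℂ E] [CompleteSpace E] [SMul Bᵐᵒᵖ E]
    [HilbertModule B E] {β : CStarAction H B} (γ : HilbertAction β E) (h : H) (T : E →L[ℂ] E) :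
    E →L[ℂ] E :=
  γ h * T * γ h⁻¹

section grading

variable {E : Type*} [NormedAddCommGroup E] [NormedSpace ℂ E]

/-- `T` is odd with respect to the grading operator `τ` (where `τ * τ = 1`). -/
def IsOdd (τ T : E →L[ℂ] E) : Prop := τ * T * τ = -T

/-- The graded commutator with respect to the grading operator `τ`:  if `S = S₀ + S₁` with `S₀` even
and `S₁` odd, then `[S, T] = S * T - T * S₀ - (τ * T * τ) * S₁`.  For homogeneous `S` and `T` this is
`S * T - (-1) ^ (∂S * ∂T) • T * S`. -/
def gradedCommutator (τ S T : E →L[ℂ] E) : E →L[ℂ] E :=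
  S * T - T * ((1 / 2 : ℂ) • (S + τ * S * τ)) - τ * T * τ * ((1 / 2 : ℂ) • (S - τ * S * τ))

end grading

/-- A C⋆-algebra is σ-unital iff it has a countable approximate unit. -/
def IsSigmaUnital (A : Type*) [NonUnitalCStarAlgebra A] [PartialOrder A] : Prop :=
  ∃ u : ℕ → A, (∀ n, 0 ≤ u n ∧ ‖u n‖ ≤ 1) ∧
    ∀ a, Tendsto (fun n => u n * a) atTop (𝓝 a) ∧ Tendsto (fun n => a * u n) atTop (𝓝 a)

/-- A Hilbert `B`-module is countably generated iff there is a sequence `s` such that the linear span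
of the vectors `s n <• b` is dense. -/
def IsCountablyGenerated (B E : Type*) [NormedAddCommGroup E] [NormedSpace ℂ E] [SMul Bᵐᵒᵖ E] :
    Prop :=
  ∃ s : ℕ → E, Dense (Submodule.span ℂ {x : E | ∃ n, ∃ b : B, x = s n <• b} : Set E)

section Kasparov

variable {G A B E : Type*} [Group G] [TopologicalSpace G]
  [NonUnitalCStarAlgebra A] [NonUnitalCStarAlgebra B] [PartialOrder B]
  [NormedAddCommGroup E] [NormedSpace ℂ E] [CompleteSpace E] [SMul Bᵐᵒᵖ E] [HilbertModule B E]

/-- `(E, φ, F)` is a Kasparov triple for `A, B`, where `α`, `β`, `γ` are the actions of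
`G × ℤ / 2ℤ` on `A`, `B`, `E`. -/
structure IsKasparovTriple (α : CStarAction (G₂ G) A) {β : CStarAction (G₂ G) B}
    (γ : HilbertAction β E) (φ : StarRep A B E) (F : E →L[ℂ] E) : Prop where
  countablyGenerated : IsCountablyGenerated B E
  equivariant : φ.IsEquivariant α γ
  odd : IsOdd (γ (gradingElt G)) F
  adjoint : ∃ Fs : E →L[ℂ] E, IsAdjointPair B F Fs ∧
    ∀ a, (F - Fs) * φ a ∈ compactOperators B E E
  commutator : ∀ a, gradedCommutator (γ (gradingElt G)) F (φ a) ∈ compactOperators B E E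
  sq : ∀ a, (1 - F * F) * φ a ∈ compactOperators B E E
  almostEquivariant : ∀ (g : G) a, (γ.conj (inclG g) F - F) * φ a ∈ compactOperators B E E

/-- `F'` is a compact perturbation of `F`. -/
def IsCompactPerturbation (φ : StarRep A B E) (F F' : E →L[ℂ] E) : Prop :=
  ∀ a, (F' - F) * φ a ∈ compactOperators B E E ∧ φ a * (F' - F) ∈ compactOperators B E E

end Kasparov

/-! ### Connections -/

/-- The inner product on the direct sum of two Hilbert modules.  Direct sums carry the maximum norm,
which is equivalent to the Hilbert module norm, so that bounded and compact operators are the same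
for both norms. -/
instance directSumInner {B E F : Type*} [NonUnitalCStarAlgebra B] [Inner B E] [Inner B F] :
    Inner B (E × F) := ⟨fun x y => ⟪x.1, y.1⟫_B + ⟪x.2, y.2⟫_B⟩

section connection

variable {A B E₁ E₂ : Type*} [NonUnitalCStarAlgebra A] [PartialOrder A] [StarOrderedRing A]
  [NonUnitalCStarAlgebra B] [PartialOrder B] [StarOrderedRing B]
  [NormedAddCommGroup E₁] [NormedSpace ℂ E₁] [CompleteSpace E₁] [SMul Aᵐᵒᵖ E₁] [HilbertModule A E₁]
  [NormedAddCommGroup E₂] [NormedSpace ℂ E₂] [CompleteSpace E₂] [SMul Bᵐᵒᵖ E₂] [HilbertModule B E₂]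

/-- The operator matrix with rows `(0, T_ξ^*)` and `(T_ξ, 0)` on `E₂ ⊕ (E₁ ⊗_φ E₂)`. -/
def tildeT (φ : StarRep A B E₂) (ξ : E₁) :
    (E₂ × InteriorTensor E₁ φ) →L[ℂ] (E₂ × InteriorTensor E₁ φ) :=
  ((annihilation φ ξ).comp (ContinuousLinearMap.snd ℂ E₂ (InteriorTensor E₁ φ))).prod
    ((creation φ ξ).comp (ContinuousLinearMap.fst ℂ E₂ (InteriorTensor E₁ φ)))

/-- The operator `F₁₂` on `E₁ ⊗_φ E₂` is an `F₂`-connection: the graded commutator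
`[F₂ ⊕ F₁₂, T̃_ξ]` is compact for all `ξ`.  Here `τ₂` and `τ₁₂` are the grading operators of `E₂` and
`E₁ ⊗_φ E₂`. -/
def IsConnection (φ : StarRep A B E₂) (τ₂ : E₂ →L[ℂ] E₂)
    (τ₁₂ : InteriorTensor E₁ φ →L[ℂ] InteriorTensor E₁ φ) (F₂ : E₂ →L[ℂ] E₂)
    (F₁₂ : InteriorTensor E₁ φ →L[ℂ] InteriorTensor E₁ φ) : Prop :=
  ∀ ξ : E₁, gradedCommutator (τ₂.prodMap τ₁₂) (F₂.prodMap F₁₂) (tildeT φ ξ) ∈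
    compactOperators B (E₂ × InteriorTensor E₁ φ) (E₂ × InteriorTensor E₁ φ)

end connection

end EquivariantKK

end

open EquivariantKK

/-!
The unitary `U` sends `f ⊗ e` to the function `g ↦ φ(f(g)) e`.  It preserves inner products because
`a ↦ ⟪e, φ(a) e'⟫` is a bounded linear map and commutes with the integral, and its range is dense
because a partition of unity approximates every `k ∈ C_c(G, E)` by sums of functions `χ_i ⊗ k(x_i)`,
where `k(x_i) = φ(a_i) e_i` (`CcSpace.mem_closure_span_rep`).

The perturbation is `F₀ = 2 F₁ (1 + F₁ ^ 2)⁻¹` with `F₁ = (F + F^*) / 2`, so that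
`F₀ - F₁ = (1 + F₁ ^ 2)⁻¹ F₁ (1 - F₁ ^ 2)` is compact after multiplication by `φ(a)`
(`IsKasparovTriple.exists_selfAdjoint_contraction`).  The inverse exists by two Neumann series, so that
no functional calculus for adjointable operators is needed.

The pointwise formula for `F'` defines a contraction on `L²(G, E)` because a self-adjoint contraction
satisfies `⟪T x, T x⟫ ≤ ⟪x, x⟫` in the order of `B`, an inequality that can be integrated
(`IsAdjointPair.ip_apply_self_le`).  Equivariance and oddness are read off from the formula.

For the connection property, the essential point is that `F' T_ξ - T_{τ ξ} F₀` is compact for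
`ξ = f ∈ C_c(G, A)`.  Under `U` this operator is `e ↦ (g ↦ κ(g) e)`, where
`κ(g) = γ_g(F₀) φ(f(g)) - φ(τ f(g)) F₀` is compact for each `g`; but `κ` is a priori only strongly
continuous in `g`.  This suffices: since `E` is countably generated, `𝕂(E)` has a sequential
approximate unit `1 - r n` (`IsCountablyGenerated.exists_approximateUnit`), and dominated convergence
gives `∫ ‖κ(g) * r n‖ ^ 2 dg → 0`, so that the operator is a norm limit of compact operators
(`mem_compactOperators_of_norm_sq_le_integral`).  The remaining terms are of the form
`T_ξ (F - F₀)`, which are compact because `ξ` is a limit of vectors `ξ <• a` and `T_{ξ a} = T_ξ φ(a)`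
(`creation_comp_mem_compactOperators`), and the other corner of the graded commutator is the adjoint
of an operator of the same kind.
-/

namespace EquivariantKK

open PreHilbertModule

/-! ### Adjoint pairs and the ideal of compact operators -/

section adjoint

variable {B E F D : Type*} [NonUnitalCStarAlgebra B] [PartialOrder B] [StarOrderedRing B]
  [NormedAddCommGroup E] [NormedSpace ℂ E] [CompleteSpace E] [SMul Bᵐᵒᵖ E] [HilbertModule B E]
  [NormedAddCommGroup F] [NormedSpace ℂ F] [CompleteSpace F] [SMul Bᵐᵒᵖ F] [HilbertModule B F]
  [NormedAddCommGroup D] [NormedSpace ℂ D] [CompleteSpace D] [SMul Bᵐᵒᵖ D] [HilbertModule B D]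

namespace IsAdjointPair

lemma symm {T : E →L[ℂ] F} {S : F →L[ℂ] E} (h : IsAdjointPair B T S) : IsAdjointPair B S T :=
  fun x y => by rw [← star_ip, ← h, star_ip]

lemma comp {T : E →L[ℂ] F} {S : F →L[ℂ] E} {T' : F →L[ℂ] D} {S' : D →L[ℂ] F}
    (h' : IsAdjointPair B T' S') (h : IsAdjointPair B T S) :
    IsAdjointPair B (T'.comp T) (S.comp S') :=
  fun x y => (h' (T x) y).trans (h x (S' y))

lemma mul {T S T' S' : E →L[ℂ] E} (h' : IsAdjointPair B T' S') (h : IsAdjointPair B T S) :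
    IsAdjointPair B (T' * T) (S * S') :=
  h'.comp h

lemma one : IsAdjointPair B (1 : E →L[ℂ] E) 1 := fun _ _ => rfl

lemma zero : IsAdjointPair B (0 : E →L[ℂ] F) 0 := fun x y =>
  (ip_zero_left y).trans (ip_zero_right x).symm

lemma add {T T' : E →L[ℂ] F} {S S' : F →L[ℂ] E} (h : IsAdjointPair B T S)
    (h' : IsAdjointPair B T' S') : IsAdjointPair B (T + T') (S + S') := fun x y => by
  rw [add_apply, add_apply, ip_add_left, ip_add_right, h, h']

lemma sub {T T' : E →L[ℂ] F} {S S' : F →L[ℂ] E} (h : IsAdjointPair B T S)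
    (h' : IsAdjointPair B T' S') : IsAdjointPair B (T - T') (S - S') := fun x y => by
  rw [sub_apply, sub_apply, ip_sub_left, ip_sub_right, h, h']

lemma smul {T : E →L[ℂ] F} {S : F →L[ℂ] E} (h : IsAdjointPair B T S) (c : ℂ) :
    IsAdjointPair B (c • T) (star c • S) := fun x y => by
  rw [smul_apply, smul_apply, ip_smul_left, ip_smul_right, h]

lemma map_op_smul {T : E →L[ℂ] F} {S : F →L[ℂ] E} (h : IsAdjointPair B T S) (x : E) (b : B) :
    T (x <• b) = T x <• b :=
  HilbertModule.ext_ip (B := B) fun z => by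
    rw [← h.symm, ip_op_smul_right, ip_op_smul_right, ← h.symm]

lemma unique {T : E →L[ℂ] F} {S S' : F →L[ℂ] E} (h : IsAdjointPair B T S)
    (h' : IsAdjointPair B T S') : S = S' :=
  ContinuousLinearMap.ext fun y => HilbertModule.ext_ip (B := B) fun x => by rw [← h, ← h']

lemma opNorm_le {T : E →L[ℂ] F} {S : F →L[ℂ] E} (h : IsAdjointPair B T S) : ‖S‖ ≤ ‖T‖ := by
  refine S.opNorm_le_bound (norm_nonneg _) fun y => ?_
  have h1 : ‖S y‖ ^ 2 ≤ ‖T (S y)‖ * ‖y‖ := by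
    rw [HilbertModule.norm_sq_eq (B := B), ← h]
    exact HilbertModule.norm_ip_le _ _
  have h2 := T.le_opNorm (S y)
  rcases (norm_nonneg (S y)).eq_or_lt with h0 | h0
  · rw [← h0]; positivity
  · have h3 := h1.trans (mul_le_mul_of_nonneg_right h2 (norm_nonneg y))
    nlinarith

end IsAdjointPair

lemma zero_op_smul (b : B) : (0 : E) <• b = 0 := map_zero (HilbertModule.opSMul E b)

lemma norm_op_smul_le (x : E) (b : B) : ‖x <• b‖ ≤ ‖x‖ * ‖b‖ := by
  have h1 := (HilbertModule.opSMul E b).le_opNorm x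
  have h2 : ‖HilbertModule.opSMul E b‖ ≤ ‖b‖ :=
    LinearMap.mkContinuous_norm_le _ (norm_nonneg _) _
  calc ‖x <• b‖ ≤ ‖HilbertModule.opSMul E b‖ * ‖x‖ := h1
    _ ≤ ‖x‖ * ‖b‖ := by rw [mul_comm]; gcongr

variable (B) in
/-- The rank one operator `|x⟩⟨y| : z ↦ x <• ⟪y, z⟫_B`. -/
noncomputable def rankOne (x : F) (y : E) : E →L[ℂ] F :=
  LinearMap.mkContinuous
    { toFun := fun z => x <• ⟪y, z⟫_B
      map_add' := fun z w => HilbertModule.ext_ip (B := B) fun v => by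
        simp only [ip_op_smul_right, ip_add_right, mul_add]
      map_smul' := fun c z => HilbertModule.ext_ip (B := B) fun v => by
        simp only [ip_op_smul_right, ip_smul_right, mul_smul_comm, RingHom.id_apply] }
    (‖x‖ * ‖y‖) fun z => by
      refine (norm_op_smul_le (B := B) x _).trans ?_
      rw [mul_assoc]
      gcongr
      exact HilbertModule.norm_ip_le y z

lemma rankOne_apply (x : F) (y z : E) : rankOne B x y z = x <• ⟪y, z⟫_B := rfl

lemma isAdjointPair_rankOne (x : F) (y : E) : IsAdjointPair B (rankOne B x y) (rankOne B y x) :=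
  fun z w => by
    rw [rankOne_apply, rankOne_apply, ip_op_smul_left, ip_op_smul_right, star_ip]

/-- A bounded linear map between spaces of operators that sends rank one operators to compact
operators sends all compact operators to compact operators. -/
lemma map_mem_compactOperators {X Y X' Y' : Type*} [NormedAddCommGroup X] [NormedSpace ℂ X]
    [NormedAddCommGroup Y] [NormedSpace ℂ Y] [NormedAddCommGroup X'] [NormedSpace ℂ X']
    [NormedAddCommGroup Y'] [NormedSpace ℂ Y'] [Inner B X] [SMul Bᵐᵒᵖ Y] [Inner B X']
    [SMul Bᵐᵒᵖ Y'] (Φ : (X →L[ℂ] Y) →L[ℂ] (X' →L[ℂ] Y'))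
    (hΦ : ∀ T x y, (∀ z, T z = x <• ⟪y, z⟫_B) → Φ T ∈ compactOperators B X' Y')
    {T : X →L[ℂ] Y} (hT : T ∈ compactOperators B X Y) : Φ T ∈ compactOperators B X' Y' := by
  have hle : compactOperators B X Y ≤
      (compactOperators B X' Y').comap (Φ : (X →L[ℂ] Y) →ₗ[ℂ] (X' →L[ℂ] Y')) := by
    refine Submodule.topologicalClosure_minimal _ (Submodule.span_le.2 ?_) ?_
    · rintro T ⟨x, y, h⟩
      exact hΦ T x y h
    · exact (Submodule.isClosed_topologicalClosure _).preimage Φ.continuous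
  exact hle hT

lemma rankOne_mem_compactOperators {X Y : Type*} [NormedAddCommGroup X] [NormedSpace ℂ X]
    [NormedAddCommGroup Y] [NormedSpace ℂ Y] [Inner B X] [SMul Bᵐᵒᵖ Y] {T : X →L[ℂ] Y} {x : Y}
    {y : X} (h : ∀ z, T z = x <• ⟪y, z⟫_B) : T ∈ compactOperators B X Y :=
  Submodule.le_topologicalClosure _ (Submodule.subset_span ⟨x, y, h⟩)

lemma isClosed_compactOperators {X Y : Type*} [NormedAddCommGroup X] [NormedSpace ℂ X]
    [NormedAddCommGroup Y] [NormedSpace ℂ Y] [Inner B X] [SMul Bᵐᵒᵖ Y] :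
    IsClosed (compactOperators B X Y : Set (X →L[ℂ] Y)) :=
  Submodule.isClosed_topologicalClosure _

lemma comp_mem_compactOperators_of_left {S : F →L[ℂ] D} (hS : ∀ x (b : B), S (x <• b) = S x <• b)
    {T : E →L[ℂ] F} (hT : T ∈ compactOperators B E F) : S.comp T ∈ compactOperators B E D :=
  map_mem_compactOperators (ContinuousLinearMap.compL ℂ E F D S)
    (fun T x y h => rankOne_mem_compactOperators (x := S x) (y := y) fun z => by
      rw [ContinuousLinearMap.compL_apply, ContinuousLinearMap.comp_apply, h, hS]) hT

lemma IsAdjointPair.comp_mem_compactOperators {S : E →L[ℂ] F} {S' : F →L[ℂ] E}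
    (hS : IsAdjointPair B S S') {T : F →L[ℂ] D} (hT : T ∈ compactOperators B F D) :
    T.comp S ∈ compactOperators B E D :=
  map_mem_compactOperators ((ContinuousLinearMap.compL ℂ E F D).flip S)
    (fun T x y h => rankOne_mem_compactOperators (x := x) (y := S' y) fun z => by
      rw [ContinuousLinearMap.flip_apply, ContinuousLinearMap.compL_apply,
        ContinuousLinearMap.comp_apply, h, hS.symm]) hT

lemma mul_mem_compactOperators_of_left {S S' T : E →L[ℂ] E} (hS : IsAdjointPair B S S')
    (hT : T ∈ compactOperators B E E) : S * T ∈ compactOperators B E E :=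
  comp_mem_compactOperators_of_left hS.map_op_smul hT

lemma mul_mem_compactOperators_of_right {S S' T : E →L[ℂ] E} (hS : IsAdjointPair B S S')
    (hT : T ∈ compactOperators B E E) : T * S ∈ compactOperators B E E :=
  hS.comp_mem_compactOperators hT

/-- The adjoint of a compact operator is compact. -/
lemma IsAdjointPair.mem_compactOperators {T : E →L[ℂ] F} {S : F →L[ℂ] E} (h : IsAdjointPair B T S)
    (hT : T ∈ compactOperators B E F) : S ∈ compactOperators B F E := by
  have hspan : ∀ T' ∈ Submodule.span ℂ {T : E →L[ℂ] F | ∃ (x : F) (y : E), ∀ z, T z = x <• ⟪y, z⟫_B},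
      ∃ S' ∈ compactOperators B F E, IsAdjointPair B T' S' := by
    intro T' hT'
    induction hT' using Submodule.span_induction with
    | mem T' hT' =>
      obtain ⟨x, y, hxy⟩ := hT'
      obtain rfl : T' = rankOne B x y := ContinuousLinearMap.ext hxy
      exact ⟨rankOne B y x, rankOne_mem_compactOperators (rankOne_apply y x),
        isAdjointPair_rankOne x y⟩
    | zero => exact ⟨0, zero_mem _, .zero⟩
    | add T₁ T₂ _ _ h₁ h₂ =>
      obtain ⟨S₁, hS₁, h₁⟩ := h₁
      obtain ⟨S₂, hS₂, h₂⟩ := h₂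
      exact ⟨S₁ + S₂, add_mem hS₁ hS₂, h₁.add h₂⟩
    | smul c T₁ _ h₁ =>
      obtain ⟨S₁, hS₁, h₁⟩ := h₁
      exact ⟨_, Submodule.smul_mem _ _ hS₁, h₁.smul c⟩
  refine isClosed_compactOperators.closure_subset ?_
  rw [Metric.mem_closure_iff]
  intro ε hε
  obtain ⟨T', hT', hd⟩ := Metric.mem_closure_iff.1 hT ε hε
  obtain ⟨S', hS', h'⟩ := hspan T' hT'
  refine ⟨S', hS', ?_⟩
  rw [dist_eq_norm] at hd ⊢
  exact ((h.sub h').opNorm_le).trans_lt hd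

end adjoint

section action

variable {H B E : Type*} [Group H] [TopologicalSpace H] [NonUnitalCStarAlgebra B]
  [PartialOrder B] [StarOrderedRing B] [NormedAddCommGroup E] [NormedSpace ℂ E] [CompleteSpace E]
  [SMul Bᵐᵒᵖ E] [HilbertModule B E] {β : CStarAction H B}

namespace HilbertAction

lemma mul_apply (γ : HilbertAction β E) (g h : H) (x : E) : γ (g * h) x = γ g (γ h x) := by
  rw [map_mul]; rfl

lemma one_apply (γ : HilbertAction β E) (x : E) : γ 1 x = x := by
  rw [map_one]; rfl

lemma apply_inv_apply (γ : HilbertAction β E) (h : H) (x : E) : γ h (γ h⁻¹ x) = x := by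
  rw [← mul_apply, mul_inv_cancel, one_apply]

lemma inv_apply_apply (γ : HilbertAction β E) (h : H) (x : E) : γ h⁻¹ (γ h x) = x := by
  rw [← mul_apply, inv_mul_cancel, one_apply]

lemma ip_apply_left (γ : HilbertAction β E) (h : H) (x y : E) :
    ⟪γ h x, y⟫_B = β h ⟪x, γ h⁻¹ y⟫_B := by
  rw [← γ.ip_map, apply_inv_apply]

lemma conj_apply (γ : HilbertAction β E) (h : H) (T : E →L[ℂ] E) (x : E) :
    γ.conj h T x = γ h (T (γ h⁻¹ x)) := rfl

lemma conj_mul (γ : HilbertAction β E) (h : H) (S T : E →L[ℂ] E) :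
    γ.conj h (S * T) = γ.conj h S * γ.conj h T := by
  ext x
  change γ h (S (T (γ h⁻¹ x))) = γ h (S (γ h⁻¹ (γ h (T (γ h⁻¹ x)))))
  rw [inv_apply_apply]

lemma conj_one (γ : HilbertAction β E) (h : H) : γ.conj h 1 = 1 :=
  ContinuousLinearMap.ext fun x => apply_inv_apply γ h x

lemma conj_add (γ : HilbertAction β E) (h : H) (S T : E →L[ℂ] E) :
    γ.conj h (S + T) = γ.conj h S + γ.conj h T := by
  simp only [conj, mul_add, add_mul]

lemma conj_sub (γ : HilbertAction β E) (h : H) (S T : E →L[ℂ] E) :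
    γ.conj h (S - T) = γ.conj h S - γ.conj h T := by
  simp only [conj, mul_sub, sub_mul]

lemma conj_smul (γ : HilbertAction β E) (h : H) (c : ℂ) (T : E →L[ℂ] E) :
    γ.conj h (c • T) = c • γ.conj h T := by
  simp only [conj, mul_smul_comm, smul_mul_assoc]

lemma isAdjointPair_conj (γ : HilbertAction β E) (h : H) {T S : E →L[ℂ] E}
    (hT : IsAdjointPair B T S) : IsAdjointPair B (γ.conj h T) (γ.conj h S) := fun x y => by
  have e : ⟪x, γ h (S (γ h⁻¹ y))⟫_B = β h ⟪γ h⁻¹ x, S (γ h⁻¹ y)⟫_B := by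
    rw [← γ.ip_map, apply_inv_apply]
  rw [conj_apply, conj_apply, ip_apply_left, hT, e]

lemma norm_conj_le (γ : HilbertAction β E) (h : H) (T : E →L[ℂ] E) : ‖γ.conj h T‖ ≤ ‖T‖ := by
  refine ContinuousLinearMap.opNorm_le_bound _ (norm_nonneg _) fun x => ?_
  rw [conj_apply, γ.norm_map]
  simpa only [γ.norm_map] using T.le_opNorm (γ h⁻¹ x)

lemma conj_mem_compactOperators (γ : HilbertAction β E) (h : H) {T : E →L[ℂ] E}
    (hT : T ∈ compactOperators B E E) : γ.conj h T ∈ compactOperators B E E :=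
  map_mem_compactOperators
    ((ContinuousLinearMap.compL ℂ E E E (γ h)).comp
      ((ContinuousLinearMap.compL ℂ E E E).flip (γ h⁻¹)))
    (fun T x y hxy => rankOne_mem_compactOperators (x := γ h x) (y := γ h y) fun z => by
      change γ h (T (γ h⁻¹ z)) = _
      rw [hxy, γ.map_op_smul, ip_apply_left]) hT

end HilbertAction

end action

section directSum

variable {B E F : Type*} [NonUnitalCStarAlgebra B] [PartialOrder B] [StarOrderedRing B]
  [NormedAddCommGroup E] [NormedSpace ℂ E] [CompleteSpace E] [SMul Bᵐᵒᵖ E] [HilbertModule B E]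
  [NormedAddCommGroup F] [NormedSpace ℂ F] [CompleteSpace F] [SMul Bᵐᵒᵖ F] [HilbertModule B F]

/-- An operator matrix with compact off-diagonal entries and zero diagonal is compact. -/
lemma offDiagonal_mem_compactOperators {S : F →L[ℂ] E} {T : E →L[ℂ] F}
    (hS : S ∈ compactOperators B F E) (hT : T ∈ compactOperators B E F) :
    (S.comp (ContinuousLinearMap.snd ℂ E F)).prod (T.comp (ContinuousLinearMap.fst ℂ E F)) ∈
      compactOperators B (E × F) (E × F) := by
  have h1 := map_mem_compactOperators (B := B) (X' := E × F) (Y' := E × F)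
    ((ContinuousLinearMap.compL ℂ (E × F) E (E × F) (ContinuousLinearMap.inl ℂ E F)).comp
      ((ContinuousLinearMap.compL ℂ (E × F) F E).flip (ContinuousLinearMap.snd ℂ E F)))
    (fun T x y h => rankOne_mem_compactOperators (x := (x, 0)) (y := (0, y)) fun z => by
      change (T z.2, (0 : F)) = (x <• (⟪0, z.1⟫_B + ⟪y, z.2⟫_B), (0 : F) <• (⟪0, z.1⟫_B + ⟪y, z.2⟫_B))
      rw [h, ip_zero_left, zero_add, zero_op_smul]) hS
  have h2 := map_mem_compactOperators (B := B) (X' := E × F) (Y' := E × F)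
    ((ContinuousLinearMap.compL ℂ (E × F) F (E × F) (ContinuousLinearMap.inr ℂ E F)).comp
      ((ContinuousLinearMap.compL ℂ (E × F) E F).flip (ContinuousLinearMap.fst ℂ E F)))
    (fun T x y h => rankOne_mem_compactOperators (x := (0, x)) (y := (y, 0)) fun z => by
      change ((0 : E), T z.1) = ((0 : E) <• (⟪y, z.1⟫_B + ⟪0, z.2⟫_B), x <• (⟪y, z.1⟫_B + ⟪0, z.2⟫_B))
      rw [h, ip_zero_left, add_zero, zero_op_smul]) hT
  convert add_mem h1 h2 using 1
  ext z
  all_goals simp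

end directSum

/-! ### Positive operators and contractions -/

section positive

variable {B E : Type*} [NonUnitalCStarAlgebra B] [PartialOrder B] [StarOrderedRing B]
  [NormedAddCommGroup E] [NormedSpace ℂ E] [CompleteSpace E] [SMul Bᵐᵒᵖ E] [HilbertModule B E]

lemma norm_le_norm_smul_add_apply {P : E →L[ℂ] E} (hP : ∀ x, 0 ≤ ⟪x, P x⟫_B) {c : ℝ} (hc : 0 < c)
    (x : E) : c * ‖x‖ ≤ ‖((c : ℂ) • (1 : E →L[ℂ] E) + P) x‖ := by
  have h1 : ⟪x, ((c : ℂ) • (1 : E →L[ℂ] E) + P) x⟫_B = c • ⟪x, x⟫_B + ⟪x, P x⟫_B := by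
    rw [add_apply, smul_apply, ip_add_right, ip_smul_right, Complex.coe_smul]
    rfl
  have h2 : ‖c • ⟪x, x⟫_B‖ ≤ ‖⟪x, ((c : ℂ) • (1 : E →L[ℂ] E) + P) x⟫_B‖ := by
    rw [h1]
    exact CStarAlgebra.norm_le_norm_of_nonneg_of_le (smul_nonneg hc.le (ip_self_nonneg x))
      (le_add_of_nonneg_right (hP x))
  rw [norm_smul, Real.norm_of_nonneg hc.le, ← HilbertModule.norm_sq_eq (B := B)] at h2
  have h3 := h2.trans (HilbertModule.norm_ip_le _ _)
  rcases (norm_nonneg x).eq_or_lt with h0 | h0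
  · rw [← h0, mul_zero]; positivity
  · nlinarith

/-- If `P ≥ 0` is an adjointable operator, then `1 + P` is invertible and its inverse is a
self-adjoint contraction.  The operator `c + P` is invertible for large `c` by the Neumann series,
and since `‖(c + P)⁻¹‖ ≤ 1 / c` another Neumann series reaches `1 + P` from there. -/
lemma exists_inverse_one_add {P : E →L[ℂ] E} (hP : ∀ x, 0 ≤ ⟪x, P x⟫_B)
    (hPs : IsAdjointPair B P P) : ∃ R : E →L[ℂ] E, IsAdjointPair B R R ∧ (1 + P) * R = 1 ∧
      R * (1 + P) = 1 ∧ ‖R‖ ≤ 1 := by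
  set c : ℝ := ‖P‖ + 1 with hc
  have hc1 : 1 ≤ c := by simp [hc]
  have hc0 : 0 < c := by linarith
  have hcC : (c : ℂ) ≠ 0 := by exact_mod_cast hc0.ne'
  have hu : IsUnit ((c : ℂ) • (1 : E →L[ℂ] E) + P) := by
    have h1 : ‖-((c : ℂ)⁻¹ • P)‖ < 1 := by
      rw [norm_neg, norm_smul, norm_inv, Complex.norm_real, Real.norm_of_nonneg hc0.le,
        inv_mul_lt_iff₀ hc0]
      linarith
    have h2 := isUnit_one_sub_of_norm_lt_one h1
    have h3 : (c : ℂ) • (1 : E →L[ℂ] E) + P = (Units.mk0 (c : ℂ) hcC) • (1 - -((c : ℂ)⁻¹ • P)) := by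
      rw [sub_neg_eq_add, smul_add, Units.smul_def, Units.smul_def, Units.val_mk0, smul_smul,
        mul_inv_cancel₀ hcC, one_smul]
    rw [h3]
    exact h2.smul _
  obtain ⟨⟨Q, S, hQS, hSQ⟩, hQ⟩ := hu
  change Q = _ at hQ
  have hS : ‖S‖ ≤ c⁻¹ := by
    refine S.opNorm_le_bound (by positivity) fun x => ?_
    have h1 := norm_le_norm_smul_add_apply hP hc0 (S x)
    rw [← hQ, ← mul_apply_eq_comp, hQS] at h1
    rw [← div_eq_inv_mul, le_div_iff₀' hc0]
    exact h1
  have hu1 : IsUnit (1 + P) := by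
    have h1 : ‖((c : ℂ) - 1) • S‖ < 1 := by
      rw [norm_smul]
      have h2 : ‖(c : ℂ) - 1‖ = c - 1 := by
        rw [show (c : ℂ) - 1 = ((c - 1 : ℝ) : ℂ) by push_cast; rfl, Complex.norm_real,
          Real.norm_of_nonneg (by linarith)]
      rw [h2]
      calc (c - 1) * ‖S‖ ≤ (c - 1) * c⁻¹ := by gcongr
        _ < 1 := by rw [← div_eq_mul_inv, div_lt_one hc0]; linarith
    have h2 := isUnit_one_sub_of_norm_lt_one h1
    have h3 : 1 + P = Q * (1 - ((c : ℂ) - 1) • S) := by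
      rw [mul_sub, mul_one, mul_smul_comm, hQS, hQ, sub_smul, one_smul]
      abel
    rw [h3]
    exact IsUnit.mul ⟨⟨Q, S, hQS, hSQ⟩, rfl⟩ h2
  obtain ⟨⟨Q', R, hQR, hRQ⟩, hQ'⟩ := hu1
  change Q' = _ at hQ'
  rw [hQ'] at hQR hRQ
  refine ⟨R, fun x y => ?_, hQR, hRQ, ?_⟩
  · have h1 : y = (1 + P) (R y) := by rw [← mul_apply_eq_comp, hQR]; rfl
    have h2 : (1 + P) (R x) = x := by rw [← mul_apply_eq_comp, hQR]; rfl
    nth_rewrite 1 [h1]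
    rw [← (IsAdjointPair.one (B := B)).add hPs, h2]
  · refine R.opNorm_le_bound zero_le_one fun x => ?_
    have h1 := norm_le_norm_smul_add_apply hP one_pos (R x)
    rw [Complex.ofReal_one, one_smul, ← mul_apply_eq_comp, hQR, one_mul] at h1
    rw [one_mul]
    exact h1

/-- A self-adjoint contraction `T` satisfies `⟪T x, T x⟫ ≤ ⟪x, x⟫` in the order of `B`.  Since
`(1 - T ^ (2 * k)) ^ 2 ≥ 0`, the elements `a k = ⟪T ^ k x, T ^ k x⟫` satisfy
`2 * a k ≤ a 0 + a (2 * k)`; iterating this gives `2 ^ n * (a 0 - a 1) ≥ a 0 - a (2 ^ n)`, and the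
right hand side is bounded. -/
lemma IsAdjointPair.ip_apply_self_le {T : E →L[ℂ] E} (hT : IsAdjointPair B T T) (h1 : ‖T‖ ≤ 1)
    (x : E) : ⟪T x, T x⟫_B ≤ ⟪x, x⟫_B := by
  have hpow : ∀ k, IsAdjointPair B (T ^ k) (T ^ k) := by
    intro k
    induction k with
    | zero => exact .one
    | succ k ih =>
      have := ih.mul hT
      rwa [← pow_succ, ← pow_succ'] at this
  set a : ℕ → B := fun k => ⟪(T ^ k) x, (T ^ k) x⟫_B with ha
  have hstep : ∀ k, 2 • a k ≤ ⟪x, x⟫_B + a (2 * k) := by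
    intro k
    have h2 : ⟪x, (T ^ (2 * k)) x⟫_B = a k := by
      rw [two_mul, pow_add, mul_apply_eq_comp, ← hpow k]
    have h3 : ⟪(T ^ (2 * k)) x, x⟫_B = a k := by rw [hpow, h2]
    have h4 := ip_self_nonneg (B := B) (x - (T ^ (2 * k)) x)
    rw [ip_sub_left, ip_sub_right, ip_sub_right, h2, h3] at h4
    rw [← sub_nonneg]
    convert h4 using 1
    rw [two_nsmul]
    abel
  have hn : ∀ n : ℕ, (2 ^ n) • a 1 + ⟪x, x⟫_B ≤ (2 ^ n) • ⟪x, x⟫_B + a (2 ^ n) := by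
    intro n
    induction n with
    | zero => simp only [pow_zero, one_smul]; rw [add_comm]
    | succ n ih =>
      have h2 := add_le_add (nsmul_le_nsmul_right ih 2) (hstep (2 ^ n))
      rw [← pow_succ'] at h2
      rw [← sub_nonneg] at h2 ⊢
      convert h2 using 1
      rw [pow_succ', mul_smul, mul_smul, two_smul, two_smul, two_smul, two_smul, two_smul]
      abel
  have hle : ∀ n : ℕ, 0 ≤ (⟪x, x⟫_B - a 1) + ((1 / 2 : ℝ) ^ n) • (a (2 ^ n) - ⟪x, x⟫_B) := by
    intro n
    have h2 := smul_nonneg (show (0 : ℝ) ≤ (1 / 2) ^ n by positivity) (sub_nonneg.2 (hn n))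
    convert h2 using 1
    have h3 : ∀ b : B, b = ((1 / 2 : ℝ) ^ n) • ((2 ^ n : ℕ) • b) := by
      intro b
      rw [← Nat.cast_smul_eq_nsmul ℝ, smul_smul, Nat.cast_pow, ← mul_pow]
      norm_num
    nth_rewrite 1 [h3 (⟪x, x⟫_B - a 1)]
    rw [← smul_add, smul_sub]
    congr 1
    abel
  have hlim : Tendsto (fun n => (⟪x, x⟫_B - a 1) + ((1 / 2 : ℝ) ^ n) • (a (2 ^ n) - ⟪x, x⟫_B))
      atTop (𝓝 (⟪x, x⟫_B - a 1 + 0)) := by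
    refine tendsto_const_nhds.add ?_
    refine (tendsto_pow_atTop_nhds_zero_of_lt_one (by norm_num : (0 : ℝ) ≤ 1 / 2)
      (by norm_num)).zero_smul_isBoundedUnder_le ?_
    refine isBoundedUnder_of ⟨‖x‖ ^ 2 + ‖x‖ ^ 2, fun n => ?_⟩
    refine (norm_sub_le _ _).trans (add_le_add ?_ (HilbertModule.norm_sq_eq x).ge)
    have h2 : ‖(T ^ 2 ^ n) x‖ ≤ ‖x‖ := by
      refine ((T ^ 2 ^ n).le_opNorm x).trans (mul_le_of_le_one_left (norm_nonneg _) ?_)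
      exact (norm_pow_le' T (by positivity)).trans (pow_le_one₀ (norm_nonneg _) h1)
    change ‖⟪(T ^ 2 ^ n) x, (T ^ 2 ^ n) x⟫_B‖ ≤ _
    rw [← HilbertModule.norm_sq_eq]
    gcongr
  have h0 := ge_of_tendsto' hlim hle
  rw [add_zero, sub_nonneg] at h0
  simpa [ha] using h0

end positive

/-! ### Approximate units of compact operators -/

section approximateUnit

lemma tendsto_zero_of_mem_closure_span {X Y : Type*} [NormedAddCommGroup X] [NormedSpace ℂ X]
    [NormedAddCommGroup Y] [NormedSpace ℂ Y] (L : ℕ → X →L[ℂ] Y) (hL : ∀ n, ‖L n‖ ≤ 1)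
    {s : Set X} (hs : ∀ x ∈ s, Tendsto (fun n => L n x) atTop (𝓝 0)) {x : X}
    (hx : x ∈ closure (Submodule.span ℂ s : Set X)) : Tendsto (fun n => L n x) atTop (𝓝 0) := by
  have hspan : ∀ y ∈ Submodule.span ℂ s, Tendsto (fun n => L n y) atTop (𝓝 0) := by
    intro y hy
    induction hy using Submodule.span_induction with
    | mem y hy => exact hs y hy
    | zero => simp
    | add y z _ _ hy hz => simpa using hy.add hz
    | smul c y _ hy => simpa using hy.const_smul c
  rw [Metric.tendsto_nhds]
  intro ε hε
  obtain ⟨y, hy, hxy⟩ := Metric.mem_closure_iff.1 hx (ε / 2) (by positivity)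
  filter_upwards [Metric.tendsto_nhds.1 (hspan y hy) (ε / 2) (by positivity)] with n hn
  rw [dist_zero_right] at hn ⊢
  rw [dist_eq_norm] at hxy
  have h1 : ‖L n (x - y)‖ ≤ ‖x - y‖ :=
    ((L n).le_opNorm _).trans (mul_le_of_le_one_left (norm_nonneg _) (hL n))
  calc ‖L n x‖ = ‖L n (x - y) + L n y‖ := by rw [map_sub, sub_add_cancel]
    _ ≤ ‖L n (x - y)‖ + ‖L n y‖ := norm_add_le _ _
    _ < ε := by linarith

variable {B E : Type*} [NonUnitalCStarAlgebra B] [PartialOrder B] [StarOrderedRing B]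
  [NormedAddCommGroup E] [NormedSpace ℂ E] [CompleteSpace E] [SMul Bᵐᵒᵖ E] [HilbertModule B E]

/-- If the sequence `s` generates the Hilbert module `E` and `k n = ∑ j < n, |s j⟩⟨s j|`, then the
operators `r n = (1 + n * k n)⁻¹` converge strongly to `0`, because `‖r n (s j)‖ ^ 2 ≤ 1 / n` for
`j < n`.  So the compact operators `1 - r n` form an approximate unit for `𝕂(E)`. -/
lemma IsCountablyGenerated.exists_approximateUnit (h : IsCountablyGenerated B E) :
    ∃ r : ℕ → E →L[ℂ] E, (∀ n, 1 - r n ∈ compactOperators B E E) ∧ (∀ n, ‖r n‖ ≤ 1) ∧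
      ∀ k ∈ compactOperators B E E, Tendsto (fun n => k * r n) atTop (𝓝 0) := by
  obtain ⟨s, hs⟩ := h
  let P : ℕ → E →L[ℂ] E := fun n => (n : ℂ) • ∑ j ∈ Finset.range n, rankOne B (s j) (s j)
  have hPip : ∀ n x, ⟪x, P n x⟫_B = n • ∑ j ∈ Finset.range n, star ⟪s j, x⟫_B * ⟪s j, x⟫_B := by
    intro n x
    simp only [P, smul_apply, sum_apply, ip_smul_right, ip_sum_right, rankOne_apply,
      ip_op_smul_right, star_ip]
    rw [Nat.cast_smul_eq_nsmul]
  have hpos : ∀ n x, 0 ≤ ⟪x, P n x⟫_B := fun n x => by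
    rw [hPip]
    exact nsmul_nonneg (Finset.sum_nonneg fun j _ => star_mul_self_nonneg _) n
  have hPs : ∀ n, IsAdjointPair B (P n) (P n) := by
    intro n
    have h1 : IsAdjointPair B (∑ j ∈ Finset.range n, rankOne B (s j) (s j))
        (∑ j ∈ Finset.range n, rankOne B (s j) (s j)) := fun x y => by
      rw [sum_apply, sum_apply, ip_sum_left, ip_sum_right]
      exact Finset.sum_congr rfl fun j _ => isAdjointPair_rankOne _ _ _ _
    simpa [P] using h1.smul (n : ℂ)
  choose r hrs hPr hrP hr1 using fun n => exists_inverse_one_add (hpos n) (hPs n)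
  have hbound : ∀ j n, j < n → n * ‖r n (s j)‖ ^ 2 ≤ 1 := by
    intro j n hj
    -- With `y = r n z` one has `n * |⟪s j, y⟫| ^ 2 ≤ ⟪y, P n y⟫ ≤ ⟪y, z⟫`, and `⟪s j, y⟫ = ⟪z, z⟫`.
    set z := r n (s j) with hz
    set y := r n z with hy
    have h1 : y + P n y = z := by
      have : ((1 + P n) * r n) z = z := by rw [hPr]; rfl
      exact this
    have h2 : ⟪y, z⟫_B = ⟪y, y⟫_B + ⟪y, P n y⟫_B := by rw [← h1, ip_add_right]
    have h3 : n • (star ⟪s j, y⟫_B * ⟪s j, y⟫_B) ≤ ⟪y, z⟫_B := by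
      rw [h2, hPip]
      refine le_add_of_nonneg_of_le (ip_self_nonneg y) (nsmul_le_nsmul_right ?_ n)
      exact Finset.single_le_sum (f := fun j => star ⟪s j, y⟫_B * ⟪s j, y⟫_B)
        (fun j _ => star_mul_self_nonneg _) (Finset.mem_range.2 hj)
    have h4 := CStarAlgebra.norm_le_norm_of_nonneg_of_le
      (nsmul_nonneg (star_mul_self_nonneg _) n) h3
    have h5 : ⟪s j, y⟫_B = ⟪z, z⟫_B := by rw [hy, ← hrs]
    rw [h5, ← Nat.cast_smul_eq_nsmul ℝ, norm_smul, CStarRing.norm_star_mul_self,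
      ← HilbertModule.norm_sq_eq, Real.norm_natCast] at h4
    have h6 : ‖y‖ ≤ ‖z‖ :=
      ((r n).le_opNorm z).trans (mul_le_of_le_one_left (norm_nonneg _) (hr1 n))
    have h7 := h4.trans (HilbertModule.norm_ip_le y z)
    rcases (norm_nonneg z).eq_or_lt with h0 | h0
    · rw [← h0]; norm_num
    · have h8 : (n * ‖z‖ ^ 2) * ‖z‖ ^ 2 ≤ 1 * ‖z‖ ^ 2 := by nlinarith
      exact le_of_mul_le_mul_right h8 (by positivity)
  have hsj : ∀ j, Tendsto (fun n => r n (s j)) atTop (𝓝 0) := by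
    intro j
    have h1 : Tendsto (fun n => ‖r n (s j)‖ ^ 2) atTop (𝓝 0) := by
      refine squeeze_zero' (Eventually.of_forall fun n => by positivity) ?_
        tendsto_one_div_atTop_nhds_zero_nat
      filter_upwards [eventually_gt_atTop j] with n hn
      rw [le_div_iff₀ (by exact_mod_cast (Nat.zero_le j).trans_lt hn), mul_comm]
      exact hbound j n hn
    rw [tendsto_zero_iff_norm_tendsto_zero]
    simpa using h1.sqrt
  have hstrong : ∀ x, Tendsto (fun n => r n x) atTop (𝓝 0) := by
    intro x
    refine tendsto_zero_of_mem_closure_span r hr1 ?_ (hs x)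
    rintro _ ⟨j, b, rfl⟩
    have h1 := ((HilbertModule.opSMul E b).continuous.tendsto 0).comp (hsj j)
    rw [map_zero] at h1
    refine h1.congr fun n => ?_
    rw [(hrs n).map_op_smul]
    rfl
  refine ⟨r, fun n => ?_, hr1, fun k hk => ?_⟩
  · have h1 : 1 - r n = r n * P n := by
      rw [sub_eq_iff_eq_add, ← hrP n, mul_add, mul_one, add_comm]
    rw [h1]
    refine mul_mem_compactOperators_of_left (hrs n) (Submodule.smul_mem _ _ (sum_mem fun j _ => ?_))
    exact rankOne_mem_compactOperators (rankOne_apply _ _)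
  · refine tendsto_zero_of_mem_closure_span
      (fun n => (ContinuousLinearMap.compL ℂ E E E).flip (r n)) (fun n => ?_) ?_ hk
    · refine ContinuousLinearMap.opNorm_le_bound _ zero_le_one fun T => ?_
      calc ‖T.comp (r n)‖ ≤ ‖T‖ * ‖r n‖ := T.opNorm_comp_le _
        _ ≤ 1 * ‖T‖ := by rw [mul_comm]; gcongr; exact hr1 n
    · rintro T ⟨x, y, hT⟩
      rw [tendsto_zero_iff_norm_tendsto_zero]
      have h1 : Tendsto (fun n => ‖x‖ * ‖r n y‖) atTop (𝓝 0) := by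
        simpa using (hstrong y).norm.const_mul ‖x‖
      refine squeeze_zero (fun n => norm_nonneg _) (fun n => ?_) h1
      refine ContinuousLinearMap.opNorm_le_bound _ (by positivity) fun z => ?_
      change ‖T (r n z)‖ ≤ _
      rw [hT, ← hrs, mul_assoc]
      refine (norm_op_smul_le x _).trans ?_
      gcongr
      exact HilbertModule.norm_ip_le _ _

end approximateUnit

/-! ### Self-adjoint contractive perturbations -/

section perturbation

variable {G A B E : Type*} [Group G] [TopologicalSpace G]
  [NonUnitalCStarAlgebra A] [NonUnitalCStarAlgebra B] [PartialOrder B] [StarOrderedRing B]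
  [NormedAddCommGroup E] [NormedSpace ℂ E] [CompleteSpace E] [SMul Bᵐᵒᵖ E] [HilbertModule B E]

lemma gradingElt_mul_self : gradingElt G * gradingElt G = 1 := by
  refine Prod.ext (mul_one 1) ?_
  change Multiplicative.ofAdd ((1 : ZMod 2) + 1) = 1
  rfl

lemma gradingElt_inv : (gradingElt G)⁻¹ = gradingElt G :=
  inv_eq_of_mul_eq_one_left gradingElt_mul_self

lemma gradingElt_mul_comm (h : G₂ G) : gradingElt G * h = h * gradingElt G := by
  refine Prod.ext ?_ (mul_comm _ _)
  change 1 * h.1 = h.1 * 1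
  rw [one_mul, mul_one]

variable {α : CStarAction (G₂ G) A} {β : CStarAction (G₂ G) B} {γ : HilbertAction β E}

lemma HilbertAction.grading_apply_apply (γ : HilbertAction β E) (x : E) :
    γ (gradingElt G) (γ (gradingElt G) x) = x := by
  rw [← γ.mul_apply, gradingElt_mul_self, γ.one_apply]

lemma HilbertAction.isOdd_iff {T : E →L[ℂ] E} :
    IsOdd (γ (gradingElt G)) T ↔ γ.conj (gradingElt G) T = -T := by
  rw [HilbertAction.conj, gradingElt_inv, IsOdd]

/-- The graded commutator of an odd operator with `T`. -/
lemma gradedCommutator_of_isOdd {X : Type*} [NormedAddCommGroup X] [NormedSpace ℂ X]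
    {τ F T : X →L[ℂ] X} (hF : IsOdd τ F) : gradedCommutator τ F T = F * T - τ * T * τ * F := by
  rw [gradedCommutator, hF, add_neg_cancel, smul_zero, mul_zero, sub_zero, sub_neg_eq_add,
    ← two_smul ℂ F, smul_smul]
  norm_num

lemma HilbertAction.conj_rep {φ : StarRep A B E} (hφ : φ.IsEquivariant α γ) (h : G₂ G) (a : A) :
    γ.conj h (φ a) = φ (α h a) :=
  ContinuousLinearMap.ext fun x => by rw [γ.conj_apply, hφ, γ.apply_inv_apply]

lemma gradedCommutator_rep {φ : StarRep A B E} (hφ : φ.IsEquivariant α γ) {F : E →L[ℂ] E}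
    (hF : IsOdd (γ (gradingElt G)) F) (a : A) :
    gradedCommutator (γ (gradingElt G)) F (φ a) = F * φ a - φ (α (gradingElt G) a) * F := by
  rw [gradedCommutator_of_isOdd hF, ← HilbertAction.conj_rep hφ, HilbertAction.conj, gradingElt_inv]

lemma HilbertAction.isOdd_of_isAdjointPair {T S : E →L[ℂ] E} (hT : IsOdd (γ (gradingElt G)) T)
    (h : IsAdjointPair B T S) : IsOdd (γ (gradingElt G)) S := by
  rw [HilbertAction.isOdd_iff] at hT ⊢
  have h1 := γ.isAdjointPair_conj (gradingElt G) h
  rw [hT] at h1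
  refine h1.unique ?_
  simpa using h.smul (-1)

/-- The operator `F₀ = 2 F₁ (1 + F₁ ^ 2)⁻¹` with `F₁ = (F + F^*) / 2` is an odd self-adjoint
contraction.  It is a compact perturbation of `F` because `F₀ - F₁ = (1 + F₁ ^ 2)⁻¹ F₁ (1 - F₁ ^ 2)`,
and it is a contraction because `(1 + F₁ ^ 2) ^ 2 - (2 F₁) ^ 2 = (1 - F₁ ^ 2) ^ 2`. -/
lemma IsKasparovTriple.exists_selfAdjoint_contraction {φ : StarRep A B E} {F : E →L[ℂ] E}
    (hF : IsKasparovTriple α γ φ F) : ∃ F₀ : E →L[ℂ] E, IsAdjointPair B F₀ F₀ ∧ ‖F₀‖ ≤ 1 ∧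
      IsOdd (γ (gradingElt G)) F₀ ∧ IsCompactPerturbation φ F F₀ := by
  obtain ⟨Fs, hFs, hFc⟩ := hF.adjoint
  set F₁ : E →L[ℂ] E := (1 / 2 : ℂ) • (F + Fs) with hF₁
  have hF₁s : IsAdjointPair B F₁ F₁ := by
    have := (hFs.add hFs.symm).smul (1 / 2 : ℂ)
    rw [add_comm Fs F] at this
    simpa [hF₁] using this
  have hF₁odd : γ.conj (gradingElt G) F₁ = -F₁ := by
    rw [hF₁, γ.conj_smul, γ.conj_add, HilbertAction.isOdd_iff.1 hF.odd,
      HilbertAction.isOdd_iff.1 (HilbertAction.isOdd_of_isAdjointPair hF.odd hFs), ← neg_add, smul_neg]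
  have hPpos : ∀ x, 0 ≤ ⟪x, (F₁ * F₁) x⟫_B := fun x => by
    rw [mul_apply_eq_comp, ← hF₁s]
    exact ip_self_nonneg _
  obtain ⟨R, hRs, hPR, hRP, -⟩ := exists_inverse_one_add hPpos (hF₁s.mul hF₁s)
  have hcomm : R * F₁ = F₁ * R := by
    calc R * F₁ = R * F₁ * ((1 + F₁ * F₁) * R) := by rw [hPR, mul_one]
      _ = R * (1 + F₁ * F₁) * F₁ * R := by noncomm_ring
      _ = F₁ * R := by rw [hRP, one_mul]
  have hRconj : γ.conj (gradingElt G) R = R := by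
    have h1 : γ.conj (gradingElt G) R * (1 + F₁ * F₁) = 1 := by
      have h2 := congrArg (γ.conj (gradingElt G)) hRP
      rwa [γ.conj_mul, γ.conj_add, γ.conj_mul, hF₁odd, γ.conj_one, neg_mul_neg] at h2
    calc γ.conj (gradingElt G) R = γ.conj (gradingElt G) R * ((1 + F₁ * F₁) * R) := by
          rw [hPR, mul_one]
      _ = R := by rw [← mul_assoc, h1, one_mul]
  have hdiff : F₁ - F = (1 / 2 : ℂ) • (Fs - F) := by
    rw [hF₁]
    module
  have hF₁c : ∀ a, (F₁ - F) * φ a ∈ compactOperators B E E := fun a => by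
    rw [hdiff, smul_mul_assoc, ← neg_sub F Fs, neg_mul]
    exact Submodule.smul_mem _ _ (neg_mem (hFc a))
  have hsq : ∀ a, (1 - F₁ * F₁) * φ a ∈ compactOperators B E E := by
    intro a
    have h1 := hF.commutator a
    rw [gradedCommutator_rep hF.equivariant hF.odd] at h1
    have h2 : IsAdjointPair B (F₁ - F) (F₁ - Fs) := hF₁s.sub hFs
    -- `F φ(a)` is moved to `φ(τ a) F` by the graded commutator, so that `F₁ - F` meets `φ(τ a)`.
    have e : (1 - F₁ * F₁) * φ a = (1 - F * F) * φ a - F₁ * ((F₁ - F) * φ a)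
        - ((F₁ - F) * (F * φ a - φ (α (gradingElt G) a) * F)
          + (F₁ - F) * φ (α (gradingElt G) a) * F) := by noncomm_ring
    rw [e]
    refine sub_mem (sub_mem (hF.sq a) (mul_mem_compactOperators_of_left hF₁s (hF₁c a)))
      (add_mem (mul_mem_compactOperators_of_left h2 h1)
        (mul_mem_compactOperators_of_right hFs (hF₁c _)))
  have hF₀s : IsAdjointPair B ((2 : ℂ) • (F₁ * R)) ((2 : ℂ) • (F₁ * R)) := by
    have := (hF₁s.mul hRs).smul (2 : ℂ)
    rw [hcomm] at this
    simpa using this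
  have hF₀c : ∀ a, ((2 : ℂ) • (F₁ * R) - F) * φ a ∈ compactOperators B E E := by
    intro a
    have e0 : (2 : ℂ) • (F₁ * R) - F₁ = R * F₁ * (1 - F₁ * F₁) := by
      have e1 : F₁ = R * F₁ * (1 + F₁ * F₁) := by
        calc F₁ = R * (1 + F₁ * F₁) * F₁ := by rw [hRP, one_mul]
          _ = R * F₁ * (1 + F₁ * F₁) := by noncomm_ring
      nth_rewrite 2 [e1]
      rw [← hcomm, two_smul]
      noncomm_ring
    have e : ((2 : ℂ) • (F₁ * R) - F) * φ a = R * F₁ * ((1 - F₁ * F₁) * φ a) + (F₁ - F) * φ a := by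
      rw [← mul_assoc, ← e0, ← add_mul, sub_add_sub_cancel]
    rw [e]
    exact add_mem (mul_mem_compactOperators_of_left (hRs.mul hF₁s) (hsq a)) (hF₁c a)
  refine ⟨(2 : ℂ) • (F₁ * R), hF₀s, ?_, ?_, fun a => ⟨hF₀c a, ?_⟩⟩
  · refine ContinuousLinearMap.opNorm_le_bound _ zero_le_one fun x => ?_
    set y := R x with hy
    have hx : x = y + F₁ (F₁ y) := by
      have : ((1 + F₁ * F₁) * R) x = x := by rw [hPR]; rfl
      exact this.symm
    have e1 : ((2 : ℂ) • (F₁ * R)) x = F₁ y + F₁ y := by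
      rw [smul_apply, two_smul]; rfl
    rw [one_mul, e1]
    have hF₁y : ⟪F₁ y, F₁ y⟫_B = ⟪y, F₁ (F₁ y)⟫_B := hF₁s _ _
    have hF₁y' : ⟪F₁ (F₁ y), y⟫_B = ⟪y, F₁ (F₁ y)⟫_B := by rw [hF₁s, hF₁s]
    have h1 : ⟪F₁ y + F₁ y, F₁ y + F₁ y⟫_B ≤ ⟪x, x⟫_B := by
      rw [← sub_nonneg]
      convert ip_self_nonneg (B := B) (y - F₁ (F₁ y)) using 1
      rw [hx]
      simp only [ip_add_left, ip_add_right, ip_sub_left, ip_sub_right, hF₁y, hF₁y']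
      abel
    have h2 := CStarAlgebra.norm_le_norm_of_nonneg_of_le (ip_self_nonneg _) h1
    rw [← HilbertModule.norm_sq_eq, ← HilbertModule.norm_sq_eq] at h2
    exact (sq_le_sq₀ (norm_nonneg _) (norm_nonneg _)).1 h2
  · rw [HilbertAction.isOdd_iff, γ.conj_smul, γ.conj_mul, hRconj, hF₁odd, neg_mul, smul_neg]
  · have h1 : IsAdjointPair B (((2 : ℂ) • (F₁ * R) - Fs) * φ (star a))
        (φ a * ((2 : ℂ) • (F₁ * R) - F)) := by
      have h2 := (hF₀s.sub hFs.symm).mul (φ.adjoint (star a))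
      rwa [star_star] at h2
    refine h1.mem_compactOperators ?_
    have e : ((2 : ℂ) • (F₁ * R) - Fs) * φ (star a) =
        ((2 : ℂ) • (F₁ * R) - F) * φ (star a) + (F - Fs) * φ (star a) := by
      rw [← add_mul, sub_add_sub_cancel]
    rw [e]
    exact add_mem (hF₀c _) (hFc _)

end perturbation

/-! ### The unitary `L²(G, A) ⊗_φ E ≅ L²(G, E)` -/

section bounded

variable {A B E : Type*} [NonUnitalCStarAlgebra A] [PartialOrder A] [StarOrderedRing A]
  [NonUnitalCStarAlgebra B] [PartialOrder B] [StarOrderedRing B]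
  [NormedAddCommGroup E] [NormedSpace ℂ E] [CompleteSpace E] [SMul Bᵐᵒᵖ E] [HilbertModule B E]

lemma StarRep.exists_opNorm_le (φ : StarRep A B E) : ∃ C, ∀ a, ‖φ a‖ ≤ C * ‖a‖ := by
  let f (y : E) : A →L[ℂ] E :=
    { toFun := fun a => φ a y
      map_add' := fun a b => by rw [map_add, add_apply]
      map_smul' := fun c a => by rw [map_smul, smul_apply, RingHom.id_apply]
      cont := φ.continuous_apply y }
  obtain ⟨C, hC⟩ := banach_steinhaus (g := fun a : Metric.closedBall (0 : A) 1 => φ a.1)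
    fun y => ⟨‖f y‖, fun a => by
      have h1 := (f y).le_opNorm a.1
      have h2 : ‖a.1‖ ≤ 1 := mem_closedBall_zero_iff.1 a.2
      exact h1.trans (mul_le_of_le_one_right (norm_nonneg _) h2)⟩
  refine ⟨C, fun a => ?_⟩
  rcases eq_or_ne a 0 with rfl | ha
  · simp
  have ha' : 0 < ‖a‖ := norm_pos_iff.2 ha
  have h1 := hC ⟨((‖a‖⁻¹ : ℝ) : ℂ) • a, by
    rw [mem_closedBall_zero_iff, norm_smul, Complex.norm_real, norm_inv, norm_norm,
      inv_mul_cancel₀ ha'.ne']⟩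
  dsimp only at h1
  rwa [map_smul, norm_smul, Complex.norm_real, norm_inv, norm_norm, inv_mul_le_iff₀' ha'] at h1

/-- A ⋆-homomorphism `A → 𝕃(E)` as a bounded linear map. -/
noncomputable def StarRep.toCLM (φ : StarRep A B E) : A →L[ℂ] (E →L[ℂ] E) :=
  LinearMap.mkContinuous
    { toFun := fun a => φ a
      map_add' := map_add φ.toHom
      map_smul' := map_smul φ.toHom }
    φ.exists_opNorm_le.choose φ.exists_opNorm_le.choose_spec

end bounded

section unitary

variable {G A B E : Type*} [Group G] [TopologicalSpace G] [IsTopologicalGroup G]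
  [LocallyCompactSpace G] [MeasurableSpace G] [BorelSpace G]
  [NonUnitalCStarAlgebra A] [PartialOrder A] [StarOrderedRing A]
  [NonUnitalCStarAlgebra B] [PartialOrder B] [StarOrderedRing B]
  [NormedAddCommGroup E] [NormedSpace ℂ E] [CompleteSpace E] [SMul Bᵐᵒᵖ E] [HilbertModule B E]
  {μ : Measure G} [μ.IsHaarMeasure]

namespace CcSpace

/-- The evaluation at a point of `G`. -/
noncomputable def eval (x : G) : CcSpace μ B E →ₗ[ℂ] E where
  toFun f := f x
  map_add' _ _ := rfl
  map_smul' _ _ := rfl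

lemma sub_apply (f g : CcSpace μ B E) (x : G) : (f - g) x = f x - g x := map_sub (eval x) f g

lemma sum_apply {ι : Type*} (s : Finset ι) (f : ι → CcSpace μ B E) (x : G) :
    (∑ i ∈ s, f i) x = ∑ i ∈ s, f i x := map_sum (eval x) f s

lemma norm_sq_integrable (f : CcSpace μ B E) : Integrable (fun x => ‖f x‖ ^ 2) μ := by
  have hc : Continuous fun x => ‖f x‖ ^ 2 := f.continuous.norm.pow 2
  refine hc.integrable_of_hasCompactSupport ?_
  refine f.hasCompactSupport.mono fun x hx => ?_
  contrapose! hx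
  rw [Function.notMem_support] at hx ⊢
  rw [hx, norm_zero, zero_pow two_ne_zero]

lemma norm_of_sq_le (f : CcSpace μ B E) : ‖L2.of μ f‖ ^ 2 ≤ ∫ x, ‖f x‖ ^ 2 ∂μ := by
  rw [L2.of, HilbertCompletion.norm_of_sq, ip_def]
  refine (norm_integral_le_integral_norm _).trans_eq ?_
  simp only [← HilbertModule.norm_sq_eq]

lemma norm_of_sq_le_of_norm_le {f : CcSpace μ B E} {K : Set G} (hK : IsCompact K)
    (hK' : MeasurableSet K) (hf : ∀ x ∉ K, f x = 0) {ε : ℝ} (hfε : ∀ x, ‖f x‖ ≤ ε) :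
    ‖L2.of μ f‖ ^ 2 ≤ ε ^ 2 * μ.real K := by
  have h1 : ∫ x, ‖f x‖ ^ 2 ∂μ = ∫ x in K, ‖f x‖ ^ 2 ∂μ := by
    refine (setIntegral_eq_integral_of_forall_compl_eq_zero fun x hx => ?_).symm
    rw [hf x hx, norm_zero, zero_pow two_ne_zero]
  have h2 : ∫ x in K, ‖f x‖ ^ 2 ∂μ ≤ ∫ _ in K, ε ^ 2 ∂μ := by
    refine setIntegral_mono_on (norm_sq_integrable f).integrableOn
      (integrableOn_const hK.measure_lt_top.ne) hK' fun x _ => ?_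
    have := hfε x
    gcongr
  refine (norm_of_sq_le f).trans ?_
  rw [h1]
  refine h2.trans_eq ?_
  rw [setIntegral_const, smul_eq_mul, mul_comm]

/-- The function `g ↦ φ(f(g)) e`. -/
noncomputable def rep (φ : StarRep A B E) (f : CcSpace μ A A) (e : E) : CcSpace μ B E :=
  mk' μ B (fun g => φ (f g) e) ((φ.continuous_apply e).comp f.continuous)
    (f.hasCompactSupport.comp_left (g := fun a => φ a e) (by simp))

lemma rep_apply (φ : StarRep A B E) (f : CcSpace μ A A) (e : E) (g : G) :
    rep φ f e g = φ (f g) e := rfl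

lemma ip_rep (φ : StarRep A B E) (f f' : CcSpace μ A A) (e e' : E) :
    ⟪rep φ f e, rep φ f' e'⟫_B = ⟪e, φ ⟪f, f'⟫_A e'⟫_B := by
  let L : A →L[ℂ] B :=
    { toFun := fun a => ⟪e, φ a e'⟫_B
      map_add' := fun a b => by rw [map_add, _root_.add_apply, ip_add_right]
      map_smul' := fun c a => by rw [map_smul, _root_.smul_apply, ip_smul_right, RingHom.id_apply]
      cont := continuous_const.ip (φ.continuous_apply e') }
  have h1 := L.integral_comp_comm (ip_integrable f f')
  rw [ip_def, ip_def]
  refine Eq.trans (integral_congr_ae (Eventually.of_forall fun x => ?_)) h1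
  change ⟪φ (f x) e, φ (f' x) e'⟫_B = ⟪e, φ (star (f x) * f' x) e'⟫_B
  rw [φ.ip_left, map_mul]
  rfl

/-- The functions `g ↦ φ(f(g)) e` span a dense subspace of `L²(G, E)` if `φ` is essential.  To
approximate `k`, take a fine partition of unity `(χ_i)` on the support of `k`, with points `x_i`
where `χ_i` is concentrated, and write `k(x_i) = φ(a_i) e_i`; then `∑ i, χ_i ⊗ k(x_i)` has the
required form and is uniformly close to `k`. -/
lemma mem_closure_span_rep [T2Space G] {φ : StarRep A B E} (hφ : φ.IsEssential)
    (k : CcSpace μ B E) : L2.of μ k ∈ closure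
      (Submodule.span ℂ {y : L2 μ B E | ∃ f e, y = L2.of μ (rep φ f e)} : Set (L2 μ B E)) := by
  rw [Metric.mem_closure_iff]
  intro ε hε
  -- All approximants are supported in the compact set `L`, so uniform closeness gives `L²`-closeness.
  obtain ⟨L, hL, hKL⟩ := exists_compact_superset k.hasCompactSupport.isCompact
  obtain ⟨δ, hδ, hδε⟩ : ∃ δ : ℝ, 0 < δ ∧ δ ^ 2 * μ.real L < ε ^ 2 := by
    have h1 : Tendsto (fun δ : ℝ => δ ^ 2 * μ.real L) (𝓝[>] 0) (𝓝 0) := by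
      have : Continuous fun δ : ℝ => δ ^ 2 * μ.real L := by fun_prop
      simpa using (this.tendsto 0).mono_left nhdsWithin_le_nhds
    obtain ⟨δ, h2, h3⟩ := ((h1.eventually_lt_const (show 0 < ε ^ 2 by positivity)).and
      self_mem_nhdsWithin).exists
    exact ⟨δ, h3, h2⟩
  let s : G → Set G := fun x => interior L ∩ {g | ‖k g - k x‖ < δ}
  have hs : ∀ x, IsOpen (s x) := fun x =>
    isOpen_interior.inter (isOpen_lt (k.continuous.sub continuous_const).norm continuous_const)
  obtain ⟨t, ht⟩ := k.hasCompactSupport.isCompact.elim_finite_subcover s hs fun x hx =>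
    Set.mem_iUnion.2 ⟨x, hKL hx, by simpa using hδ⟩
  obtain ⟨χ, hχs, hχc⟩ := PartitionOfUnity.exists_isSubordinate_of_locallyFinite_t2space
    k.hasCompactSupport.isCompact (fun i : t => s i.1) (fun i => hs i.1) (locallyFinite_of_finite _)
    (fun x hx => by
      obtain ⟨i, hi, hxi⟩ := Set.mem_iUnion₂.1 (ht hx)
      exact Set.mem_iUnion.2 ⟨⟨i, hi⟩, hxi⟩)
  choose a e hae using fun x => hφ (k x)
  let f : t → CcSpace μ A A := fun i => mk' μ A (fun g => (χ i g : ℂ) • a i.1)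
    ((Complex.continuous_ofReal.comp (χ i).continuous).smul continuous_const)
    ((hχc i).mono fun g hg => by
      contrapose! hg
      rw [Function.notMem_support] at hg ⊢
      rw [hg, Complex.ofReal_zero, zero_smul])
  let h : CcSpace μ B E := ∑ i, rep φ (f i) (e i.1)
  have hh : ∀ g, h g = ∑ i, χ i g • k i.1 := by
    intro g
    rw [sum_apply]
    refine Finset.sum_congr rfl fun i _ => ?_
    rw [rep_apply, mk'_apply, map_smul, _root_.smul_apply, hae, Complex.coe_smul]
  have hχ0 : ∀ i g, g ∉ s i.1 → χ i g = 0 := fun i g hg =>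
    image_eq_zero_of_notMem_tsupport fun hg' => hg (hχs i hg')
  have hsum : ∀ g, k g = ∑ i, χ i g • k g := by
    intro g
    rw [← Finset.sum_smul]
    by_cases hg : g ∈ tsupport k
    · rw [← finsum_eq_sum_of_fintype, χ.sum_eq_one hg, one_smul]
    · rw [image_eq_zero_of_notMem_tsupport hg, smul_zero]
  have hsub : ∀ g, (k - h) g = ∑ i, χ i g • (k g - k i.1) := by
    intro g
    rw [sub_apply, hh, hsum g, ← Finset.sum_sub_distrib, ← hsum g]
    simp only [smul_sub]
  refine ⟨L2.of μ h, ?_, ?_⟩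
  · have : L2.of μ h = ∑ i, L2.of μ (rep φ (f i) (e i.1)) :=
      map_sum (HilbertCompletion.of B (CcSpace μ B E)) _ _
    rw [this]
    exact sum_mem fun i _ => Submodule.subset_span ⟨_, _, rfl⟩
  · have h1 : dist (L2.of μ k) (L2.of μ h) = ‖L2.of μ (k - h)‖ := by
      rw [dist_eq_norm]
      exact congrArg norm (map_sub (HilbertCompletion.of B (CcSpace μ B E)) k h).symm
    rw [h1]
    refine lt_of_pow_lt_pow_left₀ 2 hε.le (lt_of_le_of_lt ?_ hδε)
    refine norm_of_sq_le_of_norm_le hL hL.isClosed.measurableSet (fun g hg => ?_) fun g => ?_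
    · rw [hsub]
      refine Finset.sum_eq_zero fun i _ => ?_
      rw [hχ0 i g fun hg' => hg (interior_subset hg'.1), zero_smul]
    · rw [hsub]
      calc ‖∑ i, χ i g • (k g - k i.1)‖ ≤ ∑ i, χ i g * δ := by
            refine norm_sum_le_of_le _ fun i _ => ?_
            by_cases hg : g ∈ s i.1
            · rw [norm_smul, Real.norm_of_nonneg (χ.nonneg i g)]
              exact mul_le_mul_of_nonneg_left hg.2.le (χ.nonneg i g)
            · rw [hχ0 i g hg, zero_smul, zero_mul, norm_zero]
        _ ≤ 1 * δ := by
            rw [← Finset.sum_mul, ← finsum_eq_sum_of_fintype]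
            gcongr
            exact χ.sum_le_one g
        _ = δ := one_mul δ

end CcSpace

/-- The bounded operator `L²(G, A) → L²(G, E)` with `f ↦ (g ↦ φ(f(g)) e)` for `f ∈ C_c(G, A)`. -/
noncomputable def L2.rep (μ : Measure G) [μ.IsHaarMeasure] (φ : StarRep A B E) (e : E) :
    L2 μ A A →L[ℂ] L2 μ B E :=
  HilbertCompletion.extend
    { toFun := fun f => L2.of μ (CcSpace.rep φ f e)
      map_add' := fun f f' => by
        rw [L2.of, L2.of, L2.of, ← map_add]
        congr 1
        ext g
        simp [CcSpace.rep_apply]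
      map_smul' := fun c f => by
        rw [RingHom.id_apply, L2.of, L2.of, ← map_smul]
        congr 1
        ext g
        simp [CcSpace.rep_apply] }
    (√‖φ.toCLM‖ * ‖e‖) fun f => by
      refine abs_le_of_sq_le_sq' ?_ (by positivity) |>.2
      change ‖L2.of μ (CcSpace.rep φ f e)‖ ^ 2 ≤ _
      rw [L2.of, HilbertCompletion.norm_of_sq, CcSpace.ip_rep, mul_pow, mul_pow,
        Real.sq_sqrt (norm_nonneg φ.toCLM), HilbertCompletion.norm_of_sq]
      calc ‖⟪e, φ ⟪f, f⟫_A e⟫_B‖ ≤ ‖e‖ * (‖φ.toCLM‖ * ‖⟪f, f⟫_A‖ * ‖e‖) := by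
            refine (HilbertModule.norm_ip_le _ _).trans ?_
            gcongr
            refine ((φ ⟪f, f⟫_A).le_opNorm e).trans ?_
            gcongr
            exact φ.toCLM.le_opNorm _
        _ = _ := by ring

lemma L2.rep_of (φ : StarRep A B E) (e : E) (f : CcSpace μ A A) :
    L2.rep μ φ e (L2.of μ f) = L2.of μ (CcSpace.rep φ f e) :=
  HilbertCompletion.extend_of _ _ _ f

lemma L2.induction {p : L2 μ B E → Prop} (x : L2 μ B E) (hp : IsClosed {x | p x})
    (ih : ∀ f, p (L2.of μ f)) : p x :=
  HilbertCompletion.denseRange_of.induction_on x hp ih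

lemma L2.ip_rep (φ : StarRep A B E) (e e' : E) (x x' : L2 μ A A) :
    ⟪L2.rep μ φ e x, L2.rep μ φ e' x'⟫_B = ⟪e, φ ⟪x, x'⟫_A e'⟫_B := by
  induction x using L2.induction with
  | hp =>
    exact isClosed_eq ((L2.rep μ φ e).continuous.ip continuous_const)
      (continuous_const.ip ((φ.continuous_apply e').comp (continuous_id.ip continuous_const)))
  | ih f =>
    induction x' using L2.induction with
    | hp =>
      exact isClosed_eq (continuous_const.ip (L2.rep μ φ e').continuous)
        (continuous_const.ip ((φ.continuous_apply e').comp (continuous_const.ip continuous_id)))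
    | ih f' =>
      rw [L2.rep_of, L2.rep_of, L2.of, L2.of, L2.of, L2.of, HilbertCompletion.ip_of,
        HilbertCompletion.ip_of, CcSpace.ip_rep]

variable (μ) in
/-- The map `x ⊗ e ↦ L2.rep μ φ e x` on the algebraic tensor product. -/
noncomputable def algRepMap (φ : StarRep A B E) : AlgTensor (L2 μ A A) φ →ₗ[ℂ] L2 μ B E :=
  TensorProduct.lift (LinearMap.mk₂ ℂ (fun (x : L2 μ A A) (e : E) => L2.rep μ φ e x)
    (fun x y e => map_add _ x y) (fun c x e => map_smul _ c x)
    (fun x e e' => by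
      induction x using L2.induction with
      | hp =>
        exact isClosed_eq (L2.rep μ φ (e + e')).continuous
          ((L2.rep μ φ e).continuous.add (L2.rep μ φ e').continuous)
      | ih f =>
        rw [L2.rep_of, L2.rep_of, L2.rep_of, L2.of, L2.of, L2.of, ← map_add]
        congr 1
        ext g
        exact map_add (φ (f g)) e e')
    (fun c x e => by
      induction x using L2.induction with
      | hp =>
        exact isClosed_eq (L2.rep μ φ (c • e)).continuous
          ((L2.rep μ φ e).continuous.const_smul c)
      | ih f =>
        rw [L2.rep_of, L2.rep_of, L2.of, L2.of, ← map_smul]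
        congr 1
        ext g
        exact map_smul (φ (f g)) c e))

lemma algRepMap_tmul (φ : StarRep A B E) (x : L2 μ A A) (e : E) :
    algRepMap μ φ (AlgTensor.tmul φ x e) = L2.rep μ φ e x := rfl

lemma ip_algRepMap (φ : StarRep A B E) (s t : AlgTensor (L2 μ A A) φ) :
    ⟪algRepMap μ φ s, algRepMap μ φ t⟫_B = ⟪s, t⟫_B := by
  induction t using AlgTensor.induction with
  | h0 => rw [map_zero, ip_zero_right, ip_zero_right]
  | h2 t u ht hu => rw [map_add, ip_add_right, ip_add_right, ht, hu]
  | h1 x y =>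
    induction s using AlgTensor.induction with
    | h0 => rw [map_zero, ip_zero_left, ip_zero_left]
    | h2 s u hs hu => rw [map_add, ip_add_left, ip_add_left, hs, hu]
    | h1 x' y' => rw [algRepMap_tmul, algRepMap_tmul, L2.ip_rep, AlgTensor.ip_tmul]

lemma norm_algRepMap (φ : StarRep A B E) (t : AlgTensor (L2 μ A A) φ) :
    ‖algRepMap μ φ t‖ = ‖HilbertCompletion.of B (AlgTensor (L2 μ A A) φ) t‖ := by
  refine (sq_eq_sq₀ (norm_nonneg _) (norm_nonneg _)).1 ?_
  rw [HilbertModule.norm_sq_eq (B := B), ip_algRepMap, HilbertCompletion.norm_of_sq]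

variable (μ) in
/-- The isometry `L²(G, A) ⊗_φ E → L²(G, E)`. -/
noncomputable def repIsometry (φ : StarRep A B E) : InteriorTensor (L2 μ A A) φ →ₗᵢ[ℂ] L2 μ B E where
  toLinearMap := HilbertCompletion.extend (algRepMap μ φ) 1 fun t => by
    rw [one_mul, norm_algRepMap]
  norm_map' x := by
    set V := HilbertCompletion.extend (algRepMap μ φ) 1 fun t => by rw [one_mul, norm_algRepMap]
    change ‖V x‖ = ‖x‖
    induction x using HilbertCompletion.denseRange_of.induction_on with
    | hp => exact isClosed_eq V.continuous.norm continuous_norm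
    | ih t => rw [HilbertCompletion.extend_of, norm_algRepMap]

lemma repIsometry_of (φ : StarRep A B E) (t : AlgTensor (L2 μ A A) φ) :
    repIsometry μ φ (InteriorTensor.of φ t) = algRepMap μ φ t :=
  HilbertCompletion.extend_of _ _ _ t

lemma ip_repIsometry (φ : StarRep A B E) (x y : InteriorTensor (L2 μ A A) φ) :
    ⟪repIsometry μ φ x, repIsometry μ φ y⟫_B = ⟪x, y⟫_B := by
  induction x using HilbertCompletion.denseRange_of.induction_on with
  | hp =>
    exact isClosed_eq ((repIsometry μ φ).continuous.ip continuous_const)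
      (continuous_id.ip continuous_const)
  | ih s =>
    induction y using HilbertCompletion.denseRange_of.induction_on with
    | hp =>
      exact isClosed_eq (continuous_const.ip (repIsometry μ φ).continuous)
        (continuous_const.ip continuous_id)
    | ih t =>
      exact (congrArg₂ (inner B) (repIsometry_of φ s) (repIsometry_of φ t)).trans
        ((ip_algRepMap φ s t).trans (InteriorTensor.ip_of φ s t).symm)

lemma repIsometry_surjective [T2Space G] {φ : StarRep A B E} (hφ : φ.IsEssential) :
    Function.Surjective (repIsometry μ φ) := by
  have hcl : IsClosed (Set.range (repIsometry μ φ)) :=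
    (repIsometry μ φ).isometry.isClosedEmbedding.isClosed_range
  have hspan : Submodule.span ℂ {y : L2 μ B E | ∃ f e, y = L2.of μ (CcSpace.rep φ f e)} ≤
      LinearMap.range (repIsometry μ φ).toLinearMap := by
    refine Submodule.span_le.2 ?_
    rintro _ ⟨f, e, rfl⟩
    refine ⟨InteriorTensor.tmul φ (L2.of μ f) e, ?_⟩
    exact (repIsometry_of φ _).trans (L2.rep_of φ e f)
  intro y
  change y ∈ Set.range (repIsometry μ φ)
  induction y using L2.induction with
  | hp => exact hcl
  | ih k => exact closure_minimal hspan hcl (CcSpace.mem_closure_span_rep hφ k)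

variable (μ) in
/-- The unitary `L²(G, A) ⊗_φ E ≅ L²(G, E)` with `f ⊗ e ↦ (g ↦ φ(f(g)) e)`. -/
noncomputable def repUnitary [T2Space G] {φ : StarRep A B E} (hφ : φ.IsEssential) :
    InteriorTensor (L2 μ A A) φ ≃ₗᵢ[ℂ] L2 μ B E :=
  LinearIsometryEquiv.ofSurjective (repIsometry μ φ) (repIsometry_surjective hφ)

variable [T2Space G] {φ : StarRep A B E} (hφ : φ.IsEssential)

lemma ip_repUnitary (x y : InteriorTensor (L2 μ A A) φ) :
    ⟪repUnitary μ hφ x, repUnitary μ hφ y⟫_B = ⟪x, y⟫_B :=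
  ip_repIsometry φ x y

lemma repUnitary_tmul (x : L2 μ A A) (e : E) :
    repUnitary μ hφ (InteriorTensor.tmul φ x e) = L2.rep μ φ e x :=
  repIsometry_of φ _

lemma repUnitary_tmul_of (f : CcSpace μ A A) (e : E) :
    repUnitary μ hφ (InteriorTensor.tmul φ (L2.of μ f) e) = L2.of μ (CcSpace.rep φ f e) :=
  (repUnitary_tmul hφ _ e).trans (L2.rep_of φ e f)

lemma repUnitary_op_smul (x : InteriorTensor (L2 μ A A) φ) (b : B) :
    repUnitary μ hφ (x <• b) = repUnitary μ hφ x <• b :=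
  HilbertModule.ext_ip (B := B) fun z => by
    obtain ⟨w, rfl⟩ := (repUnitary μ hφ).surjective z
    rw [ip_op_smul_right, ip_repUnitary, ip_repUnitary, ip_op_smul_right]

lemma repUnitary_equivariant {α : CStarAction (G₂ G) A} {β : CStarAction (G₂ G) B}
    {γ : HilbertAction β E} (hγ : φ.IsEquivariant α γ) (h : G₂ G)
    (x : InteriorTensor (L2 μ A A) φ) :
    repUnitary μ hφ ((α.onSelf.L2 μ).tensor γ hγ h x) = γ.L2 μ h (repUnitary μ hφ x) := by
  induction x using HilbertCompletion.denseRange_of.induction_on with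
  | hp =>
    exact isClosed_eq ((repUnitary μ hφ).continuous.comp (ContinuousLinearMap.continuous _))
      ((γ.L2 μ h).continuous.comp (repUnitary μ hφ).continuous)
  | ih t =>
    change repUnitary μ hφ ((α.onSelf.L2 μ).tensor γ hγ h (InteriorTensor.of φ t)) =
      γ.L2 μ h (repUnitary μ hφ (InteriorTensor.of φ t))
    induction t using AlgTensor.induction with
    | h0 => simp only [map_zero]
    | h2 s t hs ht => simp only [map_add, hs, ht]
    | h1 x e =>
      change repUnitary μ hφ ((α.onSelf.L2 μ).tensor γ hγ h (InteriorTensor.tmul φ x e)) =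
        γ.L2 μ h (repUnitary μ hφ (InteriorTensor.tmul φ x e))
      rw [HilbertAction.tensor_tmul, repUnitary_tmul, repUnitary_tmul]
      induction x using L2.induction with
      | hp =>
        exact isClosed_eq
          ((L2.rep μ φ (γ h e)).continuous.comp (ContinuousLinearMap.continuous _))
          ((γ.L2 μ h).continuous.comp (L2.rep μ φ e).continuous)
      | ih f =>
        rw [HilbertAction.L2_of, L2.rep_of, L2.rep_of, HilbertAction.L2_of]
        congr 1
        ext g
        exact (hγ h (f (h.1⁻¹ * g)) e).symm

end unitary

/-! ### Pointwise operators on `L²(G, E)` -/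

section pointwise

variable {G B E : Type*} [Group G] [TopologicalSpace G] [IsTopologicalGroup G]
  [LocallyCompactSpace G] [MeasurableSpace G] [BorelSpace G]
  [NonUnitalCStarAlgebra B] [PartialOrder B] [StarOrderedRing B]
  [NormedAddCommGroup E] [NormedSpace ℂ E] [CompleteSpace E] [SMul Bᵐᵒᵖ E] [HilbertModule B E]
  {μ : Measure G} [μ.IsHaarMeasure] {β : CStarAction (G₂ G) B} (γ : HilbertAction β E)

lemma continuous_inclG : Continuous (inclG : G → G₂ G) := continuous_id.prodMk continuous_const

lemma HilbertAction.continuous_conj_apply (T : E →L[ℂ] E) {f : G → E} (hf : Continuous f) :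
    Continuous fun g => γ.conj (inclG g) T (f g) := by
  have h1 : Continuous fun g => γ (inclG g)⁻¹ (f g) :=
    γ.continuous_uncurry.comp (continuous_inclG.inv.prodMk hf)
  exact γ.continuous_uncurry.comp (continuous_inclG.prodMk (T.continuous.comp h1))

/-- The operator `f ↦ (g ↦ γ_g(T) f(g))` on `C_c(G, E)`. -/
noncomputable def CcSpace.pointwise (T : E →L[ℂ] E) : CcSpace μ B E →ₗ[ℂ] CcSpace μ B E where
  toFun f := mk' μ B (fun g => γ.conj (inclG g) T (f g)) (γ.continuous_conj_apply T f.continuous)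
    (f.hasCompactSupport.mono fun g hg => by
      contrapose! hg
      rw [Function.notMem_support] at hg ⊢
      rw [hg, map_zero])
  map_add' f f' := by ext g; exact map_add (γ.conj (inclG g) T) _ _
  map_smul' c f := by ext g; exact map_smul (γ.conj (inclG g) T) _ _

lemma CcSpace.pointwise_apply (T : E →L[ℂ] E) (f : CcSpace μ B E) (g : G) :
    pointwise γ T f g = γ.conj (inclG g) T (f g) := rfl

/-- The inequality holds in `B`, before taking norms, so it can be integrated: this needs the
operator inequality `⟪T x, T x⟫ ≤ ⟪x, x⟫` at each point of `G`. -/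
lemma CcSpace.ip_pointwise_le {T : E →L[ℂ] E} (hT : IsAdjointPair B T T) (h1 : ‖T‖ ≤ 1)
    (f : CcSpace μ B E) : ⟪pointwise γ T f, pointwise γ T f⟫_B ≤ ⟪f, f⟫_B := by
  rw [← sub_nonneg, ip_def, ip_def, ← integral_sub (ip_integrable _ _) (ip_integrable _ _)]
  refine integral_nonneg fun g => sub_nonneg.2 ?_
  exact (γ.isAdjointPair_conj (inclG g) hT).ip_apply_self_le ((γ.norm_conj_le _ T).trans h1) (f g)

lemma CcSpace.norm_of_pointwise_le {T : E →L[ℂ] E} (hT : IsAdjointPair B T T) (h1 : ‖T‖ ≤ 1)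
    (f : CcSpace μ B E) : ‖L2.of μ (pointwise γ T f)‖ ≤ ‖L2.of μ f‖ := by
  refine (sq_le_sq₀ (norm_nonneg _) (norm_nonneg _)).1 ?_
  rw [L2.of, L2.of, HilbertCompletion.norm_of_sq, HilbertCompletion.norm_of_sq]
  exact CStarAlgebra.norm_le_norm_of_nonneg_of_le (ip_self_nonneg _) (ip_pointwise_le γ hT h1 f)

variable (μ) in
/-- The operator on `L²(G, E)` with `f ↦ (g ↦ γ_g(T) f(g))` for `f ∈ C_c(G, E)`, where `T` is a
self-adjoint contraction. -/
noncomputable def L2.pointwise {T : E →L[ℂ] E} (hT : IsAdjointPair B T T) (h1 : ‖T‖ ≤ 1) :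
    L2 μ B E →L[ℂ] L2 μ B E :=
  HilbertCompletion.extend
    ((HilbertCompletion.of B (CcSpace μ B E)).comp (CcSpace.pointwise γ T)) 1 fun f => by
      rw [one_mul]
      exact CcSpace.norm_of_pointwise_le γ hT h1 f

variable {T : E →L[ℂ] E} (hT : IsAdjointPair B T T) (h1 : ‖T‖ ≤ 1)

lemma L2.pointwise_of (f : CcSpace μ B E) :
    L2.pointwise μ γ hT h1 (L2.of μ f) = L2.of μ (CcSpace.pointwise γ T f) :=
  HilbertCompletion.extend_of _ _ _ f

lemma L2.norm_pointwise_apply_le (x : L2 μ B E) : ‖L2.pointwise μ γ hT h1 x‖ ≤ ‖x‖ := by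
  induction x using L2.induction with
  | hp => exact isClosed_le (L2.pointwise μ γ hT h1).continuous.norm continuous_norm
  | ih f =>
    rw [L2.pointwise_of]
    exact CcSpace.norm_of_pointwise_le γ hT h1 f

lemma L2.isAdjointPair_pointwise :
    IsAdjointPair B (L2.pointwise μ γ hT h1) (L2.pointwise μ γ hT h1) := by
  intro x y
  induction x using L2.induction with
  | hp =>
    exact isClosed_eq ((L2.pointwise μ γ hT h1).continuous.ip continuous_const)
      (continuous_id.ip continuous_const)
  | ih f =>
    induction y using L2.induction with
    | hp =>
      exact isClosed_eq (continuous_const.ip continuous_id)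
        (continuous_const.ip (L2.pointwise μ γ hT h1).continuous)
    | ih f' =>
      rw [L2.pointwise_of, L2.pointwise_of, L2.of, L2.of, L2.of, L2.of, HilbertCompletion.ip_of,
        HilbertCompletion.ip_of, CcSpace.ip_def, CcSpace.ip_def]
      exact integral_congr_ae (Eventually.of_forall fun g =>
        γ.isAdjointPair_conj (inclG g) hT (f g) (f' g))

lemma L2.pointwise_equivariant (h : G) (x : L2 μ B E) :
    L2.pointwise μ γ hT h1 (γ.L2 μ (inclG h) x) =
      γ.L2 μ (inclG h) (L2.pointwise μ γ hT h1 x) := by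
  induction x using L2.induction with
  | hp =>
    exact isClosed_eq ((L2.pointwise μ γ hT h1).continuous.comp (γ.L2 μ (inclG h)).continuous)
      ((γ.L2 μ (inclG h)).continuous.comp (L2.pointwise μ γ hT h1).continuous)
  | ih f =>
    rw [HilbertAction.L2_of, L2.pointwise_of, L2.pointwise_of, HilbertAction.L2_of]
    congr 1
    ext g
    have e1 : (inclG g : G₂ G) = inclG h * inclG (h⁻¹ * g) := by
      refine Prod.ext ?_ (mul_one 1).symm
      exact (mul_inv_cancel_left h g).symm
    change γ.conj (inclG g) T (γ (inclG h) (f (h⁻¹ * g))) =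
      γ (inclG h) (γ.conj (inclG (h⁻¹ * g)) T (f (h⁻¹ * g)))
    rw [γ.conj_apply, γ.conj_apply, e1, mul_inv_rev, γ.mul_apply, γ.mul_apply, γ.inv_apply_apply]

lemma L2.isOdd_pointwise (hodd : IsOdd (γ (gradingElt G)) T) :
    IsOdd (γ.L2 μ (gradingElt G)) (L2.pointwise μ γ hT h1) := by
  refine ContinuousLinearMap.ext fun x => ?_
  change γ.L2 μ (gradingElt G) (L2.pointwise μ γ hT h1 (γ.L2 μ (gradingElt G) x)) =
    -L2.pointwise μ γ hT h1 x
  induction x using L2.induction with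
  | hp =>
    exact isClosed_eq ((γ.L2 μ (gradingElt G)).continuous.comp
      ((L2.pointwise μ γ hT h1).continuous.comp (γ.L2 μ (gradingElt G)).continuous))
      (L2.pointwise μ γ hT h1).continuous.neg
  | ih f =>
    rw [HilbertAction.L2_of, L2.pointwise_of, L2.pointwise_of, HilbertAction.L2_of, L2.of, L2.of,
      ← map_neg]
    congr 1
    ext g
    have e1 : ∀ g' : G, (gradingElt G).1⁻¹ * g' = g' := fun g' => by
      change (1 : G)⁻¹ * g' = g'
      rw [inv_one, one_mul]
    have e2 : (-CcSpace.pointwise γ T f) g = -(γ.conj (inclG g) T (f g)) := rfl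
    rw [e2, CcSpace.translate_apply, CcSpace.pointwise_apply, CcSpace.translate_apply, e1, e1,
      γ.conj_apply, γ.conj_apply, ← γ.mul_apply, ← γ.mul_apply, gradingElt_mul_comm,
      ← gradingElt_mul_comm (inclG g)⁻¹, γ.mul_apply, γ.mul_apply, ← map_neg]
    congr 1
    exact DFunLike.congr_fun hodd (γ (inclG g)⁻¹ (f g))

end pointwise

/-! ### A compactness criterion -/

section criterion

lemma lowerSemicontinuous_opNorm {X E F : Type*} [TopologicalSpace X] [NormedAddCommGroup E]
    [NormedSpace ℂ E] [NormedAddCommGroup F] [NormedSpace ℂ F] {κ : X → E →L[ℂ] F}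
    (hκ : ∀ e, Continuous fun x => κ x e) : LowerSemicontinuous fun x => ‖κ x‖ := by
  intro x c hc
  obtain ⟨e, he, hce⟩ := (κ x).exists_lt_apply_of_lt_opNorm hc
  filter_upwards [(hκ e).norm.continuousAt.eventually_const_lt hce] with y hy
  exact hy.trans_le (((κ y).le_opNorm e).trans (mul_le_of_le_one_right (norm_nonneg _) he.le))

variable {G B E F : Type*} [TopologicalSpace G] [MeasurableSpace G] [BorelSpace G] [T2Space G]
  {μ : Measure G} [IsFiniteMeasureOnCompacts μ]
  [NonUnitalCStarAlgebra B] [PartialOrder B] [StarOrderedRing B]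
  [NormedAddCommGroup E] [NormedSpace ℂ E] [CompleteSpace E] [SMul Bᵐᵒᵖ E] [HilbertModule B E]
  [NormedAddCommGroup F] [NormedSpace ℂ F] [CompleteSpace F] [SMul Bᵐᵒᵖ F] [HilbertModule B F]

/-- Let `κ` be a strongly continuous, compactly supported family of compact operators.  If `T` is
dominated by `κ` in mean square, then `T` is compact.  Norm continuity of `κ` is not needed: with an
approximate unit `1 - r n` of `𝕂(E)`, the norms `‖κ g * r n‖` tend to zero for each `g`, and they are
measurable in `g` as lower semicontinuous functions, so `‖T * r n‖` tends to zero by dominated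
convergence, and `T` is the limit of the compact operators `T * (1 - r n)`. -/
lemma mem_compactOperators_of_norm_sq_le_integral (hE : IsCountablyGenerated B E) {T : E →L[ℂ] F}
    (hT : ∀ x (b : B), T (x <• b) = T x <• b) {κ : G → E →L[ℂ] E}
    (hκ : ∀ g, κ g ∈ compactOperators B E E) (hκc : ∀ e, Continuous fun g => κ g e) {K : Set G}
    (hK : IsCompact K) (hκK : ∀ g ∉ K, κ g = 0) (hTκ : ∀ e, ‖T e‖ ^ 2 ≤ ∫ g, ‖κ g e‖ ^ 2 ∂μ) :
    T ∈ compactOperators B E F := by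
  obtain ⟨r, hr, hr1, hlim⟩ := hE.exists_approximateUnit
  obtain ⟨C, hC⟩ := banach_steinhaus (g := κ) fun e =>
    (hκc e).bounded_above_of_compact_support (HasCompactSupport.intro hK fun g hg => by
      rw [hκK g hg]; rfl)
  have hmeas : ∀ n, AEStronglyMeasurable (fun g => ‖κ g * r n‖ ^ 2) μ := fun n =>
    ((lowerSemicontinuous_opNorm fun e => hκc (r n e)).measurable.pow_const 2).aestronglyMeasurable
  have hbound : ∀ n g, ‖‖κ g * r n‖ ^ 2‖ ≤ K.indicator (fun _ => C ^ 2) g := by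
    intro n g
    rw [Real.norm_of_nonneg (by positivity)]
    by_cases hg : g ∈ K
    · rw [Set.indicator_of_mem hg]
      have h1 : ‖κ g * r n‖ ≤ C :=
        (norm_mul_le _ _).trans ((mul_le_of_le_one_right (norm_nonneg _) (hr1 n)).trans (hC g))
      gcongr
    · rw [Set.indicator_of_notMem hg, hκK g hg, zero_mul, norm_zero, zero_pow two_ne_zero]
  have hint : Integrable (K.indicator fun _ => C ^ 2) μ :=
    (integrable_indicator_iff hK.isClosed.measurableSet).2
      (integrableOn_const hK.measure_lt_top.ne)
  have hint' : ∀ n, Integrable (fun g => ‖κ g * r n‖ ^ 2) μ := fun n =>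
    hint.mono' (hmeas n) (Eventually.of_forall (hbound n))
  have htend : Tendsto (fun n => ∫ g, ‖κ g * r n‖ ^ 2 ∂μ) atTop (𝓝 0) := by
    have h1 := tendsto_integral_of_dominated_convergence (μ := μ) (f := fun _ => (0 : ℝ)) _ hmeas
      hint (fun n => Eventually.of_forall (hbound n)) (Eventually.of_forall fun g => by
        simpa using (hlim (κ g) (hκ g)).norm.pow 2)
    simpa using h1
  have hTr : ∀ n, ‖T.comp (r n)‖ ≤ √(∫ g, ‖κ g * r n‖ ^ 2 ∂μ) := by
    intro n
    refine ContinuousLinearMap.opNorm_le_bound _ (Real.sqrt_nonneg _) fun e => ?_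
    have h0 : 0 ≤ ∫ g, ‖κ g * r n‖ ^ 2 ∂μ := integral_nonneg fun g => by positivity
    refine abs_le_of_sq_le_sq' ?_ (by positivity) |>.2
    rw [mul_pow, Real.sq_sqrt h0, ← integral_mul_const]
    refine (hTκ (r n e)).trans (integral_mono_of_nonneg
      (Eventually.of_forall fun g => by positivity) ((hint' n).mul_const _)
      (Eventually.of_forall fun g => ?_))
    have h1 := (κ g * r n).le_opNorm e
    change ‖(κ g * r n) e‖ ^ 2 ≤ ‖κ g * r n‖ ^ 2 * ‖e‖ ^ 2
    rw [← mul_pow]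
    gcongr
  refine isClosed_compactOperators.mem_of_tendsto (f := fun n => T.comp (1 - r n)) (b := atTop) ?_
    (Eventually.of_forall fun n => comp_mem_compactOperators_of_left hT (hr n))
  rw [tendsto_iff_norm_sub_tendsto_zero]
  have h2 := htend.sqrt
  rw [Real.sqrt_zero] at h2
  refine squeeze_zero (fun n => norm_nonneg _) (fun n => ?_) h2
  have e : T.comp (1 - r n) - T = -T.comp (r n) := by
    ext x
    simp
  rw [e, norm_neg]
  exact hTr n

end criterion

/-! ### Creation operators -/

section creation

variable {A B E₁ E₂ : Type*} [NonUnitalCStarAlgebra A] [PartialOrder A] [StarOrderedRing A]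
  [NonUnitalCStarAlgebra B] [PartialOrder B] [StarOrderedRing B]
  [NormedAddCommGroup E₁] [NormedSpace ℂ E₁] [CompleteSpace E₁] [SMul Aᵐᵒᵖ E₁] [HilbertModule A E₁]
  [NormedAddCommGroup E₂] [NormedSpace ℂ E₂] [CompleteSpace E₂] [SMul Bᵐᵒᵖ E₂] [HilbertModule B E₂]
  (φ : StarRep A B E₂)

lemma norm_creation_le (ξ : E₁) : ‖creation φ ξ‖ ≤ √‖φ.toCLM‖ * ‖ξ‖ := by
  have h1 : ‖creation φ ξ‖ ≤ √‖φ ⟪ξ, ξ⟫_A‖ := LinearMap.mkContinuous_norm_le _ (Real.sqrt_nonneg _) _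
  refine h1.trans (Real.sqrt_le_iff.2 ⟨by positivity, ?_⟩)
  rw [mul_pow, Real.sq_sqrt (norm_nonneg φ.toCLM), HilbertModule.norm_sq_eq (B := A)]
  exact φ.toCLM.le_opNorm _

lemma continuous_creation : Continuous (creation φ : E₁ → E₂ →L[ℂ] InteriorTensor E₁ φ) := by
  let L : E₁ →ₗ[ℂ] (E₂ →L[ℂ] InteriorTensor E₁ φ) :=
    { toFun := creation φ
      map_add' := fun x y => ContinuousLinearMap.ext fun e =>
        (congrArg (InteriorTensor.of φ) (TensorProduct.add_tmul x y e)).trans (map_add _ _ _)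
      map_smul' := fun c x => ContinuousLinearMap.ext fun e =>
        (congrArg (InteriorTensor.of φ) (TensorProduct.smul_tmul' c x e).symm).trans
          (map_smul _ _ _) }
  exact (L.mkContinuous (√‖φ.toCLM‖) (norm_creation_le φ)).continuous

lemma creation_op_smul (ξ : E₁) (a : A) : creation φ (ξ <• a) = (creation φ ξ).comp (φ a) := by
  ext e
  rw [ContinuousLinearMap.comp_apply, creation_apply, creation_apply, ← sub_eq_zero, ← norm_eq_zero,
    ← sq_eq_zero_iff, HilbertModule.norm_sq_eq (B := B), ip_sub_left, ip_sub_right, ip_sub_right,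
    InteriorTensor.ip_tmul, InteriorTensor.ip_tmul, InteriorTensor.ip_tmul, InteriorTensor.ip_tmul]
  simp only [ip_op_smul_left, ip_op_smul_right, map_mul, mul_apply_eq_comp, φ.ip_left]
  simp

lemma tendsto_op_smul_approximateUnit {u : ℕ → A} (hu : ∀ n, 0 ≤ u n ∧ ‖u n‖ ≤ 1)
    (hu' : ∀ a, Tendsto (fun n => a * u n) atTop (𝓝 a)) (ξ : E₁) :
    Tendsto (fun n => ξ <• u n) atTop (𝓝 ξ) := by
  rw [tendsto_iff_norm_sub_tendsto_zero]
  have h1 : Tendsto (fun n => 2 * ‖⟪ξ, ξ⟫_A * u n - ⟪ξ, ξ⟫_A‖) atTop (𝓝 0) := by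
    simpa using (tendsto_iff_norm_sub_tendsto_zero.1 (hu' ⟪ξ, ξ⟫_A)).const_mul 2
  have h2 : Tendsto (fun n => ‖ξ <• u n - ξ‖ ^ 2) atTop (𝓝 0) := by
    refine squeeze_zero (fun n => by positivity) (fun n => ?_) h1
    set d := ⟪ξ, ξ⟫_A * u n - ⟪ξ, ξ⟫_A with hd
    have e : ⟪ξ <• u n - ξ, ξ <• u n - ξ⟫_A = u n * d - d := by
      rw [ip_sub_left, ip_sub_right, ip_sub_right, ip_op_smul_left, ip_op_smul_left,
        ip_op_smul_right, (hu n).1.isSelfAdjoint.star_eq, hd, mul_sub]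
    rw [HilbertModule.norm_sq_eq (B := A), e, two_mul]
    refine (norm_sub_le _ _).trans (add_le_add_left ?_ _)
    exact (norm_mul_le _ _).trans (mul_le_of_le_one_left (norm_nonneg _) (hu n).2)
  simpa using h2.sqrt

/-- Every vector of a Hilbert `A`-module is a limit of vectors `ξ <• a`, and `T_{ξ a} = T_ξ φ(a)`. -/
lemma creation_comp_mem_compactOperators (hA : IsSigmaUnital A) (ξ : E₁) {S : E₂ →L[ℂ] E₂}
    (hS : ∀ a, φ a * S ∈ compactOperators B E₂ E₂) :
    (creation φ ξ).comp S ∈ compactOperators B E₂ (InteriorTensor E₁ φ) := by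
  obtain ⟨u, hu, hu'⟩ := hA
  have h1 : Continuous fun ξ : E₁ => (creation φ ξ).comp S :=
    (continuous_creation φ).clm_comp continuous_const
  have h2 : Tendsto (fun n => (creation φ (ξ <• u n)).comp S) atTop (𝓝 ((creation φ ξ).comp S)) :=
    (h1.tendsto ξ).comp (tendsto_op_smul_approximateUnit hu (fun a => (hu' a).2) ξ)
  refine isClosed_compactOperators.mem_of_tendsto h2 (Eventually.of_forall fun n => ?_)
  have e : creation φ (ξ <• u n) = (creation φ ξ).comp (φ (u n)) := creation_op_smul φ ξ (u n)
  rw [e, ContinuousLinearMap.comp_assoc]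
  exact comp_mem_compactOperators_of_left (isAdjointPair_creation φ ξ).map_op_smul (hS (u n))

variable {φ} {G : Type*} [Group G] [TopologicalSpace G] [IsTopologicalGroup G]
  {α : CStarAction (G₂ G) A} {β : CStarAction (G₂ G) B}
  (γ₁ : HilbertAction α E₁) (γ₂ : HilbertAction β E₂) (hφ : φ.IsEquivariant α γ₂)

lemma grading_creation (ξ : E₁) (e : E₂) :
    γ₁.tensor γ₂ hφ (gradingElt G) (creation φ ξ (γ₂ (gradingElt G) e)) =
      creation φ (γ₁ (gradingElt G) ξ) e := by
  rw [creation_apply, HilbertAction.tensor_tmul, γ₂.grading_apply_apply, creation_apply]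

lemma grading_annihilation (ξ : E₁) (x : InteriorTensor E₁ φ) :
    γ₂ (gradingElt G) (annihilation φ ξ (γ₁.tensor γ₂ hφ (gradingElt G) x)) =
      annihilation φ (γ₁ (gradingElt G) ξ) x :=
  HilbertModule.ext_ip (B := B) fun e => by
    have h1 : ⟪e, γ₂ (gradingElt G) (annihilation φ ξ (γ₁.tensor γ₂ hφ (gradingElt G) x))⟫_B =
        β (gradingElt G) ⟪γ₂ (gradingElt G) e,
          annihilation φ ξ (γ₁.tensor γ₂ hφ (gradingElt G) x)⟫_B := by
      rw [← γ₂.ip_map, γ₂.grading_apply_apply]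
    rw [h1, ← isAdjointPair_creation φ ξ, ← (γ₁.tensor γ₂ hφ).ip_map, grading_creation,
      HilbertAction.grading_apply_apply, isAdjointPair_creation φ]

/-- For odd operators, `F₁₂` is an `F₂`-connection as soon as the operators `F₁₂ T_ξ - T_{τ ξ} F₂`
and `T_ξ F₂^* - F₁₂ T_{τ ξ}` are compact: they are the lower left entry of the graded commutator and
the adjoint of its upper right entry. -/
lemma isConnection_of_isOdd {F₂ Fs : E₂ →L[ℂ] E₂}
    {F₁₂ : InteriorTensor E₁ φ →L[ℂ] InteriorTensor E₁ φ} (hF₂ : IsOdd (γ₂ (gradingElt G)) F₂)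
    (hF₁₂ : IsOdd (γ₁.tensor γ₂ hφ (gradingElt G)) F₁₂) (hFs : IsAdjointPair B F₂ Fs)
    (hs : IsAdjointPair B F₁₂ F₁₂)
    (h1 : ∀ ξ, F₁₂.comp (creation φ ξ) - (creation φ (γ₁ (gradingElt G) ξ)).comp F₂ ∈
      compactOperators B E₂ (InteriorTensor E₁ φ))
    (h2 : ∀ ξ, (creation φ ξ).comp Fs - F₁₂.comp (creation φ (γ₁ (gradingElt G) ξ)) ∈
      compactOperators B E₂ (InteriorTensor E₁ φ)) :
    IsConnection φ (γ₂ (gradingElt G)) (γ₁.tensor γ₂ hφ (gradingElt G)) F₂ F₁₂ := by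
  intro ξ
  have hodd : IsOdd ((γ₂ (gradingElt G)).prodMap (γ₁.tensor γ₂ hφ (gradingElt G)))
      (F₂.prodMap F₁₂) :=
    ContinuousLinearMap.ext fun z =>
      Prod.ext (DFunLike.congr_fun hF₂ z.1) (DFunLike.congr_fun hF₁₂ z.2)
  rw [gradedCommutator_of_isOdd hodd]
  have h3 : IsAdjointPair B
      ((creation φ ξ).comp Fs - F₁₂.comp (creation φ (γ₁ (gradingElt G) ξ)))
      (F₂.comp (annihilation φ ξ) - (annihilation φ (γ₁ (gradingElt G) ξ)).comp F₁₂) :=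
    ((isAdjointPair_creation φ ξ).comp hFs.symm).sub (hs.comp (isAdjointPair_creation φ _))
  convert offDiagonal_mem_compactOperators (h3.mem_compactOperators (h2 ξ)) (h1 ξ) using 1
  refine ContinuousLinearMap.ext fun z => Prod.ext ?_ ?_
  · change F₂ (annihilation φ ξ z.2) - γ₂ (gradingElt G)
      (annihilation φ ξ (γ₁.tensor γ₂ hφ (gradingElt G) (F₁₂ z.2))) = _
    rw [grading_annihilation]
    rfl
  · change F₁₂ (creation φ ξ z.1) - γ₁.tensor γ₂ hφ (gradingElt G)
      (creation φ ξ (γ₂ (gradingElt G) (F₂ z.1))) = _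
    rw [grading_creation]
    rfl

end creation

/-! ### The equivariant connection -/

section connection

variable {G : Type*} [Group G] [TopologicalSpace G] [IsTopologicalGroup G] [T2Space G]
  [LocallyCompactSpace G] [MeasurableSpace G] [BorelSpace G]
  {μ : Measure G} [μ.IsHaarMeasure]
  {A : Type*} [NonUnitalCStarAlgebra A] [PartialOrder A] [StarOrderedRing A]
  {B : Type*} [NonUnitalCStarAlgebra B] [PartialOrder B] [StarOrderedRing B]
  {E : Type*} [NormedAddCommGroup E] [NormedSpace ℂ E] [CompleteSpace E] [SMul Bᵐᵒᵖ E]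
  [HilbertModule B E] {α : CStarAction (G₂ G) A} {β : CStarAction (G₂ G) B}
  {γ : HilbertAction β E} {φ : StarRep A B E} {F F₀ : E →L[ℂ] E}

/-- Compact perturbations of `F` are almost equivariant and almost commute with `φ(a)`, in the
combined form needed for connections. -/
lemma IsCompactPerturbation.conj_mul_sub_mem (hF : IsKasparovTriple α γ φ F)
    (hc : IsCompactPerturbation φ F F₀) (g : G) (a : A) :
    γ.conj (inclG g) F₀ * φ a - φ (α (gradingElt G) a) * F₀ ∈ compactOperators B E E := by
  have h1 : γ.conj (inclG g) (F₀ - F) * φ a ∈ compactOperators B E E := by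
    have h2 : φ a = γ.conj (inclG g) (φ (α (inclG g)⁻¹ a)) := by
      rw [HilbertAction.conj_rep hF.equivariant, ← StarAlgEquiv.mul_apply, ← map_mul,
        mul_inv_cancel, map_one, StarAlgEquiv.one_apply]
    rw [h2, ← γ.conj_mul]
    exact γ.conj_mem_compactOperators _ (hc _).1
  have h3 := hF.commutator a
  rw [gradedCommutator_rep hF.equivariant hF.odd] at h3
  have e : γ.conj (inclG g) F₀ * φ a - φ (α (gradingElt G) a) * F₀ =
      γ.conj (inclG g) (F₀ - F) * φ a + (γ.conj (inclG g) F - F) * φ a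
        + (F * φ a - φ (α (gradingElt G) a) * F) - φ (α (gradingElt G) a) * (F₀ - F) := by
    rw [γ.conj_sub]
    noncomm_ring
  rw [e]
  exact sub_mem (add_mem (add_mem h1 (hF.almostEquivariant g a)) h3) (hc _).2

variable (μ) in
/-- The operator on `L²(G, A) ⊗_φ E` that corresponds to `f ↦ (g ↦ γ_g(F₀) f(g))` on `L²(G, E)`. -/
noncomputable def pointwiseConnection (γ : HilbertAction β E) (hess : φ.IsEssential)
    (hs : IsAdjointPair B F₀ F₀) (h1 : ‖F₀‖ ≤ 1) :
    InteriorTensor (L2 μ A A) φ →L[ℂ] InteriorTensor (L2 μ A A) φ :=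
  ((repUnitary μ hess).symm.toContinuousLinearEquiv : L2 μ B E →L[ℂ] _).comp
    ((L2.pointwise μ γ hs h1).comp
      ((repUnitary μ hess).toContinuousLinearEquiv : _ →L[ℂ] L2 μ B E))

variable (hess : φ.IsEssential) (hs : IsAdjointPair B F₀ F₀) (h1 : ‖F₀‖ ≤ 1)

lemma repUnitary_pointwiseConnection (x : InteriorTensor (L2 μ A A) φ) :
    repUnitary μ hess (pointwiseConnection μ γ hess hs h1 x) =
      L2.pointwise μ γ hs h1 (repUnitary μ hess x) :=
  (repUnitary μ hess).apply_symm_apply _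

lemma isAdjointPair_pointwiseConnection : IsAdjointPair B (pointwiseConnection μ γ hess hs h1)
    (pointwiseConnection μ γ hess hs h1) := fun x y => by
  rw [← ip_repUnitary hess, ← ip_repUnitary hess, repUnitary_pointwiseConnection,
    repUnitary_pointwiseConnection, L2.isAdjointPair_pointwise]

lemma norm_pointwiseConnection_le : ‖pointwiseConnection μ γ hess hs h1‖ ≤ 1 := by
  refine ContinuousLinearMap.opNorm_le_bound _ zero_le_one fun x => ?_
  rw [← (repUnitary μ hess).norm_map, repUnitary_pointwiseConnection, one_mul,
    ← (repUnitary μ hess).norm_map x]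
  exact L2.norm_pointwise_apply_le γ hs h1 _

lemma pointwiseConnection_equivariant (hφ : φ.IsEquivariant α γ) (g : G)
    (x : InteriorTensor (L2 μ A A) φ) :
    pointwiseConnection μ γ hess hs h1 ((α.onSelf.L2 μ).tensor γ hφ (inclG g) x) =
      (α.onSelf.L2 μ).tensor γ hφ (inclG g) (pointwiseConnection μ γ hess hs h1 x) := by
  refine (repUnitary μ hess).injective ?_
  rw [repUnitary_pointwiseConnection, repUnitary_equivariant, repUnitary_equivariant,
    repUnitary_pointwiseConnection, L2.pointwise_equivariant]

lemma isOdd_pointwiseConnection (hφ : φ.IsEquivariant α γ) (hodd : IsOdd (γ (gradingElt G)) F₀) :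
    IsOdd ((α.onSelf.L2 μ).tensor γ hφ (gradingElt G)) (pointwiseConnection μ γ hess hs h1) := by
  refine ContinuousLinearMap.ext fun x => (repUnitary μ hess).injective ?_
  change repUnitary μ hess ((α.onSelf.L2 μ).tensor γ hφ (gradingElt G)
    (pointwiseConnection μ γ hess hs h1 ((α.onSelf.L2 μ).tensor γ hφ (gradingElt G) x))) =
    repUnitary μ hess (-pointwiseConnection μ γ hess hs h1 x)
  rw [map_neg, repUnitary_equivariant, repUnitary_pointwiseConnection, repUnitary_equivariant,
    repUnitary_pointwiseConnection]
  exact DFunLike.congr_fun (L2.isOdd_pointwise γ hs h1 hodd) (repUnitary μ hess x)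

/-- For `ξ = f ∈ C_c(G, A)` the operator `F' T_ξ - T_{τ ξ} F₀` is `e ↦ (g ↦ κ(g) e)` with
`κ(g) = γ_g(F₀) φ(f(g)) - φ(τ f(g)) F₀`, a strongly continuous and compactly supported family of
compact operators.  General `ξ` follow by density. -/
lemma pointwiseConnection_comp_creation_mem (hF : IsKasparovTriple α γ φ F)
    (hc : IsCompactPerturbation φ F F₀) (ξ : L2 μ A A) :
    (pointwiseConnection μ γ hess hs h1).comp (creation φ ξ) -
      (creation φ (α.onSelf.L2 μ (gradingElt G) ξ)).comp F₀ ∈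
        compactOperators B E (InteriorTensor (L2 μ A A) φ) := by
  induction ξ using L2.induction with
  | hp =>
    have hcont : Continuous fun ξ : L2 μ A A =>
        (pointwiseConnection μ γ hess hs h1).comp (creation φ ξ) -
          (creation φ (α.onSelf.L2 μ (gradingElt G) ξ)).comp F₀ :=
      (continuous_const.clm_comp (continuous_creation φ)).sub
        (((continuous_creation φ).comp (α.onSelf.L2 μ (gradingElt G)).continuous).clm_comp
          continuous_const)
    exact isClosed_compactOperators.preimage hcont
  | ih f =>
    have hτ : ∀ g, (gradingElt G).1⁻¹ * g = g := fun g => by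
      change (1 : G)⁻¹ * g = g
      rw [inv_one, one_mul]
    let κ : G → E →L[ℂ] E := fun g =>
      γ.conj (inclG g) F₀ * φ (f g) - φ (α (gradingElt G) (f g)) * F₀
    let k : E → CcSpace μ B E := fun e => CcSpace.pointwise γ F₀ (CcSpace.rep φ f e) -
      CcSpace.rep φ (CcSpace.translate α.onSelf (gradingElt G) f) (F₀ e)
    have hk : ∀ e g, k e g = κ g e := by
      intro e g
      rw [CcSpace.sub_apply, CcSpace.pointwise_apply, CcSpace.rep_apply, CcSpace.rep_apply,
        CcSpace.translate_apply, hτ]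
      rfl
    refine mem_compactOperators_of_norm_sq_le_integral (μ := μ) (κ := κ) (K := tsupport f)
      hF.countablyGenerated ?_ (fun g => hc.conj_mul_sub_mem hF g (f g)) (fun e => ?_)
      f.hasCompactSupport (fun g hg => ?_) fun e => ?_
    · exact (((isAdjointPair_pointwiseConnection hess hs h1).comp
        (isAdjointPair_creation φ _)).sub ((isAdjointPair_creation φ _).comp hs)).map_op_smul
    · exact (k e).continuous.congr (hk e)
    · simp only [κ, image_eq_zero_of_notMem_tsupport hg, map_zero, mul_zero, zero_mul, sub_zero]
    · have hU : repUnitary μ hess (((pointwiseConnection μ γ hess hs h1).comp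
          (creation φ (L2.of μ f)) -
            (creation φ (α.onSelf.L2 μ (gradingElt G) (L2.of μ f))).comp F₀) e) =
          L2.of μ (k e) := by
        rw [sub_apply, map_sub, ContinuousLinearMap.comp_apply, ContinuousLinearMap.comp_apply,
          repUnitary_pointwiseConnection, creation_apply, creation_apply, HilbertAction.L2_of,
          repUnitary_tmul_of, repUnitary_tmul_of, L2.pointwise_of]
        exact (map_sub (HilbertCompletion.of B (CcSpace μ B E)) _ _).symm
      rw [← (repUnitary μ hess).norm_map, hU]
      simpa only [hk] using CcSpace.norm_of_sq_le (k e)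

lemma isConnection_pointwiseConnection (hA : IsSigmaUnital A) (hF : IsKasparovTriple α γ φ F)
    (hodd : IsOdd (γ (gradingElt G)) F₀) (hc : IsCompactPerturbation φ F F₀) :
    IsConnection φ (γ (gradingElt G))
      ((α.onSelf.L2 μ).tensor γ hF.equivariant (gradingElt G)) F
      (pointwiseConnection μ γ hess hs h1) := by
  obtain ⟨Fs, hFs, -⟩ := hF.adjoint
  -- `φ(a) (F^* - F₀)` is the adjoint of `(F - F₀) φ(a^*)`.
  have hcs : ∀ a, φ a * (Fs - F₀) ∈ compactOperators B E E := by
    intro a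
    have h2 := (hFs.sub hs).mul (φ.adjoint (star a))
    rw [star_star] at h2
    refine h2.mem_compactOperators ?_
    rw [← neg_sub F₀ F, neg_mul]
    exact neg_mem (hc _).1
  refine isConnection_of_isOdd _ γ hF.equivariant hF.odd
    (isOdd_pointwiseConnection hess hs h1 hF.equivariant hodd) hFs
    (isAdjointPair_pointwiseConnection hess hs h1) (fun ξ => ?_) fun ξ => ?_
  · have h2 := add_mem (pointwiseConnection_comp_creation_mem hess hs h1 hF hc ξ)
      (creation_comp_mem_compactOperators φ hA (α.onSelf.L2 μ (gradingElt G) ξ) fun a => (hc a).2)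
    rwa [ContinuousLinearMap.comp_sub, sub_add_sub_cancel] at h2
  · have h2 := pointwiseConnection_comp_creation_mem (γ := γ) hess hs h1 hF hc
      (α.onSelf.L2 μ (gradingElt G) ξ)
    rw [HilbertAction.grading_apply_apply] at h2
    have h3 := sub_mem (creation_comp_mem_compactOperators φ hA ξ hcs) h2
    rw [ContinuousLinearMap.comp_sub] at h3
    convert h3 using 1
    abel

end connection

end EquivariantKK

theorem mainTheorem12
    {G : Type*} [Group G] [TopologicalSpace G] [IsTopologicalGroup G] [T2Space G]
    [LocallyCompactSpace G] [SigmaCompactSpace G] [MeasurableSpace G] [BorelSpace G]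
    (μ : Measure G) [μ.IsHaarMeasure]
    {A : Type*} [NonUnitalCStarAlgebra A] [PartialOrder A] [StarOrderedRing A]
    {B : Type*} [NonUnitalCStarAlgebra B] [PartialOrder B] [StarOrderedRing B]
    {E : Type*} [NormedAddCommGroup E] [NormedSpace ℂ E] [CompleteSpace E] [SMul Bᵐᵒᵖ E]
    [HilbertModule B E]
    (hA : IsSigmaUnital A) (hB : IsSigmaUnital B)
    (α : CStarAction (G₂ G) A) (β : CStarAction (G₂ G) B) (γ : HilbertAction β E)
    (φ : StarRep A B E) (F : E →L[ℂ] E)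
    (hF : IsKasparovTriple α γ φ F) (hess : φ.IsEssential) :
    -- the `G₂`-equivariant unitary `L²(G, A) ⊗_φ E ≅ L²(G, E)`
    ∃ U : InteriorTensor (L2 μ A A) φ ≃ₗᵢ[ℂ] L2 μ B E,
      (∀ x y, ⟪U x, U y⟫_B = ⟪x, y⟫_B) ∧
      (∀ x (b : B), U (x <• b) = U x <• b) ∧
      (∀ (h : G₂ G) x,
        U ((α.onSelf.L2 μ).tensor γ hF.equivariant h x) = γ.L2 μ h (U x)) ∧
      (∀ (f : CcSpace μ A A) (e : E), ∃ k : CcSpace μ B E,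
        (∀ g, k g = φ (f g) e) ∧ U (InteriorTensor.tmul φ (L2.of μ f) e) = L2.of μ k) ∧
      -- `F` has odd self-adjoint contractive compact perturbations `F₀`
      (∃ F₀ : E →L[ℂ] E, IsAdjointPair B F₀ F₀ ∧ ‖F₀‖ ≤ 1 ∧ IsOdd (γ (gradingElt G)) F₀ ∧
        IsCompactPerturbation φ F F₀) ∧
      -- and each of them gives an equivariant connection
      ∀ F₀ : E →L[ℂ] E, IsAdjointPair B F₀ F₀ → ‖F₀‖ ≤ 1 → IsOdd (γ (gradingElt G)) F₀ →
        IsCompactPerturbation φ F F₀ →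
        ∃ F' : InteriorTensor (L2 μ A A) φ →L[ℂ] InteriorTensor (L2 μ A A) φ,
          IsAdjointPair B F' F' ∧ ‖F'‖ ≤ 1 ∧
          IsOdd ((α.onSelf.L2 μ).tensor γ hF.equivariant (gradingElt G)) F' ∧
          (∀ (g : G) x, F' ((α.onSelf.L2 μ).tensor γ hF.equivariant (inclG g) x) =
            (α.onSelf.L2 μ).tensor γ hF.equivariant (inclG g) (F' x)) ∧
          IsConnection φ (γ (gradingElt G))
            ((α.onSelf.L2 μ).tensor γ hF.equivariant (gradingElt G)) F F' ∧
          ∀ f : CcSpace μ B E, ∃ k : CcSpace μ B E,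
            (∀ g, k g = γ.conj (inclG g) F₀ (f g)) ∧ U (F' (U.symm (L2.of μ f))) = L2.of μ k := by
  refine ⟨repUnitary μ hess, ip_repUnitary hess, repUnitary_op_smul hess,
    repUnitary_equivariant hess hF.equivariant,
    fun f e => ⟨CcSpace.rep φ f e, fun g => rfl, repUnitary_tmul_of hess f e⟩,
    hF.exists_selfAdjoint_contraction, fun F₀ hs h1 hodd hc => ?_⟩
  refine ⟨pointwiseConnection μ γ hess hs h1, isAdjointPair_pointwiseConnection hess hs h1,
    norm_pointwiseConnection_le hess hs h1,
    isOdd_pointwiseConnection hess hs h1 hF.equivariant hodd,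
    pointwiseConnection_equivariant hess hs h1 hF.equivariant,
    isConnection_pointwiseConnection hess hs h1 hA hF hodd hc,
    fun f => ⟨CcSpace.pointwise γ F₀ f, fun g => rfl, ?_⟩⟩
  rw [repUnitary_pointwiseConnection, LinearIsometryEquiv.apply_symm_apply, L2.pointwise_of]
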